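/- Let $C$ be an algebraically closed field of characteristic $0$, $R=C[[t]]$, and let $\tau\subset C$ be a set of representatives of $C/\mathbb Z$ with $\tau\cap\mathbb Z=\{0\}$. For a commutative ring $A$ let $\vartheta=x\frac{d}{dx}$ on $A((x))=A[[x]][x^{-1}]$. A connection over $A((x))$ is a finite $A((x))$-module $E$ with an additive map $\nabla:E\to E$ such that $\nabla(fe)=\vartheta(f)e+f\nabla(e)$ (so $\nabla$ is $A$-linear). It is regular singular if it has a logarithmic model, i.e. a finitely generated $\nabla$-stable $A[[x]]$-submodule $\mathcal E\subset E$ with $\mathcal E[x^{-1}]=E$. For $A=C$, such an $\mathcal E$ is a Deligne–Manin lattice with respect to $\tau$ if all eigenvalues of the residue of $\nabla$ on $\mathcal E/x\mathcal E$ lie in $\tau$. Regular singular part. Let $(E,\nabla)$ be a connection over $C((x))$. For $s\ge 1$ let $x_s^s=x$, extend $\vartheta$ to $C((x_s))$ by $s^{-1}x_s\frac{d}{dx_s}$, and let $E_{(s)}=C((x_s))\otimes_{C((x))}E$ with the induced connection. A Turrittin–Levelt–Jordan decomposition over $C((x_s))$ is a decomposition $E_{(s)}=\bigoplus_{i}E_i$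 with finitely many $f_i\in C((x_s))$, pairwise distinct modulo $\{u^{-1}\vartheta(u): u\in C((x_s)),\,u\neq0\}$, where $E_i$ is the $C((x_s))$-subspace generated by $\bigcup_q\ker(\nabla-f_i)^q$. A regular singular part of $\nabla$ is a regular singular connection $\nabla^{\rm rs}$ on the $C((x))$-space $E$ such that for some $s$ and some such decomposition, $\nabla-\nabla^{\rm rs}$ acts on each $E_i$ as multiplication by the principal part $\mathrm p(f_i)$ of $f_i$ (its terms with negative exponents in $x_s$). Let $(E,\nabla)$ be a connection over $R((x))$ (possibly with $t$-torsion). For $\ell\ge0$ let $(E|_\ell,\nabla|_\ell)$ be the connection induced on $E|_\ell=E/t^{\ell+1}E$, regarded as a connection over $C((x))$ with an action of $R_\ell=R/(t^{\ell+1})$. Then: (1) For every $\ell$, $\nabla|_\ell$ has a unique regular singular part $\nabla|_\ell^{\rm rs}$. (2) The $(E|_\ell,\nabla|_\ell^{\rm rs})$ form a compatible system: $\nabla|_\ell^{\rm rs}$ is $R_\ell$-linear, and the projection $E|_{\ell+1}\to E|_\ell$ (which induces $(E|_{\ell+1})|_\ell\cong E|_\ell$) carries $\nabla|_{\ell+1}^{\rm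 rs}$ to $\nabla|_\ell^{\rm rs}$. (3) There is a regular singular connection $(\dot E,\dot\nabla)$ over $R((x))$ with $R((x))$-linear isomorphisms $\theta_\ell:(\dot E,\dot\nabla)|_\ell\cong(E|_\ell,\nabla|_\ell^{\rm rs})$ for all $\ell$, compatible with the connections and with the projections from level $\ell+1$ to level $\ell$. Moreover $(\dot E,\dot\nabla)$ is the limit of the system: there are Deligne–Manin lattices $\mathcal E_\ell$ of $(E|_\ell,\nabla|_\ell^{\rm rs})$ with respect to $\tau$ and a logarithmic model $\mathcal E$ of $(\dot E,\dot\nabla)$ such that $\theta_\ell$ maps the image of $\mathcal E$ in $\dot E|_\ell$ onto $\mathcal E_\ell$ for every $\ell$, and the resulting map $\mathcal E\to\varprojlim_\ell\mathcal E_\ell$ is bijective. -/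

import Mathlib

open scoped PowerSeries LaurentSeries TensorProduct

universe u v w

noncomputable section

namespace RegSing

/-! ## Connections over a ring with a derivation -/

/-- An additive map `δ : K → K` with `δ (f g) = δ(f) g + f δ(g)`. -/
structure Deriv (K : Type u) [CommRing K] extends K →+ K where
  leibniz' : ∀ f g : K, toFun (f * g) = toFun f * g + f * toFun g

namespace Deriv

variable {K : Type u} [CommRing K]

instance : FunLike (Deriv K) K K where
  coe δ := δ.toFun
  coe_injective δ δ' h := by
    cases δ; cases δ'; congr; exact DFunLike.coe_injective h

instance : AddMonoidHomClass (Deriv K) K K where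
  map_add δ := δ.map_add'
  map_zero δ := δ.map_zero'

theorem leibniz (δ : Deriv K) (f g : K) : δ (f * g) = δ f * g + f * δ g := δ.leibniz' f g

/-- The multiple `c δ` of a derivation. -/
def scale (c : K) (δ : Deriv K) : Deriv K where
  toFun f := c * δ f
  map_zero' := by simp
  map_add' f g := by rw [map_add, mul_add]
  leibniz' f g := by rw [δ.leibniz]; ring

end Deriv

/-- A connection on the `K`-module `E` relative to the derivation `δ` of `K`: an additive map
`∇ : E → E` with `∇ (f e) = δ(f) e + f ∇ e`. Linearity over the constants of `δ` is automatic, see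
`Connection.map_const_smul`. -/
structure Connection {K : Type u} [CommRing K] (δ : Deriv K)
    (E : Type v) [AddCommGroup E] [Module K E] extends E →+ E where
  leibniz' : ∀ (f : K) (e : E), toFun (f • e) = δ f • e + f • toFun e

namespace Connection

variable {K : Type u} [CommRing K] {δ : Deriv K}
  {E : Type v} [AddCommGroup E] [Module K E]

instance : FunLike (Connection δ E) E E where
  coe D := D.toFun
  coe_injective D D' h := by
    cases D; cases D'; congr; exact DFunLike.coe_injective h

instance : AddMonoidHomClass (Connection δ E) E E where
  map_add D := D.map_add'
  map_zero D := D.map_zero'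

theorem leibniz (D : Connection δ E) (f : K) (e : E) : D (f • e) = δ f • e + f • D e :=
  D.leibniz' f e

theorem map_const_smul (D : Connection δ E) {f : K} (hf : δ f = 0) (e : E) :
    D (f • e) = f • D e := by
  rw [D.leibniz, hf, zero_smul, zero_add]

/-- The additive map `g ⊗ e ↦ δ'(g) ⊗ e + g ⊗ ∇ e` on `K' ⊗ E`. -/
def baseChangeHom {K' : Type w} [CommRing K'] [Algebra K K'] (δ' : Deriv K')
    (hδ : ∀ f : K, δ' (algebraMap K K' f) = algebraMap K K' (δ f)) (D : Connection δ E) :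
    K' ⊗[K] E →+ K' ⊗[K] E :=
  TensorProduct.liftAddHom
    { toFun := fun g =>
        { toFun := fun e => δ' g ⊗ₜ[K] e + g ⊗ₜ[K] D e
          map_zero' := by simp
          map_add' := fun e e' => by
            simp only [map_add, TensorProduct.tmul_add]; abel }
      map_zero' := by ext e; simp
      map_add' := fun g g' => by
        ext e
        simp only [map_add, TensorProduct.add_tmul, AddMonoidHom.coe_mk, ZeroHom.coe_mk,
          AddMonoidHom.add_apply]
        abel }
    (by
      intro r g e
      have h1 : δ' (r • g) = δ r • g + r • δ' g := by
        simp only [Algebra.smul_def, δ'.leibniz, hδ]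
      simp only [AddMonoidHom.coe_mk, ZeroHom.coe_mk, h1, D.leibniz, TensorProduct.tmul_add,
        TensorProduct.add_tmul, TensorProduct.smul_tmul]
      abel)

theorem baseChangeHom_tmul {K' : Type w} [CommRing K'] [Algebra K K'] (δ' : Deriv K')
    (hδ : ∀ f : K, δ' (algebraMap K K' f) = algebraMap K K' (δ f)) (D : Connection δ E)
    (g : K') (e : E) :
    D.baseChangeHom δ' hδ (g ⊗ₜ e) = δ' g ⊗ₜ[K] e + g ⊗ₜ[K] D e := rfl

/-- Extension of scalars: `∇ (g ⊗ e) = δ'(g) ⊗ e + g ⊗ ∇ e` on `K' ⊗ E`. -/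
def baseChange {K' : Type w} [CommRing K'] [Algebra K K'] (δ' : Deriv K')
    (hδ : ∀ f : K, δ' (algebraMap K K' f) = algebraMap K K' (δ f)) (D : Connection δ E) :
    Connection δ' (K' ⊗[K] E) where
  toAddMonoidHom := D.baseChangeHom δ' hδ
  leibniz' := by
    intro f z
    change D.baseChangeHom δ' hδ (f • z) = δ' f • z + f • D.baseChangeHom δ' hδ z
    induction z using TensorProduct.induction_on with
    | zero => simp
    | tmul g e =>
      simp only [TensorProduct.smul_tmul', baseChangeHom_tmul, smul_eq_mul, δ'.leibniz,
        TensorProduct.add_tmul, smul_add]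
      abel
    | add z z' hz hz' =>
      simp only [smul_add, map_add, hz, hz']
      abel

/-- The submodule generated by the vectors killed by a power of `∇ - f`, i.e. by
`ker (∇ - f)^q` for `q` large. -/
def isotypic (D : Connection δ E) (f : K) : Submodule K E :=
  Submodule.span K {e : E | ∃ q : ℕ, (fun w : E => D w - f • w)^[q] e = 0}

end Connection

/-! ## Laurent series -/

/-- The derivation `ϑ = x d/dx` of `A((x))`: `∑ aₙ xⁿ ↦ ∑ n aₙ xⁿ`. -/
def theta (A : Type u) [CommRing A] : Deriv A⸨X⸩ where
  toFun f :=
    { coeff := fun n => (n : A) * f.coeff n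
      isPWO_support' := f.isPWO_support.mono fun n hn h => hn (by simp [h]) }
  map_zero' := by ext n; simp
  map_add' f g := by ext n; simp [mul_add]
  leibniz' f g := by
    have hs : ∀ (h k : A⸨X⸩), (∀ n : ℤ, k.coeff n = n * h.coeff n) → k.support ⊆ h.support :=
      fun h k hk n hn h0 => hn (by simp [hk, h0])
    ext n
    simp only [HahnSeries.coeff_add]
    rw [HahnSeries.coeff_mul, HahnSeries.coeff_mul_right' g.isPWO_support (hs g ⟨_, _⟩ fun _ => rfl),
      HahnSeries.coeff_mul_left' f.isPWO_support (hs f ⟨_, _⟩ fun _ => rfl), Finset.mul_sum,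
      ← Finset.sum_add_distrib]
    refine Finset.sum_congr rfl fun ij hij => ?_
    rw [Finset.mem_antidiagonal] at hij
    rw [← hij.2.2]
    push_cast
    ring

theorem theta_coeff {A : Type u} [CommRing A] (f : A⸨X⸩) (n : ℤ) :
    (theta A f).coeff n = n * f.coeff n := rfl

theorem theta_C {A : Type u} [CommRing A] (a : A) : theta A (HahnSeries.C a) = 0 := by
  ext n
  rw [theta_coeff]
  by_cases h : n = 0
  · simp [h]
  · simp [HahnSeries.coeff_single_of_ne h]

/-- The element `x` of `A((x))`. -/
def xElt (A : Type u) [CommRing A] : A⸨X⸩ := HahnSeries.single 1 1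

/-- The principal part `∑_{k<0} f_k x^k` of `f = ∑ f_k x^k`. -/
def principalPart {A : Type u} [CommRing A] (f : A⸨X⸩) : A⸨X⸩ := HahnSeries.truncLT 0 f

/-! ## Logarithmic models, regular singular connections, exponents -/

section Log

variable {A : Type u} [CommRing A] {E : Type v} [AddCommGroup E] [Module A⸨X⸩ E]

/-- A logarithmic model of `(E, ∇)`, realised inside `E`: a finitely generated
`A[[x]]`-submodule, stable under `∇`, that becomes `E` once `x` is inverted. (For an abstract
finite `A[[x]]`-module `𝓔` with logarithmic connection and `𝓔[1/x] ≅ E`, the image of `𝓔` in `E` is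
such a submodule; conversely `L[1/x] = E` for a submodule `L` as here.) -/
structure LogModel (D : Connection (theta A) E) where
  carrier : AddSubgroup E
  smul_mem : ∀ (f : A⟦X⟧) (e : E), e ∈ carrier → HahnSeries.ofPowerSeries ℤ A f • e ∈ carrier
  fg : ∃ (n : ℕ) (g : Fin n → E), (∀ i, g i ∈ carrier) ∧
    ∀ e ∈ carrier, ∃ a : Fin n → A⟦X⟧, e = ∑ i, HahnSeries.ofPowerSeries ℤ A (a i) • g i
  stable : ∀ e ∈ carrier, D e ∈ carrier
  spans : ∀ e : E, ∃ n : ℕ, xElt A ^ n • e ∈ carrier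

/-- A connection over `A((x))` is regular singular if it has a logarithmic model. -/
def IsRegularSingular (D : Connection (theta A) E) : Prop := Nonempty (LogModel D)

/-- `c` is an exponent of the model `L`: an eigenvalue of the residue, i.e. of the endomorphism
of `L / x L` induced by `∇`. -/
def LogModel.IsExponent {D : Connection (theta A) E} (L : LogModel D) (c : A) : Prop :=
  ∃ e ∈ L.carrier, (¬ ∃ e' ∈ L.carrier, e = xElt A • e') ∧
    ∃ e' ∈ L.carrier, D e - (HahnSeries.C c : A⸨X⸩) • e = xElt A • e'

/-- `L` is a Deligne-Manin lattice with respect to `τ`: all exponents lie in `τ`. -/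
def LogModel.IsDeligneManin {D : Connection (theta A) E} (L : LogModel D) (τ : Set A) : Prop :=
  ∀ c : A, L.IsExponent c → c ∈ τ

end Log

/-! ## The field `C((x_s))` with `x_s ^ s = x` -/

/-- `C((x_s))`, the field of Laurent series in the variable `x_s`, regarded as an extension of
`C((x))` through `x ↦ x_s ^ s`. -/
def Ramified (C : Type u) (_s : ℕ+) [Field C] : Type u := C⸨X⸩

section Ramified

variable (C : Type u) [Field C] (s : ℕ+)

instance : Field (Ramified C s) := inferInstanceAs (Field C⸨X⸩)

/-- The map `∑ aₙ xⁿ ↦ ∑ aₙ x^{sn}`. -/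
def ramify : C⸨X⸩ →+* C⸨X⸩ :=
  HahnSeries.embDomainRingHom (AddMonoidHom.mulLeft ((s : ℕ) : ℤ))
    (fun a b h => by simpa using h)
    (fun a b => by simp)

theorem ramify_coeff_mul (f : C⸨X⸩) (m : ℤ) :
    (ramify C s f).coeff (((s : ℕ) : ℤ) * m) = f.coeff m :=
  HahnSeries.embDomain_coeff (a := m)

theorem ramify_coeff_eq_zero (f : C⸨X⸩) {n : ℤ} (h : ¬ ∃ m : ℤ, ((s : ℕ) : ℤ) * m = n) :
    (ramify C s f).coeff n = 0 :=
  HahnSeries.embDomain_of_notMem_range (by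
    rintro ⟨m, hm⟩
    exact h ⟨m, hm⟩)

/-- `C((x_s))` is an extension of `C((x))` through `∑ aₙ xⁿ ↦ ∑ aₙ x_s^{sn}`. -/
instance : Algebra C⸨X⸩ (Ramified C s) :=
  RingHom.toAlgebra (show C⸨X⸩ →+* Ramified C s from ramify C s)

theorem scale_theta_ramify [CharZero C] (f : C⸨X⸩) :
    (theta C).scale (HahnSeries.C (((s : ℕ) : C)⁻¹)) (ramify C s f) =
      ramify C s (theta C f) := by
  have hs : ((s : ℕ) : C) ≠ 0 := by exact_mod_cast s.pos.ne'
  change (HahnSeries.C (((s : ℕ) : C)⁻¹) : C⸨X⸩) * theta C (ramify C s f) = _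
  ext n
  rw [HahnSeries.C_mul_eq_smul, HahnSeries.coeff_smul, theta_coeff, smul_eq_mul]
  by_cases h : ∃ m : ℤ, ((s : ℕ) : ℤ) * m = n
  · obtain ⟨m, rfl⟩ := h
    rw [ramify_coeff_mul, ramify_coeff_mul, theta_coeff]
    push_cast
    field_simp
  · rw [ramify_coeff_eq_zero C s f h, ramify_coeff_eq_zero C s _ h, mul_zero, mul_zero]

/-- The derivation `s⁻¹ x_s d/dx_s` of `C((x_s))`, which extends `ϑ`. -/
def thetaRam : Deriv (Ramified C s) :=
  show Deriv C⸨X⸩ from (theta C).scale (HahnSeries.C (((s : ℕ) : C)⁻¹))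

theorem thetaRam_algebraMap [CharZero C] (f : C⸨X⸩) :
    thetaRam C s (algebraMap C⸨X⸩ (Ramified C s) f) =
      algebraMap C⸨X⸩ (Ramified C s) (theta C f) :=
  scale_theta_ramify C s f

/-- The principal part `∑_{k<0} f_k x_s^k` of `f ∈ C((x_s))`. -/
def principalPartRam (f : Ramified C s) : Ramified C s :=
  show C⸨X⸩ from principalPart (show C⸨X⸩ from f)

/-- Logarithmic derivatives `u⁻¹ ϑ(u)`, `u ∈ C((x_s))` nonzero. -/
def dLog : Set (Ramified C s) := {g | ∃ u : Ramified C s, u ≠ 0 ∧ g = u⁻¹ * thetaRam C s u}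

variable {C}

/-- The connection `(E, ∇)_(s)` on `E_(s) = C((x_s)) ⊗ E`. -/
def Connection.ram [CharZero C] {E : Type v} [AddCommGroup E] [Module C⸨X⸩ E]
    (D : Connection (theta C) E) : Connection (thetaRam C s) (Ramified C s ⊗[C⸨X⸩] E) :=
  D.baseChange (thetaRam C s) (thetaRam_algebraMap C s)

end Ramified

/-! ## The regular singular part of a connection over `C((x))` -/

section RegularSingularPart

variable {C : Type u} [Field C] [CharZero C] {E : Type v} [AddCommGroup E] [Module C⸨X⸩ E]

/-- The family `f` of elements of `C((x_s))` gives a Turrittin-Levelt-Jordan decomposition of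
`(E, ∇)` over `C((x_s))`: the `f i` have distinct classes modulo logarithmic derivatives, and
`E_(s)` is the direct sum of the subspaces generated by `ker (∇ - f i)^q`, `q` large. -/
structure IsTLJ (D : Connection (theta C) E) (s : ℕ+) {m : ℕ} (f : Fin m → Ramified C s) :
    Prop where
  distinct : ∀ i j, i ≠ j → f i - f j ∉ dLog C s
  isInternal : DirectSum.IsInternal fun i => (D.ram s).isotypic (f i)

/-- `D'` is the regular singular part of the connection `D`: both are connections on `E`,
`D'` is regular singular, and over some `C((x_s))` over which `D` has a
Turrittin-Levelt-Jordan decomposition, `D - D'` is multiplication by the principal part of `f i` on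
the component of type `f i`. In particular `D - D'` is diagonalizable over `C((x_s))`, with
eigenvalues in `x_s⁻¹ C[x_s⁻¹]`. -/
def IsRegularSingularPart (D D' : Connection (theta C) E) : Prop :=
  IsRegularSingular D' ∧
    ∃ (s : ℕ+) (m : ℕ) (f : Fin m → Ramified C s), IsTLJ D s f ∧
      ∀ i, ∀ e ∈ (D.ram s).isotypic (f i),
        D.ram s e - D'.ram s e = principalPartRam C s (f i) • e

end RegularSingularPart

/-! ## Reduction modulo `t ^ (ℓ + 1)` of connections over `R((x))`, `R = C[[t]]` -/

section Reduction

variable (C : Type u) [Field C]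

/-- The element `t ∈ R = C[[t]]`, as a constant of `R((x))`. -/
def tElt : (C⟦X⟧)⸨X⸩ := HahnSeries.C (PowerSeries.X : C⟦X⟧)

/-- The inclusion `C((x)) → R((x))`, coefficientwise `C → R = C[[t]]`. -/
def inclC : C⸨X⸩ →+* (C⟦X⟧)⸨X⸩ where
  toFun f := f.map (PowerSeries.C : C →+* C⟦X⟧)
  map_one' := HahnSeries.map_one (PowerSeries.C : C →+* C⟦X⟧).toMonoidWithZeroHom
  map_mul' f g := HahnSeries.map_mul (PowerSeries.C : C →+* C⟦X⟧).toNonUnitalRingHom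
  map_zero' := by ext; simp
  map_add' f g := by ext; simp

theorem inclC_coeff (f : C⸨X⸩) (n : ℤ) : (inclC C f).coeff n = PowerSeries.C (f.coeff n) := rfl

theorem theta_inclC (f : C⸨X⸩) : theta (C⟦X⟧) (inclC C f) = inclC C (theta C f) := by
  ext n : 2
  rw [theta_coeff, inclC_coeff, inclC_coeff, theta_coeff, map_mul, map_intCast]

variable (E : Type v) [AddCommGroup E] [Module (C⟦X⟧)⸨X⸩ E]

/-- The submodule `t ^ (ℓ + 1) E`. -/
def tPow (ℓ : ℕ) : Submodule (C⟦X⟧)⸨X⸩ E :=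
  LinearMap.range (LinearMap.lsmul (C⟦X⟧)⸨X⸩ E (tElt C ^ (ℓ + 1)))

/-- The reduction `E|_ℓ = E / t ^ (ℓ + 1) E`. It is a module over `R((x))`, killed by
`t ^ (ℓ + 1)`, and a `C((x))`-vector space through `C((x)) → R((x))`. -/
def Reduction (ℓ : ℕ) : Type v := E ⧸ tPow C E ℓ

instance (ℓ : ℕ) : AddCommGroup (Reduction C E ℓ) := inferInstanceAs (AddCommGroup (E ⧸ tPow C E ℓ))

instance (ℓ : ℕ) : Module (C⟦X⟧)⸨X⸩ (Reduction C E ℓ) :=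
  inferInstanceAs (Module (C⟦X⟧)⸨X⸩ (E ⧸ tPow C E ℓ))

instance (ℓ : ℕ) : Module C⸨X⸩ (Reduction C E ℓ) :=
  Module.compHom (Reduction C E ℓ) (inclC C)

theorem Reduction.smul_def (ℓ : ℕ) (f : C⸨X⸩) (e : Reduction C E ℓ) :
    f • e = inclC C f • e := rfl

/-- The projection `E → E|_ℓ`. -/
def Reduction.mk (ℓ : ℕ) : E →ₗ[(C⟦X⟧)⸨X⸩] Reduction C E ℓ := (tPow C E ℓ).mkQ

theorem tPow_succ_le (ℓ : ℕ) : tPow C E (ℓ + 1) ≤ tPow C E ℓ := by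
  rintro _ ⟨e, rfl⟩
  exact ⟨tElt C • e, by simp only [LinearMap.lsmul_apply, smul_smul, ← pow_succ]⟩

/-- The projection `E|_{ℓ+1} → E|_ℓ`; it induces `(E|_{ℓ+1})|_ℓ ≅ E|_ℓ`. -/
def Reduction.transition (ℓ : ℕ) :
    Reduction C E (ℓ + 1) →ₗ[(C⟦X⟧)⸨X⸩] Reduction C E ℓ :=
  (tPow C E (ℓ + 1)).mapQ (tPow C E ℓ) LinearMap.id (tPow_succ_le C E ℓ)

variable {C E}

theorem Connection.map_tPow (D : Connection (theta (C⟦X⟧)) E) (ℓ : ℕ) {e : E}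
    (he : e ∈ tPow C E ℓ) : D e ∈ tPow C E ℓ := by
  obtain ⟨e, rfl⟩ := he
  refine ⟨D e, ?_⟩
  have : theta (C⟦X⟧) (tElt C ^ (ℓ + 1)) = 0 := by
    rw [tElt, ← map_pow, theta_C]
  simp [D.map_const_smul this]

/-- The connection `∇|_ℓ` on `E|_ℓ` induced by `∇`, over `C((x))`. -/
def Connection.reduce (D : Connection (theta (C⟦X⟧)) E) (ℓ : ℕ) :
    Connection (theta C) (Reduction C E ℓ) where
  toAddMonoidHom := QuotientAddGroup.map (tPow C E ℓ).toAddSubgroup (tPow C E ℓ).toAddSubgroup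
    D.toAddMonoidHom (fun _ he => D.map_tPow ℓ he)
  leibniz' := by
    intro f e
    induction e using Submodule.Quotient.induction_on with
    | H e =>
      change Reduction.mk C E ℓ (D (inclC C f • e)) =
        inclC C (theta C f) • Reduction.mk C E ℓ e + inclC C f • Reduction.mk C E ℓ (D e)
      rw [D.leibniz, theta_inclC, map_add, map_smul, map_smul]

theorem Connection.reduce_mk (D : Connection (theta (C⟦X⟧)) E) (ℓ : ℕ) (e : E) :
    D.reduce ℓ (Reduction.mk C E ℓ e) = Reduction.mk C E ℓ (D e) := rfl

/-- The connections `D ℓ` on the `E|_ℓ` form a compatible system: each commutes with the action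
of `R` (that is, of `R / t ^ (ℓ + 1)`), and the isomorphisms `(E|_{ℓ+1})|_ℓ ≅ E|_ℓ` are horizontal. -/
structure IsCompatibleSystem (D : ∀ ℓ : ℕ, Connection (theta C) (Reduction C E ℓ)) : Prop where
  linear : ∀ (ℓ : ℕ) (r : C⟦X⟧) (e : Reduction C E ℓ),
    D ℓ ((HahnSeries.C r : (C⟦X⟧)⸨X⸩) • e) = (HahnSeries.C r : (C⟦X⟧)⸨X⸩) • D ℓ e
  horizontal : ∀ (ℓ : ℕ) (e : Reduction C E (ℓ + 1)),
    Reduction.transition C E ℓ (D (ℓ + 1) e) = D ℓ (Reduction.transition C E ℓ e)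

/-- The `θ ℓ` are isomorphisms of the reductions of `(E', D')` with the `(E|_ℓ, D ℓ)`, compatible
with the action of `R((x))`, with the connections and with the projections. -/
structure IsReductionIso {E' : Type w} [AddCommGroup E'] [Module (C⟦X⟧)⸨X⸩ E']
    (D : ∀ ℓ : ℕ, Connection (theta C) (Reduction C E ℓ)) (D' : Connection (theta (C⟦X⟧)) E')
    (θ : ∀ ℓ : ℕ, Reduction C E' ℓ ≃ₗ[(C⟦X⟧)⸨X⸩] Reduction C E ℓ) : Prop where
  horizontal : ∀ (ℓ : ℕ) (e : Reduction C E' ℓ), θ ℓ (D'.reduce ℓ e) = D ℓ (θ ℓ e)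
  transition : ∀ (ℓ : ℕ) (e : Reduction C E' (ℓ + 1)),
    Reduction.transition C E ℓ (θ (ℓ + 1) e) = θ ℓ (Reduction.transition C E' ℓ e)

/-- `(E', D')` is, through the `θ ℓ`, the limit of the system `(E|_ℓ, D ℓ)`: there are
Deligne-Manin lattices `M ℓ` of the `(E|_ℓ, D ℓ)` with respect to `τ` and a logarithmic model `L` of
`(E', D')` such that `θ ℓ` maps the image of `L` in `E'|_ℓ` onto `M ℓ`, and `L` is the inverse limit
of the `M ℓ`. -/
def IsLimit (τ : Set C) {E' : Type w} [AddCommGroup E'] [Module (C⟦X⟧)⸨X⸩ E']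
    (D : ∀ ℓ : ℕ, Connection (theta C) (Reduction C E ℓ)) (D' : Connection (theta (C⟦X⟧)) E')
    (θ : ∀ ℓ : ℕ, Reduction C E' ℓ ≃ₗ[(C⟦X⟧)⸨X⸩] Reduction C E ℓ) : Prop :=
  ∃ (M : ∀ ℓ : ℕ, LogModel (D ℓ)) (L : LogModel D'),
    (∀ ℓ, (M ℓ).IsDeligneManin τ) ∧
    (∀ (ℓ : ℕ) (e : Reduction C E ℓ),
      e ∈ (M ℓ).carrier ↔ ∃ e' ∈ L.carrier, θ ℓ (Reduction.mk C E' ℓ e') = e) ∧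
    ∀ e : ∀ ℓ : ℕ, Reduction C E ℓ, (∀ ℓ, e ℓ ∈ (M ℓ).carrier) →
      (∀ ℓ, Reduction.transition C E ℓ (e (ℓ + 1)) = e ℓ) →
      ∃! e' : E', e' ∈ L.carrier ∧ ∀ ℓ, θ ℓ (Reduction.mk C E' ℓ e') = e ℓ

end Reduction

end RegSing

end

/-! Call a `C((x))`-linear map `S` on `E` an irregular part of `∇` if, over some `C((x_s))` where
generalized eigenvectors (vectors killed by a power of some `∇ - f`) span, `S` acts on those of type
`f` as the principal part `p(f)`. A logarithmic derivative has no principal part (`coeff_logDeriv`),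
so `p(f)` depends only on the class of `f`. Inequivalent types are independent
(`iSupIndep_typeSpan`), so `S` exists over `C((x_s))` once generalized eigenvectors span. It
descends to `C((x))` because principal parts commute with `x_s ↦ ζ x_s` (`exists_isIrregularPart`).
Horizontal maps preserve types, hence intertwine irregular parts (`IsIrregularPart.comm`). Applied
to the identity, to multiplication by `r ∈ R` and to the projections `E|_{ℓ+1} → E|_ℓ`, this gives
uniqueness, `R`-linearity and compatibility of the connections `∇|_ℓ - S_ℓ`.

Spanning is Turrittin's theorem (`exists_typeSpan_ram_eq_top`). Let `T` be the span of all
generalized eigenvectors in `E_(s)`. Since `C((x_s))` is the sum of image and kernel of every `ϑ +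
h` (`exists_delta_add`), the quotient `E_(s)/T` has no eigenvectors (`mem_typeSpan_univ_of_twist`).
It remains to see that, for suitable `s`, every horizontal map from `E` to a connection without
eigenvectors is zero (`exists_vanishing`). This property passes through extensions, so induction on
the dimension leaves the irreducible case. A cyclic vector and a twist give a companion matrix of
trace zero. If it has no poles, a power series recursion produces an eigenvector
(`exists_eigenvector_of_integral`). If it has poles, a ramified shearing yields a leading matrix
with at least two eigenvalues, and the connection splits off a proper subspace
(`exists_ramified_isStable`).

The connection `∇ - S` has generalized eigenvectors of constant type only, so it has a basis with
constant matrix and eigenvalues in `τ` (`exists_eulerBasis`); this basis generates a Deligne–Manin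
lattice. As distinct elements of `τ` never differ by an integer, a Sylvester equation forces
horizontal maps to have constant matrices in such bases (`exists_matrix`). They are therefore strict
for the lattices: a lattice vector in the image comes from a lattice vector. Strictness makes the
lattices a `t`-adic system with surjective transitions and kernels `t^{ℓ+1} M_{ℓ+1}`
(`isAdicSystem_lattice`). Successive approximation in `t` then shows that the limit is finitely
generated over `R[[x]]` and reduces to the given lattices, and inverting `x` gives `(Ė, ∇̇)`. -/

noncomputable section
namespace RegSing

namespace Connection

/-! ### Twists, generalized eigenvectors, stable submodules and induced connections -/

section General

variable {K : Type u} [CommRing K] {δ : Deriv K} {E : Type v} [AddCommGroup E] [Module K E]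

/-- The connection `∇ - f`. -/
def twist (D : Connection δ E) (f : K) : Connection δ E where
  toFun e := D e - f • e
  map_zero' := by simp
  map_add' a b := by rw [map_add, smul_add]; abel
  leibniz' g e := by rw [D.leibniz, smul_sub, smul_smul, smul_smul, mul_comm f g]; abel

theorem twist_apply (D : Connection δ E) (f : K) (e : E) : D.twist f e = D e - f • e := rfl

theorem iterate_zero_vec (D : Connection δ E) (q : ℕ) : (D)^[q] (0 : E) = 0 := by
  induction q with
  | zero => rfl
  | succ q ih => rw [Function.iterate_succ_apply, map_zero, ih]

/-- The vectors killed by a power of `∇ - f`. -/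
def genEigen (D : Connection δ E) (f : K) : Set E := {e | ∃ q : ℕ, (D.twist f)^[q] e = 0}

theorem genEigen_iterate_le {D : Connection δ E} {e : E} {q r : ℕ} (hqr : q ≤ r)
    (h : (D)^[q] e = 0) : (D)^[r] e = 0 := by
  obtain ⟨k, rfl⟩ := Nat.exists_eq_add_of_le' hqr
  rw [Function.iterate_add_apply, h, iterate_zero_vec]

theorem isotypic_eq_span (D : Connection δ E) (f : K) :
    D.isotypic f = Submodule.span K (D.genEigen f) := rfl

theorem iterate_map_add (D : Connection δ E) (q : ℕ) (a b : E) :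
    (D)^[q] (a + b) = (D)^[q] a + (D)^[q] b := by
  induction q generalizing a b with
  | zero => rfl
  | succ q ih => simp only [Function.iterate_succ_apply, map_add, ih]

theorem genEigen_add {D : Connection δ E} {f : K} {a b : E} (ha : a ∈ D.genEigen f)
    (hb : b ∈ D.genEigen f) : a + b ∈ D.genEigen f := by
  obtain ⟨q, hq⟩ := ha
  obtain ⟨r, hr⟩ := hb
  refine ⟨max q r, ?_⟩
  rw [iterate_map_add, genEigen_iterate_le (le_max_left _ _) hq,
    genEigen_iterate_le (le_max_right _ _) hr, add_zero]

theorem genEigen_zero (D : Connection δ E) (f : K) : (0 : E) ∈ D.genEigen f := ⟨0, rfl⟩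

theorem genEigen_of_twist {D : Connection δ E} {f : K} {e : E} (h : D.twist f e ∈ D.genEigen f) :
    e ∈ D.genEigen f := by
  obtain ⟨q, hq⟩ := h
  exact ⟨q + 1, by rwa [Function.iterate_succ_apply]⟩

theorem twist_mem_genEigen {D : Connection δ E} {f : K} {e : E} (h : e ∈ D.genEigen f) :
    D.twist f e ∈ D.genEigen f := by
  obtain ⟨q, hq⟩ := h
  exact ⟨q, by rw [← Function.iterate_succ_apply, Function.iterate_succ_apply', hq, map_zero]⟩

/-- Stability of a submodule under a connection. -/
def IsStable (D : Connection δ E) (W : Submodule K E) : Prop := ∀ e ∈ W, D e ∈ W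

theorem IsStable.twist {D : Connection δ E} {W : Submodule K E} (h : D.IsStable W) (f : K) :
    (D.twist f).IsStable W := fun e he => W.sub_mem (h e he) (W.smul_mem f he)

theorem IsStable.of_twist {D : Connection δ E} {W : Submodule K E} {f : K}
    (h : (D.twist f).IsStable W) : D.IsStable W := fun e he => by
  have := W.add_mem (h e he) (W.smul_mem f he)
  rwa [twist_apply, sub_add_cancel] at this

theorem isStable_span {D : Connection δ E} {S : Set E}
    (h : ∀ e ∈ S, D e ∈ Submodule.span K S) : D.IsStable (Submodule.span K S) := by
  intro e he
  induction he using Submodule.span_induction with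
  | mem x hx => exact h x hx
  | zero => rw [map_zero]; exact Submodule.zero_mem _
  | add x y _ _ hx hy => rw [map_add]; exact Submodule.add_mem _ hx hy
  | smul a x hx' hx =>
    rw [D.leibniz]
    exact Submodule.add_mem _ (Submodule.smul_mem _ _ hx') (Submodule.smul_mem _ _ hx)

theorem isStable_span_singleton {D : Connection δ E} {v : E} {f : K} (h : D v = f • v) :
    D.IsStable (Submodule.span K {v}) := by
  refine isStable_span fun e he => ?_
  rw [Set.mem_singleton_iff] at he
  rw [he, h]
  exact Submodule.smul_mem _ _ (Submodule.mem_span_singleton_self v)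

/-- The connection induced on a stable submodule. -/
def restrict (D : Connection δ E) (W : Submodule K E) (h : D.IsStable W) : Connection δ W where
  toFun e := ⟨D e, h e e.2⟩
  map_zero' := by ext; simp
  map_add' a b := by ext; simp
  leibniz' f e := by ext; simp [D.leibniz]

/-- The connection induced on the quotient by a stable submodule. -/
def quotient (D : Connection δ E) (W : Submodule K E) (h : D.IsStable W) :
    Connection δ (E ⧸ W) where
  toAddMonoidHom := QuotientAddGroup.map W.toAddSubgroup W.toAddSubgroup D.toAddMonoidHom h
  leibniz' := by
    intro f e
    induction e using Submodule.Quotient.induction_on with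
    | H e =>
      change W.mkQ (D (f • e)) = δ f • W.mkQ e + f • W.mkQ (D e)
      rw [D.leibniz, map_add, map_smul, map_smul]

theorem quotient_mk (D : Connection δ E) (W : Submodule K E) (h : D.IsStable W) (e : E) :
    D.quotient W h (W.mkQ e) = W.mkQ (D e) := rfl

end General

/-! ### Spans of generalized eigenvectors over a differential field -/

section Field

variable {K : Type u} [Field K] {δ : Deriv K} {E : Type v} [AddCommGroup E] [Module K E]

/-- The span of the vectors killed by a power of `∇ - f` for some `f ∈ Φ`. -/
def typeSpan (D : Connection δ E) (Φ : Set K) : Submodule K E :=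
  Submodule.span K {e | ∃ f ∈ Φ, e ∈ D.genEigen f}

/-- Iterated extensions of subspaces generated by one vector horizontal for some `∇ - f`, `f ∈ Φ`,
modulo the previous subspace. -/
inductive IsFlag (D : Connection δ E) (Φ : Set K) : Submodule K E → Prop
  | bot : IsFlag D Φ ⊥
  | step (F : Submodule K E) (u : E) (f : K) : IsFlag D Φ F → f ∈ Φ → D.twist f u ∈ F →
      IsFlag D Φ (F ⊔ Submodule.span K {u})

theorem IsFlag.sup {D : Connection δ E} {Φ : Set K} {F G : Submodule K E} (hF : IsFlag D Φ F)
    (hG : IsFlag D Φ G) : IsFlag D Φ (F ⊔ G) := by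
  induction hG with
  | bot => rwa [sup_bot_eq]
  | step G u f _ hf hu ih =>
    rw [← sup_assoc]
    exact .step _ _ f ih hf (le_sup_right (a := F) hu)

theorem exists_isFlag_of_genEigen {D : Connection δ E} {Φ : Set K} {f : K} (hf : f ∈ Φ) {e : E}
    (he : e ∈ D.genEigen f) : ∃ F, IsFlag D Φ F ∧ e ∈ F := by
  obtain ⟨q, hq⟩ := he
  induction q generalizing e with
  | zero => exact ⟨⊥, .bot, hq⟩
  | succ q ih =>
    obtain ⟨F, hF, h⟩ := ih hq
    exact ⟨_, .step F e f hF hf h, le_sup_right (a := F) (Submodule.mem_span_singleton_self e)⟩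

theorem exists_isFlag {D : Connection δ E} {Φ : Set K} {e : E} (he : e ∈ D.typeSpan Φ) :
    ∃ F, IsFlag D Φ F ∧ e ∈ F := by
  induction he using Submodule.span_induction with
  | mem x hx =>
    obtain ⟨f, hf, hx⟩ := hx
    exact exists_isFlag_of_genEigen hf hx
  | zero => exact ⟨⊥, .bot, rfl⟩
  | add x y _ _ hx hy =>
    obtain ⟨F, hF, hx⟩ := hx
    obtain ⟨G, hG, hy⟩ := hy
    exact ⟨F ⊔ G, hF.sup hG, Submodule.add_mem _ (le_sup_left (a := F) hx) (le_sup_right (a := F) hy)⟩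
  | smul a x _ hx =>
    obtain ⟨F, hF, hx⟩ := hx
    exact ⟨F, hF, F.smul_mem a hx⟩

theorem IsFlag.isStable {D : Connection δ E} {Φ : Set K} {F : Submodule K E} (hF : IsFlag D Φ F) :
    D.IsStable F := by
  induction hF with
  | bot => intro e he; rw [Submodule.mem_bot] at he ⊢; rw [he, map_zero]
  | step F u f _ _ hu ih =>
    intro e he
    obtain ⟨a, ha, b, hb, rfl⟩ := Submodule.mem_sup.1 he
    obtain ⟨c, rfl⟩ := Submodule.mem_span_singleton.1 hb
    have h1 : D u ∈ F ⊔ Submodule.span K {u} := by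
      have : D u = D.twist f u + f • u := by rw [twist_apply, sub_add_cancel]
      rw [this]
      exact Submodule.add_mem_sup hu (Submodule.smul_mem _ _ (Submodule.mem_span_singleton_self u))
    rw [map_add, D.leibniz]
    exact Submodule.add_mem _ (le_sup_left (b := Submodule.span K {u}) (ih a ha))
      (Submodule.add_mem _ (Submodule.smul_mem _ _
        (le_sup_right (a := F) (Submodule.mem_span_singleton_self u))) (Submodule.smul_mem _ _ h1))

/-- At the first step where `W` meets the flag, `W` contains some `a + c u` with `a ∈ F` and `c ≠
0`. After division by `c`, applying `∇ - f` lands in `W ⊓ F = 0`. Working with flags avoids any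
finiteness assumption on `E`. -/
theorem IsFlag.exists_eigenvector {D : Connection δ E} {Φ : Set K} {F : Submodule K E}
    (hF : IsFlag D Φ F) {W : Submodule K E} (hW : D.IsStable W) (h : W ⊓ F ≠ ⊥) :
    ∃ f ∈ Φ, ∃ v ∈ W, v ≠ 0 ∧ D v = f • v := by
  induction hF with
  | bot => simp at h
  | step F u f hF hf hu ih =>
    by_cases h0 : W ⊓ F = ⊥
    · obtain ⟨e, he, hne⟩ := Submodule.exists_mem_ne_zero_of_ne_bot h
      obtain ⟨heW, heF⟩ := he
      obtain ⟨a, ha, b, hb, rfl⟩ := Submodule.mem_sup.1 heF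
      obtain ⟨c, rfl⟩ := Submodule.mem_span_singleton.1 hb
      have hc : c ≠ 0 := by
        rintro rfl
        rw [zero_smul, add_zero] at heW hne
        exact hne ((Submodule.eq_bot_iff _).1 h0 a ⟨heW, ha⟩)
      refine ⟨f, hf, c⁻¹ • (a + c • u), W.smul_mem _ heW, smul_ne_zero (inv_ne_zero hc) hne, ?_⟩
      have h1 : D.twist f (c⁻¹ • (a + c • u)) ∈ W ⊓ F := by
        refine ⟨hW.twist f _ (W.smul_mem _ heW), ?_⟩
        rw [smul_add, smul_smul, inv_mul_cancel₀ hc, one_smul, map_add]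
        exact F.add_mem (hF.isStable.twist f _ (F.smul_mem _ ha)) hu
      rw [h0, Submodule.mem_bot, twist_apply, sub_eq_zero] at h1
      exact h1
    · exact ih h0

theorem exists_eigenvector_of_mem_typeSpan {D : Connection δ E} {Φ : Set K} {W : Submodule K E}
    (hW : D.IsStable W) {e : E} (heW : e ∈ W) (he : e ∈ D.typeSpan Φ) (hne : e ≠ 0) :
    ∃ f ∈ Φ, ∃ v ∈ W, v ≠ 0 ∧ D v = f • v := by
  obtain ⟨F, hF, heF⟩ := exists_isFlag he
  exact hF.exists_eigenvector hW fun h => hne ((Submodule.eq_bot_iff _).1 h e ⟨heW, heF⟩)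

theorem isStable_typeSpan (D : Connection δ E) (Φ : Set K) : D.IsStable (D.typeSpan Φ) := by
  refine isStable_span ?_
  rintro e ⟨f, hf, he⟩
  have : D e = D.twist f e + f • e := by rw [twist_apply, sub_add_cancel]
  rw [this]
  exact Submodule.add_mem _ (Submodule.subset_span ⟨f, hf, twist_mem_genEigen he⟩)
    (Submodule.smul_mem _ _ (Submodule.subset_span ⟨f, hf, he⟩))

/-- An eigenvector in the span of type `Φ` has its eigenvalue congruent to an element of `Φ`
modulo logarithmic derivatives. -/
theorem exists_logDeriv_of_eigenvector {D : Connection δ E} {Φ : Set K} {v : E} {f : K}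
    (hv : v ∈ D.typeSpan Φ) (hne : v ≠ 0) (h : D v = f • v) :
    ∃ g ∈ Φ, ∃ k : K, k ≠ 0 ∧ g - f = k⁻¹ * δ k := by
  obtain ⟨g, hg, w, hw, hwne, hDw⟩ := exists_eigenvector_of_mem_typeSpan
    (isStable_span_singleton h) (Submodule.mem_span_singleton_self v) hv hne
  obtain ⟨k, rfl⟩ := Submodule.mem_span_singleton.1 hw
  have hk : k ≠ 0 := fun h0 => hwne (by rw [h0, zero_smul])
  refine ⟨g, hg, k, hk, ?_⟩
  rw [D.leibniz, h, smul_smul, smul_smul, ← add_smul] at hDw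
  have := smul_left_injective K hne hDw
  field_simp
  linear_combination -this

/-- If one span met the sum of the others, the intersection, being stable, would contain an
eigenvector `v` of eigenvalue `f`. Applying `∇ - f` to its decomposition gives a shorter relation,
so by induction all its components are eigenvectors for `f`. A nonzero one contradicts inequivalence
of the types. -/
theorem eq_zero_of_sum_typeSpan {ι : Type*} {D : Connection δ E} {Φ : ι → Set K}
    (hΦ : ∀ i j, i ≠ j → ∀ f ∈ Φ i, ∀ g ∈ Φ j, ¬ ∃ k : K, k ≠ 0 ∧ f - g = k⁻¹ * δ k)
    (s : Finset ι) (e : ι → E) (he : ∀ i ∈ s, e i ∈ D.typeSpan (Φ i))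
    (hsum : ∑ i ∈ s, e i = 0) : ∀ i ∈ s, e i = 0 := by
  classical
  induction s using Finset.induction_on generalizing e with
  | empty => simp
  | insert j s hj ih =>
    have hej : e j = 0 := by
      by_contra hne
      set W : Submodule K E := D.typeSpan (Φ j) ⊓ ⨆ i ∈ s, D.typeSpan (Φ i) with hWdef
      have hst : D.IsStable (⨆ i ∈ s, D.typeSpan (Φ i)) := by
        intro e he
        obtain ⟨μ, rfl⟩ := (Submodule.mem_iSup_finset_iff_exists_sum _ _).1 he
        rw [map_sum]
        exact Submodule.sum_mem _ fun i hi => Submodule.mem_iSup_of_mem i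
          (Submodule.mem_iSup_of_mem hi (isStable_typeSpan D _ _ (μ i).2))
      have hW : D.IsStable W := fun e he => ⟨isStable_typeSpan D _ _ he.1, hst e he.2⟩
      have hejW : e j ∈ W := by
        refine ⟨he j (Finset.mem_insert_self j s), ?_⟩
        rw [Finset.sum_insert hj, add_eq_zero_iff_eq_neg] at hsum
        rw [hsum]
        exact Submodule.neg_mem _ (Submodule.sum_mem _ fun i hi => Submodule.mem_iSup_of_mem i
          (Submodule.mem_iSup_of_mem hi (he i (Finset.mem_insert_of_mem hi))))
      obtain ⟨f, hf, v, hv, hvne, hDv⟩ := exists_eigenvector_of_mem_typeSpan hW hejW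
        (he j (Finset.mem_insert_self j s)) hne
      obtain ⟨μ, hμ⟩ := (Submodule.mem_iSup_finset_iff_exists_sum _ _).1 hv.2
      have h0 := ih (fun i => D.twist f (μ i))
        (fun i _ => (isStable_typeSpan D _).twist f _ (μ i).2)
        (by rw [← map_sum, hμ, twist_apply, hDv, sub_self])
      refine hvne ?_
      rw [← hμ]
      refine Finset.sum_eq_zero fun i hi => ?_
      by_contra hi0
      obtain ⟨g, hg, k, hk, hgf⟩ := exists_logDeriv_of_eigenvector (μ i).2 hi0
        (sub_eq_zero.1 (h0 i hi))
      exact hΦ i j (fun h => hj (h ▸ hi)) g hg f hf ⟨k, hk, hgf⟩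
    rw [Finset.sum_insert hj, hej, zero_add] at hsum
    intro i hi
    rcases Finset.mem_insert.1 hi with rfl | hi
    · exact hej
    · exact ih e (fun i hi => he i (Finset.mem_insert_of_mem hi)) hsum i hi

theorem iSupIndep_typeSpan {ι : Type*} {D : Connection δ E} {Φ : ι → Set K}
    (hΦ : ∀ i j, i ≠ j → ∀ f ∈ Φ i, ∀ g ∈ Φ j, ¬ ∃ k : K, k ≠ 0 ∧ f - g = k⁻¹ * δ k) :
    iSupIndep fun i => D.typeSpan (Φ i) := by
  rw [iSupIndep_iff_finsetSum_eq_zero_imp_eq_zero]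
  exact fun s e he => eq_zero_of_sum_typeSpan hΦ s e he

/-- If `K` is the sum of the image and the kernel of every `δ + h`, then the quotient by the span
of all generalized eigenvectors has no eigenvectors. -/
theorem mem_typeSpan_univ_of_twist {D : Connection δ E}
    (hδ : ∀ h k : K, ∃ a y : K, k = δ a + h * a + y ∧ δ y + h * y = 0) (g : K) (e : E)
    (he : D.twist g e ∈ D.typeSpan Set.univ) : e ∈ D.typeSpan Set.univ := by
  -- Modulo generalized eigenvectors of type `g`, the operator `∇ - g` is surjective on the span.
  -- Subtracting a preimage from `e` then leaves a generalized eigenvector.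
  have key : ∀ w ∈ D.typeSpan Set.univ, ∃ w' ∈ D.typeSpan Set.univ,
      w - D.twist g w' ∈ D.genEigen g := by
    intro w hw
    induction hw using Submodule.closure_induction with
    | zero => exact ⟨0, Submodule.zero_mem _, by rw [map_zero, sub_zero]; exact genEigen_zero D g⟩
    | add x y _ _ hx hy =>
      obtain ⟨x', hx', hx⟩ := hx
      obtain ⟨y', hy', hy⟩ := hy
      refine ⟨x' + y', Submodule.add_mem _ hx' hy', ?_⟩
      rw [map_add, add_sub_add_comm]
      exact genEigen_add hx hy
    | smul_mem k u hu =>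
      obtain ⟨f, -, q, hq⟩ := hu
      induction q generalizing k u with
      | zero =>
        obtain rfl : u = 0 := hq
        exact ⟨0, Submodule.zero_mem _, by simpa using genEigen_zero D g⟩
      | succ q ih =>
        -- `(∇ - g)(a u) = (δ a + (f - g) a) u + a (∇ - f) u`. The last term involves a vector of
        -- smaller nilpotency order, and `y u` has type `g` because `y` solves the homogeneous
        -- equation.
        obtain ⟨a, y, hk, hy⟩ := hδ (f - g) k
        obtain ⟨w', hw', h⟩ := ih (-a) (D.twist f u) hq
        refine ⟨a • u + w', Submodule.add_mem _ (Submodule.smul_mem _ _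
          (Submodule.subset_span ⟨f, trivial, q + 1, hq⟩)) hw', ?_⟩
        have hyu : y • u ∈ D.genEigen g := by
          refine ⟨q + 1, ?_⟩
          have : ∀ r, (D.twist g)^[r] (y • u) = y • (D.twist f)^[r] u := by
            intro r
            induction r with
            | zero => rfl
            | succ r ihr =>
              rw [Function.iterate_succ_apply', Function.iterate_succ_apply', ihr]
              simp only [twist_apply, D.leibniz, smul_sub, smul_smul]
              have : δ y = g * y - y * f := by linear_combination hy
              rw [this, sub_smul]
              abel
          rw [this, hq, smul_zero]
        have e1 : k • u - D.twist g (a • u + w') =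
            y • u + ((-a) • D.twist f u - D.twist g w') := by
          rw [map_add, hk]
          simp only [twist_apply, D.leibniz]
          module
        rw [e1]
        exact genEigen_add hyu h
  obtain ⟨w', hw', h⟩ := key _ he
  rw [← map_sub] at h
  have := Submodule.add_mem _ (Submodule.subset_span (s := {e | ∃ f ∈ Set.univ, e ∈ D.genEigen f})
    ⟨g, trivial, genEigen_of_twist h⟩) hw'
  rwa [sub_add_cancel] at this

end Field
end Connection

/-! ### Recursive sequences and coefficients of Laurent series -/

/-- Sequences can be constructed by successively satisfying conditions of which the `n`-th involves
only the terms of index at most `n`. -/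
theorem exists_seq_of_step {W : Type*} [Nonempty W] (P : ℕ → (ℕ → W) → Prop)
    (hP : ∀ n (w w' : ℕ → W), (∀ j ≤ n, w j = w' j) → P n w → P n w')
    (step : ∀ n (w : ℕ → W), (∀ j < n, P j w) → ∃ z, P n (Function.update w n z)) :
    ∃ w : ℕ → W, ∀ n, P n w := by
  classical
  have up : ∀ n (w : ℕ → W) z, ∀ j < n, Function.update w n z j = w j := fun n w z j hj =>
    Function.update_of_ne hj.ne z w
  -- Partial solutions are total sequences satisfying the first `n` conditions. An extension changes
  -- only the entry `n`, so the diagonal sequence stabilizes.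
  have ex : ∀ n (w : {w : ℕ → W // ∀ j < n, P j w}), ∃ w' : {w : ℕ → W // ∀ j < n + 1, P j w},
      ∀ j < n, w'.1 j = w.1 j := by
    rintro n ⟨w, hw⟩
    obtain ⟨z, hz⟩ := step n w hw
    refine ⟨⟨Function.update w n z, fun j hj => ?_⟩, up n w z⟩
    rcases Nat.lt_succ_iff_lt_or_eq.1 hj with hj | rfl
    · exact hP j w _ (fun i hi => (up n w z i (hi.trans_lt hj)).symm) (hw j hj)
    · exact hz
  choose F hF using ex
  let G : ∀ n, {w : ℕ → W // ∀ j < n, P j w} := fun n =>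
    Nat.rec ⟨fun _ => Classical.arbitrary W, fun j hj => absurd hj (Nat.not_lt_zero j)⟩
      (fun n w => F n w) n
  have hG : ∀ n m, n ≤ m → ∀ j < n, (G m).1 j = (G n).1 j := by
    intro n m hnm
    induction m, hnm using Nat.le_induction with
    | base => exact fun _ _ => rfl
    | succ m hnm ih => exact fun j hj => (hF m (G m) j (hj.trans_le hnm)).trans (ih j hj)
  refine ⟨fun j => (G (j + 1)).1 j, fun n => hP n (G (n + 1)).1 _ (fun j hj => ?_)
    ((G (n + 1)).2 n n.lt_succ_self)⟩
  exact hG (j + 1) (n + 1) (by omega) j j.lt_succ_self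

section Laurent

variable {A : Type u} [CommRing A]

theorem ofPowerSeries_coeff_of_neg (f : A⟦X⟧) {n : ℤ} (hn : n < 0) :
    (HahnSeries.ofPowerSeries ℤ A f).coeff n = 0 := by
  rw [PowerSeries.coeff_coe, if_pos hn]

theorem exists_eq_single_mul (f : A⸨X⸩) (N : ℤ) (h : ∀ n < N, f.coeff n = 0) :
    ∃ g : A⟦X⟧, f = HahnSeries.single N 1 * HahnSeries.ofPowerSeries ℤ A g := by
  refine ⟨PowerSeries.mk fun i => f.coeff (N + i), ?_⟩
  ext n
  rw [HahnSeries.coeff_single_mul, one_mul, PowerSeries.coeff_coe]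
  split_ifs with h0
  · exact h n (by omega)
  · rw [PowerSeries.coeff_mk]
    congr 1
    omega

theorem exists_eq_ofPowerSeries (f : A⸨X⸩) (h : ∀ n < 0, f.coeff n = 0) :
    ∃ g : A⟦X⟧, f = HahnSeries.ofPowerSeries ℤ A g := by
  obtain ⟨g, hg⟩ := exists_eq_single_mul f 0 h
  exact ⟨g, by rw [hg, HahnSeries.single_zero_one, one_mul]⟩

theorem exists_coeff_bound (f : A⸨X⸩) : ∃ N : ℕ, ∀ n : ℤ, n < -N → f.coeff n = 0 := by
  refine ⟨f.order.natAbs, fun n hn => HahnSeries.coeff_eq_zero_of_lt_order ?_⟩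
  omega

theorem coeff_mk_mul (w : ℕ → A) (H : A⟦X⟧) (n : ℕ) :
    PowerSeries.coeff n (PowerSeries.mk w * H) =
      ∑ k ∈ Finset.range n, w k * PowerSeries.coeff (n - k) H + w n * PowerSeries.coeff 0 H := by
  rw [PowerSeries.coeff_mul,
    Finset.Nat.sum_antidiagonal_eq_sum_range_succ
      (fun i j => PowerSeries.coeff i (PowerSeries.mk w) * PowerSeries.coeff j H),
    Finset.sum_range_succ]
  simp

end Laurent

/-! ### First order equations for `c x d/dx` on Laurent series -/

section Delta

variable {C : Type u} [Field C]

/-- The derivation `c x d/dx` of `C((x))`. -/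
def delta (c : C) : Deriv C⸨X⸩ := (theta C).scale (HahnSeries.C c)

theorem delta_coeff (c : C) (f : C⸨X⸩) (n : ℤ) : (delta c f).coeff n = c * (n * f.coeff n) := by
  change ((HahnSeries.C c : C⸨X⸩) * theta C f).coeff n = _
  rw [HahnSeries.C_mul_eq_smul, HahnSeries.coeff_smul, theta_coeff, smul_eq_mul]

theorem delta_C (c a : C) : delta c (HahnSeries.C a) = 0 := by
  change (HahnSeries.C c : C⸨X⸩) * theta C _ = _
  rw [theta_C, mul_zero]

theorem delta_single (c : C) (n : ℤ) (a : C) :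
    delta c (HahnSeries.single n a) = HahnSeries.C (c * n) * HahnSeries.single n a := by
  ext m
  rw [delta_coeff, HahnSeries.C_mul_eq_smul, HahnSeries.coeff_smul, smul_eq_mul]
  by_cases h : m = n
  · subst h; ring
  · rw [HahnSeries.coeff_single_of_ne h]; ring

theorem delta_one_eq : delta (1 : C) = theta C := by
  refine DFunLike.ext _ _ fun f => ?_
  ext n
  rw [delta_coeff, theta_coeff, one_mul]

variable [CharZero C]

/-- The solution is a power series `∑ w_n xⁿ` with `w_0 = 1`: the `n`-th coefficient equation
determines `c n w_n` from earlier terms, and `c n ≠ 0` for `n > 0`. It serves to gauge away the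
positive part of a type. -/
theorem exists_gauge {c : C} (hc : c ≠ 0) (h : C⸨X⸩) (hh : ∀ n ≤ 0, h.coeff n = 0) :
    ∃ y : C⸨X⸩, y ≠ 0 ∧ delta c y + h * y = 0 := by
  obtain ⟨H, rfl⟩ := exists_eq_ofPowerSeries h fun n hn => hh n hn.le
  have H0 : PowerSeries.coeff 0 H = 0 := by
    have := hh 0 le_rfl
    rwa [PowerSeries.coeff_coe] at this
  obtain ⟨w, hw⟩ := exists_seq_of_step (W := C)
    (fun n w => if n = 0 then w 0 = 1 else
      c * (n * w n) + ∑ k ∈ Finset.range n, w k * PowerSeries.coeff (n - k) H = 0)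
    (by
      intro n w w' hww h
      split_ifs at h ⊢ with h0
      · rw [← hww 0 (by omega), h]
      · rw [← hww n le_rfl, ← Finset.sum_congr rfl fun k hk => ?_]
        · exact h
        · rw [hww k (Finset.mem_range.1 hk).le])
    (by
      intro n w _
      have hs : ∀ z, ∑ k ∈ Finset.range n, Function.update w n z k * PowerSeries.coeff (n - k) H =
          ∑ k ∈ Finset.range n, w k * PowerSeries.coeff (n - k) H := fun z =>
        Finset.sum_congr rfl fun k hk => by
          rw [Function.update_of_ne (Finset.mem_range.1 hk).ne]
      split_ifs with h0
      · subst h0; exact ⟨1, by simp⟩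
      · refine ⟨-(∑ k ∈ Finset.range n, w k * PowerSeries.coeff (n - k) H) / (c * n), ?_⟩
        rw [hs]
        have : (n : C) ≠ 0 := Nat.cast_ne_zero.2 h0
        rw [Function.update_self]
        field_simp
        ring)
  refine ⟨HahnSeries.ofPowerSeries ℤ C (PowerSeries.mk w), fun h0 => ?_, ?_⟩
  · have := congrArg (fun f : C⸨X⸩ => f.coeff 0) h0
    have h1 : w 0 = 1 := hw 0
    simp [PowerSeries.coeff_coe, h1] at this
  · ext n
    rw [HahnSeries.coeff_add, delta_coeff, mul_comm (HahnSeries.ofPowerSeries ℤ C H), ← map_mul, PowerSeries.coeff_coe,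
      PowerSeries.coeff_coe, HahnSeries.coeff_zero]
    split_ifs with hn
    · simp
    · obtain ⟨m, rfl⟩ := Int.eq_ofNat_of_zero_le (not_lt.1 hn)
      have := hw m
      rw [Int.natAbs_natCast, coeff_mk_mul, H0, mul_zero, add_zero, PowerSeries.coeff_mk,
        Int.cast_natCast]
      split_ifs at this with h0
      · subst h0; simp
      · linear_combination this

-- Multiplication by a series with a pole of order `r` dominates the derivation, which does not
-- lower the order. The coefficients of `a` are therefore found one by one, dividing each time by
-- `H(0)`. If `k` starts at `x^{-N}`, then `a` starts at `x^{-N+r}`.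
omit [CharZero C] in
theorem exists_delta_add_of_pole (c : C) {r : ℕ} (hr : 0 < r) {H : C⟦X⟧}
    (H0 : PowerSeries.coeff 0 H ≠ 0) (k : C⸨X⸩) :
    ∃ a : C⸨X⸩, delta c a +
      HahnSeries.single (-(r : ℤ)) 1 * HahnSeries.ofPowerSeries ℤ C H * a = k := by
  obtain ⟨N, hN⟩ := exists_coeff_bound k
  obtain ⟨κ, rfl⟩ := exists_eq_single_mul k (-N) hN
  obtain ⟨q, hq⟩ := exists_seq_of_step (W := C)
    (fun n w => ∑ k ∈ Finset.range n, w k * PowerSeries.coeff (n - k) H + w n * PowerSeries.coeff 0 H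
      + (if r ≤ n then c * ((-N + n : ℤ) * w (n - r)) else 0) = PowerSeries.coeff n κ)
    (by
      intro n w w' hww h
      rw [← h, hww n le_rfl, hww (n - r) (by omega)]
      congr 2
      exact Finset.sum_congr rfl fun k hk => by rw [hww k (Finset.mem_range.1 hk).le])
    (by
      intro n w _
      have hs : ∀ z, ∑ k ∈ Finset.range n, Function.update w n z k * PowerSeries.coeff (n - k) H =
          ∑ k ∈ Finset.range n, w k * PowerSeries.coeff (n - k) H := fun z =>
        Finset.sum_congr rfl fun k hk => by
          rw [Function.update_of_ne (Finset.mem_range.1 hk).ne]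
      refine ⟨(PowerSeries.coeff n κ - ∑ k ∈ Finset.range n, w k * PowerSeries.coeff (n - k) H -
        (if r ≤ n then c * ((-N + n : ℤ) * w (n - r)) else 0)) / PowerSeries.coeff 0 H, ?_⟩
      rw [hs]
      rw [Function.update_self]
      by_cases h : r ≤ n
      · rw [if_pos h, if_pos h, Function.update_of_ne (by omega)]
        field_simp
        ring
      · rw [if_neg h, if_neg h]
        field_simp
        ring)
  refine ⟨HahnSeries.single (-(N : ℤ) + r) 1 * HahnSeries.ofPowerSeries ℤ C (PowerSeries.mk q), ?_⟩
  have e1 : HahnSeries.single (-(r : ℤ)) 1 * HahnSeries.ofPowerSeries ℤ C H *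
      (HahnSeries.single (-(N : ℤ) + r) 1 * HahnSeries.ofPowerSeries ℤ C (PowerSeries.mk q)) =
      HahnSeries.single (-(N : ℤ)) 1 * HahnSeries.ofPowerSeries ℤ C (PowerSeries.mk q * H) := by
    have : (HahnSeries.single (-(N : ℤ)) 1 : C⸨X⸩) =
        HahnSeries.single (-(r : ℤ)) 1 * HahnSeries.single (-(N : ℤ) + r) 1 := by
      rw [HahnSeries.single_mul_single, mul_one]
      congr 1
      ring_nf
    rw [this, map_mul]
    ring
  rw [e1]
  ext n
  rw [HahnSeries.coeff_add, delta_coeff, HahnSeries.coeff_single_mul, HahnSeries.coeff_single_mul,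
    HahnSeries.coeff_single_mul, PowerSeries.coeff_coe, PowerSeries.coeff_coe,
    PowerSeries.coeff_coe]
  by_cases hn : n - -N < 0
  · rw [if_pos hn, if_pos hn, if_pos (by omega)]
    ring
  · obtain ⟨m, hm⟩ := Int.eq_ofNat_of_zero_le (not_lt.1 hn)
    obtain rfl : n = -N + m := by omega
    have := hq m
    rw [if_neg hn, if_neg hn, hm, Int.natAbs_natCast, coeff_mk_mul, ← this]
    by_cases h : r ≤ m
    · rw [if_neg (by omega), if_pos h, PowerSeries.coeff_mk]
      have : (-(N : ℤ) + m - (-N + r)).natAbs = m - r := by omega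
      rw [this]
      ring
    · rw [if_pos (by omega), if_neg h]
      ring

-- The operator is diagonal on monomials, with eigenvalue `c n + h` on `xⁿ`: `a` absorbs the
-- exponents where this is nonzero and `y` the others.
omit [CharZero C] in
theorem exists_delta_add_const (c h : C) (k : C⸨X⸩) :
    ∃ a y : C⸨X⸩, k = delta c a + HahnSeries.C h * a + y ∧
      delta c y + HahnSeries.C h * y = 0 := by
  classical
  refine ⟨⟨fun n => if c * n + h = 0 then 0 else k.coeff n / (c * n + h),
      k.isPWO_support.mono fun n hn h0 => hn (by simp [h0])⟩,
    ⟨fun n => if c * n + h = 0 then k.coeff n else 0,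
      k.isPWO_support.mono fun n hn h0 => hn (by simp [h0])⟩, ?_, ?_⟩
  · ext n
    simp only [HahnSeries.coeff_add, delta_coeff, HahnSeries.C_mul_eq_smul, HahnSeries.coeff_smul,
      smul_eq_mul]
    split_ifs with h0
    · ring
    · field_simp
      ring
  · ext n
    simp only [HahnSeries.coeff_add, delta_coeff, HahnSeries.C_mul_eq_smul, HahnSeries.coeff_smul,
      smul_eq_mul, HahnSeries.coeff_zero]
    split_ifs with h0
    · linear_combination k.coeff n * h0
    · ring

/-- `C((x))` is the sum of the image and the kernel of every operator `c x d/dx + h`. -/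
theorem exists_delta_add {c : C} (hc : c ≠ 0) (h k : C⸨X⸩) :
    ∃ a y : C⸨X⸩, k = delta c a + h * a + y ∧ delta c y + h * y = 0 := by
  by_cases hh : ∀ n < 0, h.coeff n = 0
  -- Without a pole, conjugation by a solution `u` replaces `h` by its constant term. With a pole,
  -- the operator is already surjective.
  · obtain ⟨u, hu, hu'⟩ := exists_gauge hc (h - HahnSeries.C (h.coeff 0)) (by
      intro n hn
      rcases hn.lt_or_eq with hn | rfl
      · rw [HahnSeries.coeff_sub, hh n hn, HahnSeries.C_apply,
          HahnSeries.coeff_single_of_ne hn.ne, sub_zero]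
      · simp)
    obtain ⟨a, y, h1, h2⟩ := exists_delta_add_const c (h.coeff 0) (u⁻¹ * k)
    refine ⟨u * a, u * y, ?_, ?_⟩
    · rw [Deriv.leibniz]
      have : k = u * (u⁻¹ * k) := by field_simp
      rw [this, h1]
      linear_combination -a * hu'
    · rw [Deriv.leibniz]
      linear_combination y * hu' + u * h2
  · push Not at hh
    obtain ⟨n, hn, hne⟩ := hh
    have h0 : h ≠ 0 := fun h0 => hne (by rw [h0]; rfl)
    have hlt : h.order < 0 := (HahnSeries.order_le_of_coeff_ne_zero hne).trans_lt hn
    obtain ⟨r, hr⟩ := Int.eq_ofNat_of_zero_le (show 0 ≤ -h.order by omega)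
    obtain ⟨a, ha⟩ := exists_delta_add_of_pole c (r := r) (by omega) (H := h.powerSeriesPart)
      (by rw [LaurentSeries.powerSeriesPart_coeff]; simpa using h0) k
    refine ⟨a, 0, ?_, by simp⟩
    have e : (-(r : ℤ)) = h.order := by omega
    rw [e, LaurentSeries.single_order_mul_powerSeriesPart] at ha
    rw [add_zero, ha]

-- The derivation does not lower the order of a series, so `u⁻¹ δ u` has order at least zero. Hence
-- principal parts are invariants of types modulo logarithmic derivatives.
omit [CharZero C] in
theorem coeff_logDeriv (c : C) {u g : C⸨X⸩} (hu : u ≠ 0) (hg : g = u⁻¹ * delta c u) {n : ℤ}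
    (hn : n < 0) : g.coeff n = 0 := by
  by_cases hg0 : g = 0
  · rw [hg0]; rfl
  have h1 : u * g = delta c u := by rw [hg, mul_inv_cancel_left₀ hu]
  have h2 : delta c u ≠ 0 := h1 ▸ mul_ne_zero hu hg0
  have h3 := HahnSeries.order_mul hu hg0
  have h4 : u.order ≤ (delta c u).order := by
    apply HahnSeries.order_le_of_coeff_ne_zero
    intro h
    have := mt HahnSeries.coeff_order_eq_zero.1 h2
    rw [delta_coeff, h] at this
    simp at this
  rw [← h1] at h4
  exact HahnSeries.coeff_eq_zero_of_lt_order (by omega)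

end Delta

/-! ### Compatibility of the substitution `x ↦ x^s` with derivations and composition -/

section Ramify

variable {C : Type u} [Field C]

theorem ramify_coeff_eq_zero_of_lt (s : ℕ+) {f : C⸨X⸩} {N : ℤ} (h : ∀ n < N, f.coeff n = 0) {n : ℤ}
    (hn : n < (s : ℕ) * N) : (ramify C s f).coeff n = 0 := by
  by_cases h' : ∃ m : ℤ, ((s : ℕ) : ℤ) * m = n
  · obtain ⟨m, rfl⟩ := h'
    rw [ramify_coeff_mul]
    exact h m (lt_of_mul_lt_mul_left hn (by positivity))
  · exact ramify_coeff_eq_zero C s f h'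

theorem delta_ramify [CharZero C] (c : C) (s : ℕ+) (f : C⸨X⸩) :
    delta (c / (s : ℕ)) (ramify C s f) = ramify C s (delta c f) := by
  have hs : ((s : ℕ) : C) ≠ 0 := by exact_mod_cast s.pos.ne'
  ext n
  rw [delta_coeff]
  by_cases h : ∃ m : ℤ, ((s : ℕ) : ℤ) * m = n
  · obtain ⟨m, rfl⟩ := h
    rw [ramify_coeff_mul, ramify_coeff_mul, delta_coeff]
    push_cast
    field_simp
  · rw [ramify_coeff_eq_zero C s f h, ramify_coeff_eq_zero C s _ h, mul_zero, mul_zero]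

theorem ramify_ramify (s s' : ℕ+) (f : C⸨X⸩) :
    ramify C s' (ramify C s f) = ramify C (s * s') f := by
  have h0 : (((s * s' : ℕ+) : ℕ) : ℤ) = (s' : ℕ) * (s : ℕ) := by push_cast; ring
  have hs' : ((s' : ℕ) : ℤ) ≠ 0 := by exact_mod_cast s'.pos.ne'
  ext n
  by_cases h : ∃ m : ℤ, ((s' : ℕ) : ℤ) * m = n
  · obtain ⟨m, rfl⟩ := h
    rw [ramify_coeff_mul]
    by_cases h : ∃ k : ℤ, ((s : ℕ) : ℤ) * k = m
    · obtain ⟨k, rfl⟩ := h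
      rw [ramify_coeff_mul, ← mul_assoc, ← h0, ramify_coeff_mul]
    · rw [ramify_coeff_eq_zero C s f h, ramify_coeff_eq_zero]
      rintro ⟨k, hk⟩
      refine h ⟨k, ?_⟩
      rw [h0, mul_assoc] at hk
      exact mul_left_cancel₀ hs' hk
  · rw [ramify_coeff_eq_zero C s' _ h, ramify_coeff_eq_zero]
    rintro ⟨k, hk⟩
    exact h ⟨(s : ℕ) * k, by rw [← hk, h0, mul_assoc]⟩

theorem ramify_C (s : ℕ+) (a : C) : ramify C s (HahnSeries.C a) = HahnSeries.C a := by
  ext n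
  by_cases h : ∃ m : ℤ, ((s : ℕ) : ℤ) * m = n
  · obtain ⟨m, rfl⟩ := h
    rw [ramify_coeff_mul, HahnSeries.C_apply, HahnSeries.coeff_single, HahnSeries.coeff_single]
    simp
  · rw [ramify_coeff_eq_zero C s _ h, HahnSeries.C_apply, HahnSeries.coeff_single_of_ne]
    rintro rfl
    exact h ⟨0, mul_zero _⟩

end Ramify

/-! ### Vanishing of horizontal maps to connections without eigenvectors -/

section Vanishing

variable {C : Type u} [Field C] {c : C} {E : Type v} [AddCommGroup E] [Module C⸨X⸩ E]

/-- After adjoining an `s`-th root of `x`, horizontal maps from `(E, ∇)` to connections without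
eigenvectors vanish. -/
def Vanishing (D : Connection (delta c) E) (s : ℕ+) : Prop :=
  ∀ (K' : Type u) [Field K'] (δ' : Deriv K') (ψ : C⸨X⸩ →+* K'),
    (∀ f, δ' (ψ f) = ψ (delta (c / (s : ℕ)) f)) →
    ∀ (E' : Type w) [AddCommGroup E'] [Module K' E'] (D' : Connection δ' E'),
      (∀ (f : K') (e : E'), D' e = f • e → e = 0) →
      ∀ ι : E →+ E', (∀ k e, ι (k • e) = ψ (ramify C s k) • ι e) →
        (∀ e, ι (D e) = D' (ι e)) → ∀ e, ι e = 0

variable [CharZero C]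

/-- The test field `K'` is any differential extension of `C((x_s))`, so a map over `C((x_{ss'}))` is
already covered, through the composite `C((x_s)) → C((x_{ss'})) → K'`. -/
theorem Vanishing.mul {D : Connection (delta c) E} {s : ℕ+} (h : Vanishing.{u, v, w} D s) (s' : ℕ+) :
    Vanishing.{u, v, w} D (s * s') := by
  intro K' _ δ' ψ hψ E' _ _ D' hD' ι hι hιD
  refine h K' δ' (ψ.comp (ramify C s')) (fun f => ?_) E' D' hD' ι (fun k e => ?_) hιD
  · rw [RingHom.comp_apply, RingHom.comp_apply, hψ, ← delta_ramify, div_div]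
    simp
  · rw [hι, RingHom.comp_apply, ramify_ramify]

theorem Vanishing.mul' {D : Connection (delta c) E} {s : ℕ+} (h : Vanishing.{u, v, w} D s)
    (s' : ℕ+) : Vanishing.{u, v, w} D (s' * s) := mul_comm s s' ▸ h.mul s'

-- A horizontal map kills `W` by the first hypothesis, and then factors through `E / W`, where the
-- second applies. This closure under extensions drives the induction on the dimension.
omit [CharZero C] in
theorem Vanishing.of_quotient {D : Connection (delta c) E} {s : ℕ+} (W : Submodule C⸨X⸩ E)
    (hW : D.IsStable W) (h1 : Vanishing.{u, v, w} (D.restrict W hW) s)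
    (h2 : Vanishing.{u, v, w} (D.quotient W hW) s) : Vanishing.{u, v, w} D s := by
  intro K' _ δ' ψ hψ E' _ _ D' hD' ι hι hιD e
  have hιW : ∀ e ∈ W, ι e = 0 := fun e he =>
    h1 K' δ' ψ hψ E' D' hD' (ι.comp W.subtype.toAddMonoidHom) (fun k e => hι k e)
      (fun e => hιD e) ⟨e, he⟩
  refine h2 K' δ' ψ hψ E' D' hD' (QuotientAddGroup.lift W.toAddSubgroup ι hιW) ?_ ?_ (W.mkQ e)
  · intro k e
    induction e using Submodule.Quotient.induction_on with
    | H e => exact hι k e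
  · intro e
    induction e using Submodule.Quotient.induction_on with
    | H e => exact hιD e

-- A horizontal map remains horizontal when source and target are twisted by the same function, and
-- twisting the target creates no eigenvectors.
omit [CharZero C] in
theorem Vanishing.of_twist {D : Connection (delta c) E} {s : ℕ+} (g : C⸨X⸩)
    (h : Vanishing.{u, v, w} (D.twist g) s) : Vanishing.{u, v, w} D s := by
  intro K' _ δ' ψ hψ E' _ _ D' hD' ι hι hιD
  refine h K' δ' ψ hψ E' (D'.twist (ψ (ramify C s g))) (fun f e he => ?_) ι hι (fun e => ?_)
  · refine hD' (f + ψ (ramify C s g)) e ?_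
    rw [add_smul, ← he, Connection.twist_apply, sub_add_cancel]
  · rw [Connection.twist_apply, Connection.twist_apply, map_sub, hι, hιD]

/-- The connection `d + A` on `Kⁿ`. -/
def matConn {K : Type u} [CommRing K] (δ : Deriv K) {n : ℕ} (A : Matrix (Fin n) (Fin n) K) :
    Connection δ (Fin n → K) where
  toFun k i := δ (k i) + A.mulVec k i
  map_zero' := by ext i; simp
  map_add' k l := by
    ext i
    simp only [Pi.add_apply, map_add, Matrix.mulVec_add]
    ring
  leibniz' f k := by
    ext i
    simp only [Pi.smul_apply, smul_eq_mul, Deriv.leibniz, Matrix.mulVec_smul, Pi.add_apply]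
    ring

theorem matConn_apply {K : Type u} [CommRing K] (δ : Deriv K) {n : ℕ}
    (A : Matrix (Fin n) (Fin n) K) (k : Fin n → K) (i : Fin n) :
    matConn δ A k i = δ (k i) + A.mulVec k i := rfl

theorem Connection.apply_sum_basis {K : Type u} [CommRing K] {δ : Deriv K} {E : Type v}
    [AddCommGroup E] [Module K E] (D : Connection δ E) {n : ℕ} (e : Fin n → E)
    (A : Matrix (Fin n) (Fin n) K) (hA : ∀ j, D (e j) = ∑ i, A i j • e i) (k : Fin n → K) :
    D (∑ i, k i • e i) = ∑ i, matConn δ A k i • e i := by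
  simp only [map_sum, D.leibniz, hA, matConn_apply, add_smul, Finset.sum_add_distrib,
    Matrix.mulVec, dotProduct, Finset.sum_smul, Finset.smul_sum, smul_smul]
  rw [add_right_inj, Finset.sum_comm]
  simp only [mul_comm]

/-- Passing to the ramified connection, written in a rescaled basis. -/
theorem Vanishing.of_matConn {D : Connection (delta c) E} {n : ℕ} (e : Fin n → E)
    (hspan : ∀ x : E, ∃ k : Fin n → C⸨X⸩, x = ∑ i, k i • e i)
    (A : Matrix (Fin n) (Fin n) C⸨X⸩) (hA : ∀ j, D (e j) = ∑ i, A i j • e i)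
    (s s' : ℕ+) (d : Fin n → C⸨X⸩) (hd : ∀ i, d i ≠ 0) (A' : Matrix (Fin n) (Fin n) C⸨X⸩)
    -- This is the gauge transformation `A' = d⁻¹ A d + d⁻¹ δ(d)` by a diagonal matrix `d`, with
    -- denominators cleared.
    (hA' : ∀ i j, d i * A' i j = ramify C s (A i j) * d j +
      if i = j then delta (c / (s : ℕ)) (d j) else 0)
    (h : Vanishing.{u, u, w} (matConn (delta (c / (s : ℕ))) A') s') :
    Vanishing.{u, v, w} D (s * s') := by
  intro K' _ δ' ψ hψ E' _ _ D' hD' ι hι hιD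
  have hcc : c / ((s * s' : ℕ+) : ℕ) = c / (s : ℕ) / (s' : ℕ) := by rw [div_div]; simp
  have hψ' : ∀ f, δ' (ψ (ramify C s' f)) = ψ (ramify C s' (delta (c / (s : ℕ)) f)) := by
    intro f
    rw [hψ, hcc, delta_ramify]
  have hι' : ∀ k e, ι (k • e) = ψ (ramify C s' (ramify C s k)) • ι e := by
    intro k e
    rw [hι, ramify_ramify]
  set φ : C⸨X⸩ →+* K' := ψ.comp (ramify C s') with hφ
  have hφψ : ∀ f, ψ (ramify C s' f) = φ f := fun _ => rfl
  -- The `i`-th standard vector represents the rescaled basis vector `d i • e i`; since `d i` is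
  -- invertible, vanishing of `ι₁` gives vanishing on each `e i`.
  let ι₁ : (Fin n → C⸨X⸩) →+ E' :=
    { toFun := fun k => ∑ i, φ (k i * d i) • ι (e i)
      map_zero' := by simp
      map_add' := fun k l => by
        simp only [Pi.add_apply, add_mul, map_add, add_smul, Finset.sum_add_distrib] }
  have hι₁ : ∀ k, ι₁ k = ∑ i, φ (k i * d i) • ι (e i) := fun _ => rfl
  have h0 := h K' δ' ψ (fun f => by rw [hψ, hcc]) E' D' hD' ι₁ (fun a k => by
      simp only [hι₁, Pi.smul_apply, smul_eq_mul, mul_assoc, map_mul, hφψ, Finset.smul_sum,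
        smul_smul]) (fun k => by
      have e1 : ∀ j, D' (ι (e j)) = ∑ i, φ (ramify C s (A i j)) • ι (e i) := by
        intro j
        rw [← hιD, hA, map_sum]
        exact Finset.sum_congr rfl fun i _ => hι' _ _
      simp only [hι₁, map_sum, D'.leibniz, e1]
      rw [Finset.sum_add_distrib]
      simp only [Finset.smul_sum, smul_smul]
      rw [Finset.sum_comm, ← Finset.sum_add_distrib]
      refine Finset.sum_congr rfl fun i _ => ?_
      rw [← Finset.sum_smul, ← add_smul]
      congr 1
      rw [← hφψ, ← hφψ, hψ', hφψ, hφψ]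
      simp only [← map_mul, ← map_sum, ← map_add]
      congr 1
      rw [matConn_apply, Deriv.leibniz, Matrix.mulVec, dotProduct, add_mul, Finset.sum_mul, add_assoc]
      congr 1
      have e2 : ∀ j, A' i j * k j * d i = k j * d j * ramify C s (A i j) +
          if i = j then k j * delta (c / (s : ℕ)) (d j) else 0 := by
        intro j
        have := hA' i j
        split_ifs at this ⊢ <;> linear_combination k j * this
      simp only [e2, Finset.sum_add_distrib, Finset.sum_ite_eq, Finset.mem_univ, if_true]
      ring)
  have h1 : ∀ i, ι (e i) = 0 := by
    intro i
    have := h0 (Pi.single i (d i)⁻¹)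
    rw [hι₁, Finset.sum_eq_single i (fun j _ hj => by rw [Pi.single_eq_of_ne hj]; simp)
      (by simp), Pi.single_eq_same, inv_mul_cancel₀ (hd i), map_one, one_smul] at this
    exact this
  intro x
  obtain ⟨k, rfl⟩ := hspan x
  rw [map_sum]
  exact Finset.sum_eq_zero fun i _ => by rw [hι, h1, smul_zero]

end Vanishing

/-! ### Coefficient matrices of products of matrix power series -/

section MatrixSeries

variable {C : Type u} [Field C] {n : ℕ}

/-- The coefficient matrices of a matrix of power series. -/
def matCoeff (m : ℕ) (B : Matrix (Fin n) (Fin n) C⟦X⟧) : Matrix (Fin n) (Fin n) C :=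
  B.map (PowerSeries.coeff m)

/-- The matrix of power series with given coefficient matrices. -/
def matMk (t : ℕ → Matrix (Fin n) (Fin n) C) : Matrix (Fin n) (Fin n) C⟦X⟧ :=
  Matrix.of fun i j => PowerSeries.mk fun m => t m i j

theorem matCoeff_matMk (t : ℕ → Matrix (Fin n) (Fin n) C) (m : ℕ) : matCoeff m (matMk t) = t m := by
  ext i j
  simp [matCoeff, matMk]

theorem matCoeff_mul (m : ℕ) (B B' : Matrix (Fin n) (Fin n) C⟦X⟧) :
    matCoeff m (B * B') = ∑ p ∈ Finset.HasAntidiagonal.antidiagonal m, matCoeff p.1 B * matCoeff p.2 B' := by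
  ext i j
  rw [Matrix.sum_apply]
  simp only [matCoeff, Matrix.map_apply, Matrix.mul_apply, map_sum, PowerSeries.coeff_mul]
  exact Finset.sum_comm

theorem matCoeff_mul_matMk (m : ℕ) (B : Matrix (Fin n) (Fin n) C⟦X⟧)
    (t : ℕ → Matrix (Fin n) (Fin n) C) :
    matCoeff m (B * matMk t) =
      ∑ k ∈ Finset.range m, matCoeff (m - k) B * t k + matCoeff 0 B * t m := by
  rw [matCoeff_mul, ← Finset.Nat.sum_antidiagonal_swap,
    Finset.Nat.sum_antidiagonal_eq_sum_range_succ_mk, Finset.sum_range_succ]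
  simp [matCoeff_matMk]

theorem matCoeff_matMk_mul_matMk (m : ℕ) (t a : ℕ → Matrix (Fin n) (Fin n) C) :
    matCoeff m (matMk t * matMk a) = ∑ k ∈ Finset.range m, t k * a (m - k) + t m * a 0 := by
  rw [matCoeff_mul, Finset.Nat.sum_antidiagonal_eq_sum_range_succ_mk, Finset.sum_range_succ]
  simp [matCoeff_matMk]

end MatrixSeries

/-! ### Eigenvectors of systems with integral matrix -/

section Regular

variable {C : Type u} [Field C] [IsAlgClosed C] [CharZero C]

/-- A square matrix has an eigenvalue `μ` such that no `μ - c k`, `k ≥ 1`, is an eigenvalue. -/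
theorem exists_extremal_eigenvalue {c : C} (hc : c ≠ 0) {n : ℕ} (B : Matrix (Fin (n + 1)) (Fin (n + 1)) C) :
    ∃ μ : C, (B - Matrix.scalar _ μ).det = 0 ∧
      ∀ k : ℕ, k ≠ 0 → (B - Matrix.scalar _ (μ - c * k)).det ≠ 0 := by
  have hdet : ∀ μ, (B - Matrix.scalar _ μ).det = 0 ↔ B.charpoly.IsRoot μ := by
    intro μ
    rw [Polynomial.IsRoot, Matrix.eval_charpoly, ← neg_sub, Matrix.det_neg]
    simp
  obtain ⟨μ₀, hμ₀⟩ := IsAlgClosed.exists_root B.charpoly (by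
    rw [Matrix.charpoly_degree_eq_dim]; simp; positivity)
  -- The numbers `μ₀ - c k` are distinct, so only finitely many are eigenvalues. The one with the
  -- largest `k` is extremal.
  have hfin : {k : ℕ | B.charpoly.IsRoot (μ₀ - c * k)}.Finite := by
    have h1 := Polynomial.finite_setOfPred_isRoot (p := B.charpoly) (Matrix.charpoly_monic B).ne_zero
    refine h1.preimage (f := fun k : ℕ => μ₀ - c * k) fun a _ b _ hab => ?_
    simp only [sub_right_inj] at hab
    exact_mod_cast mul_left_cancel₀ hc hab
  obtain ⟨k₀, hk₀, hmax⟩ := Set.exists_max_image _ id hfin ⟨0, by simpa using hμ₀⟩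
  refine ⟨μ₀ - c * k₀, (hdet _).2 hk₀, fun k hk h0 => ?_⟩
  have := hmax (k₀ + k) (by
    have := (hdet _).1 h0
    rw [Set.mem_ofPred_eq]
    convert this using 1
    push_cast
    ring)
  simp only [id] at this
  omega

/-- A regular singular system with integral matrix has a solution of the form `x^μ w(x)`. -/
theorem exists_eigenvector_of_integral {c : C} (hc : c ≠ 0) {n : ℕ}
    (B : Matrix (Fin (n + 1)) (Fin (n + 1)) C⟦X⟧) :
    ∃ w : Fin (n + 1) → C⸨X⸩, w ≠ 0 ∧ ∃ μ : C⸨X⸩,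
      matConn (delta c) (B.map (HahnSeries.ofPowerSeries ℤ C)) w = μ • w := by
  obtain ⟨μ, hμ, hμk⟩ := exists_extremal_eigenvalue hc (matCoeff 0 B)
  obtain ⟨v₀, hv₀, hBv₀⟩ := Matrix.exists_mulVec_eq_zero_iff.2 hμ
  -- The coefficient of `x^m` in `δ w + B w = μ w` reads `(B₀ - (μ - c m)) w_m + ∑_{k<m} B_{m-k} w_k
  -- = 0`, and extremality of `μ` makes the leading matrix invertible for `m ≥ 1`.
  obtain ⟨w, hw⟩ := exists_seq_of_step (W := Fin (n + 1) → C)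
    (fun m w => if m = 0 then w 0 = v₀ else
      (matCoeff 0 B - Matrix.scalar _ (μ - c * m)).mulVec (w m) +
        ∑ k ∈ Finset.range m, (matCoeff (m - k) B).mulVec (w k) = 0)
    (by
      intro m w w' hww h
      split_ifs at h ⊢ with h0
      · rw [← hww 0 (by omega), h]
      · rw [← hww m le_rfl, ← Finset.sum_congr rfl fun k hk => ?_]
        · exact h
        · rw [hww k (Finset.mem_range.1 hk).le])
    (by
      intro m w _
      have hs : ∀ z, ∑ k ∈ Finset.range m, (matCoeff (m - k) B).mulVec (Function.update w m z k) =
          ∑ k ∈ Finset.range m, (matCoeff (m - k) B).mulVec (w k) := fun z =>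
        Finset.sum_congr rfl fun k hk => by
          rw [Function.update_of_ne (Finset.mem_range.1 hk).ne]
      split_ifs with h0
      · subst h0; exact ⟨v₀, by simp⟩
      · refine ⟨-((matCoeff 0 B - Matrix.scalar _ (μ - c * m))⁻¹.mulVec
          (∑ k ∈ Finset.range m, (matCoeff (m - k) B).mulVec (w k))), ?_⟩
        rw [hs, Function.update_self, Matrix.mulVec_neg, Matrix.mulVec_mulVec,
          Matrix.mul_nonsing_inv _ (isUnit_iff_ne_zero.2 (hμk m h0)), Matrix.one_mulVec,
          neg_add_cancel])
  have hw0 : w 0 = v₀ := hw 0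
  refine ⟨fun i => HahnSeries.ofPowerSeries ℤ C (PowerSeries.mk fun m => w m i), fun h0 => hv₀ ?_,
    HahnSeries.C μ, ?_⟩
  · ext i
    have := congrArg (fun f : C⸨X⸩ => f.coeff 0) (congrFun h0 i)
    simpa [PowerSeries.coeff_coe, hw0] using this
  · ext i m
    simp only [matConn_apply, Pi.smul_apply, smul_eq_mul, HahnSeries.C_mul_eq_smul,
      HahnSeries.coeff_smul, HahnSeries.coeff_add, delta_coeff, Matrix.mulVec, dotProduct,
      Matrix.map_apply, ← map_mul]
    rw [← map_sum, PowerSeries.coeff_coe, PowerSeries.coeff_coe]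
    split_ifs with hm
    · simp
    · obtain ⟨m, rfl⟩ := Int.eq_ofNat_of_zero_le (not_lt.1 hm)
      have e1 : PowerSeries.coeff m (∑ j, B i j * PowerSeries.mk fun m => w m j) =
          (∑ k ∈ Finset.range m, (matCoeff (m - k) B).mulVec (w k) +
            (matCoeff 0 B).mulVec (w m)) i := by
        simp only [map_sum, Pi.add_apply, Finset.sum_apply, Matrix.mulVec, dotProduct, matCoeff,
          Matrix.map_apply]
        rw [Finset.sum_comm, ← Finset.sum_add_distrib]
        refine Finset.sum_congr rfl fun j _ => ?_
        rw [mul_comm, coeff_mk_mul]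
        simp only [mul_comm]
      rw [Int.natAbs_natCast, e1, PowerSeries.coeff_mk, Int.cast_natCast]
      have := hw m
      split_ifs at this with h0
      · subst h0
        have h2 := congrFun hBv₀ i
        rw [Matrix.sub_mulVec, Pi.sub_apply] at h2
        simp only [Matrix.scalar_apply, Matrix.mulVec_diagonal] at h2
        simp only [Finset.range_zero, Finset.sum_empty, zero_add, hw0, Nat.cast_zero, zero_mul,
          mul_zero]
        exact sub_eq_zero.1 h2
      · have h2 := congrFun this i
        rw [Pi.add_apply, Matrix.sub_mulVec, Pi.sub_apply] at h2
        simp only [Matrix.scalar_apply, Matrix.mulVec_diagonal, Pi.zero_apply] at h2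
        rw [Pi.add_apply]
        linear_combination h2

end Regular

/-! ### Splitting an irregular system along its leading matrix -/

section Irregular

variable {C : Type u} [Field C]

/-- If the leading coefficient of an irregular system commutes with a projector `π` such that the
Sylvester equation is solvable off the diagonal blocks, the system has an invariant subspace. -/
theorem exists_isStable_of_projector (c : C) {n r : ℕ} (hr : 0 < r)
    (B : Matrix (Fin n) (Fin n) C⟦X⟧) (π : Matrix (Fin n) (Fin n) C) (hπ : π * π = π)
    (hπB : π * matCoeff 0 B = matCoeff 0 B * π) (h0 : π ≠ 0) (h1 : π ≠ 1)
    (hsol : ∀ Y, (1 - π) * Y = Y → Y * π = Y →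
      ∃ X, (1 - π) * X = X ∧ X * π = X ∧ matCoeff 0 B * X - X * matCoeff 0 B = Y) :
    ∃ W : Submodule C⸨X⸩ (Fin n → C⸨X⸩),
      (matConn (delta c) ((HahnSeries.single (-(r : ℤ)) 1 : C⸨X⸩) •
        B.map (HahnSeries.ofPowerSeries ℤ C))).IsStable W ∧ W ≠ ⊥ ∧ W ≠ ⊤ := by
  set B₀ := matCoeff 0 B with hB₀
  -- The aim is matrices `T = ∑ t_m x^m` and `a` with `δ T + x^{-r} B T = x^{-r} T a`, `t_0 = π`,
  -- `a_0 = B₀ π`, all supported on the columns of `π`. The column space of `T` is then stable. `R`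
  -- collects the terms of the equation at order `m + 1` that are already known.
  let R : ℕ → (ℕ → Matrix (Fin n) (Fin n) C × Matrix (Fin n) (Fin n) C) →
      Matrix (Fin n) (Fin n) C := fun m w =>
    (if r ≤ m + 1 then (c * ((m + 1 - r : ℕ) : C)) • (w (m + 1 - r)).1 else 0) +
      ∑ k ∈ Finset.range (m + 1), matCoeff (m + 1 - k) B * (w k).1 -
      ∑ k ∈ Finset.range m, (w (k + 1)).1 * (w (m - k)).2
  have hR : ∀ m w w', (∀ j ≤ m, w j = w' j) → R m w = R m w' := by
    intro m w w' hww
    have e1 : ∑ k ∈ Finset.range (m + 1), matCoeff (m + 1 - k) B * (w k).1 =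
        ∑ k ∈ Finset.range (m + 1), matCoeff (m + 1 - k) B * (w' k).1 :=
      Finset.sum_congr rfl fun k hk => by
        rw [hww k (Nat.lt_succ_iff.1 (Finset.mem_range.1 hk))]
    have e2 : ∑ k ∈ Finset.range m, (w (k + 1)).1 * (w (m - k)).2 =
        ∑ k ∈ Finset.range m, (w' (k + 1)).1 * (w' (m - k)).2 :=
      Finset.sum_congr rfl fun k hk => by
        rw [hww (k + 1) (Finset.mem_range.1 hk), hww (m - k) (by omega)]
    simp only [R, e1, e2]
    rw [hww (m + 1 - r) (by omega)]
  obtain ⟨w, hw⟩ := exists_seq_of_step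
    (W := Matrix (Fin n) (Fin n) C × Matrix (Fin n) (Fin n) C)
    (fun m w => (m = 0 → w 0 = (π, B₀ * π)) ∧ ((w m).1 * π = (w m).1 ∧ (w m).2 * π = (w m).2) ∧
      ∀ k, m = k + 1 → R k w + B₀ * (w m).1 - (w m).1 * (B₀ * π) - π * (w m).2 = 0)
    (by
      rintro m w w' hww ⟨h1, h2, h3⟩
      refine ⟨fun h => by rw [← hww 0 (by omega), h1 h], by rwa [← hww m le_rfl], fun k hk => ?_⟩
      rw [← hww m le_rfl, ← hR k w w' (fun j hj => hww j (by omega)), h3 k hk])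
    (by
      intro m w hj
      rcases m with _ | m
      · exact ⟨(π, B₀ * π), fun _ => by simp, by simp [hπ, Matrix.mul_assoc], fun k hk => by omega⟩
      · have hRπ : R m w * π = R m w := by
          simp only [R, sub_mul, add_mul, Finset.sum_mul, Matrix.mul_assoc]
          congr 1
          · congr 1
            · split_ifs with h
              · rw [Matrix.smul_mul, (hj _ (by omega)).2.1.1]
              · rw [zero_mul]
            · exact Finset.sum_congr rfl fun k hk => by
                rw [(hj k (Finset.mem_range.1 hk)).2.1.1]
          · exact Finset.sum_congr rfl fun k hk => by rw [(hj (m - k) (by omega)).2.1.2]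
        -- The equation at order `m + 1` splits: its `1 - π` part is the Sylvester equation for
        -- `t_{m+1}`, and its `π` part is solved by `a_{m+1} = π R`.
        obtain ⟨X, hX1, hX2, hX3⟩ := hsol (-((1 - π) * R m w))
          (by
            have : (1 - π) * (1 - π) = 1 - π := by
              rw [mul_sub, sub_mul, sub_mul, hπ]; simp
            rw [mul_neg, ← Matrix.mul_assoc, this])
          (by rw [neg_mul, Matrix.mul_assoc, hRπ])
        refine ⟨(X, π * R m w), fun h => by omega, ?_, fun k hk => ?_⟩
        · rw [Function.update_self]
          exact ⟨hX2, by rw [Matrix.mul_assoc, hRπ]⟩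
        · obtain rfl : m = k := by omega
          rw [Function.update_self, hR m _ w fun j hj => Function.update_of_ne (by omega) _ _]
          rw [← hπB, ← Matrix.mul_assoc X, hX2, ← Matrix.mul_assoc π, hπ, add_sub_assoc, hX3,
            sub_mul, one_mul]
          abel)
  set t := fun m => (w m).1 with ht
  set a := fun m => (w m).2 with ha
  have ht0 : t 0 = π := by rw [ht]; simp only [(hw 0).1 rfl]
  have ha0 : a 0 = B₀ * π := by rw [ha]; simp only [(hw 0).1 rfl]
  have hmain : ∀ m : ℕ, (if r ≤ m then (c * ((m - r : ℕ) : C)) • t (m - r) else 0) +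
      matCoeff m (B * matMk t) = matCoeff m (matMk t * matMk a) := by
    intro m
    rw [matCoeff_mul_matMk, matCoeff_matMk_mul_matMk, ← hB₀]
    rcases m with _ | m
    · rw [if_neg (by omega), ht0, ha0, ← Matrix.mul_assoc, hπB, Matrix.mul_assoc B₀, hπ]
      simp
    · have h3 : (if r ≤ m + 1 then (c * ((m + 1 - r : ℕ) : C)) • t (m + 1 - r) else 0) +
          ∑ k ∈ Finset.range (m + 1), matCoeff (m + 1 - k) B * t k -
          ∑ k ∈ Finset.range m, t (k + 1) * a (m - k) + B₀ * t (m + 1) - t (m + 1) * (B₀ * π) -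
          π * a (m + 1) = 0 := (hw (m + 1)).2.2 m rfl
      rw [Finset.sum_range_succ' (fun k => t k * a (m + 1 - k)), ht0, ha0]
      have e : ∀ k, m + 1 - (k + 1) = m - k := fun k => by omega
      simp only [e, Nat.sub_zero]
      rw [← sub_eq_zero]
      refine Eq.trans ?_ h3
      abel
  set T : Matrix (Fin n) (Fin n) C⸨X⸩ := (matMk t).map (HahnSeries.ofPowerSeries ℤ C) with hT
  set Am : Matrix (Fin n) (Fin n) C⸨X⸩ := (matMk a).map (HahnSeries.ofPowerSeries ℤ C) with hAm
  set x : C⸨X⸩ := HahnSeries.single (-(r : ℤ)) 1 with hx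
  have hTA : T.map (delta c) + x • (B.map (HahnSeries.ofPowerSeries ℤ C) * T) = x • (T * Am) := by
    rw [hT, hAm, ← Matrix.map_mul, ← Matrix.map_mul]
    ext i j k
    simp only [Matrix.add_apply, Matrix.smul_apply, Matrix.map_apply, smul_eq_mul,
      HahnSeries.coeff_add, delta_coeff, hx, HahnSeries.coeff_single_mul, one_mul,
      PowerSeries.coeff_coe]
    by_cases hk : k - -(r : ℤ) < 0
    · rw [if_pos hk, if_pos hk, if_pos (by omega)]
      simp
    · obtain ⟨m, hm⟩ := Int.eq_ofNat_of_zero_le (not_lt.1 hk)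
      obtain rfl : k = m - r := by omega
      have := congrFun (congrFun (hmain m) i) j
      rw [if_neg hk, if_neg hk, hm, Int.natAbs_natCast]
      simp only [Matrix.add_apply, matCoeff, Matrix.map_apply] at this
      rw [← this]
      by_cases hrm : r ≤ m
      · rw [if_neg (by omega), if_pos hrm]
        have : ((m : ℤ) - r).natAbs = m - r := by omega
        rw [this]
        have e3 : ((m : ℤ) - r : ℤ) = ((m - r : ℕ) : ℤ) := by omega
        rw [e3]
        simp [matMk, mul_assoc]
      · rw [if_pos (by omega), if_neg hrm]
        simp
  have hTπ : T * (1 - π).map HahnSeries.C = 0 := by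
    have e : ((1 - π).map HahnSeries.C : Matrix (Fin n) (Fin n) C⸨X⸩) =
        ((1 - π).map PowerSeries.C).map (HahnSeries.ofPowerSeries ℤ C) := by
      ext i j : 2
      simp [HahnSeries.ofPowerSeries_C]
    have e' : matMk t * (1 - π).map PowerSeries.C = 0 := by
      ext i j m
      have h2 : (t m * (1 - π)) i j = 0 := by
        rw [mul_sub, mul_one, Matrix.sub_apply, ht]
        exact sub_eq_zero.2 (congrFun (congrFun (hw m).2.1.1 i) j).symm
      simp only [Matrix.mul_apply, Matrix.map_apply, map_sum, PowerSeries.coeff_mul_C, matMk,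
        Matrix.of_apply, PowerSeries.coeff_mk, Matrix.zero_apply, map_zero]
      rwa [Matrix.mul_apply] at h2
    rw [e, hT, ← Matrix.map_mul, e', Matrix.map_zero _ (map_zero _)]
  -- The range is nonzero since `t_0 = π ≠ 0`. It is proper since `T` kills the nonzero matrix `1 -
  -- π`, and for a square matrix failure of injectivity prevents surjectivity.
  refine ⟨LinearMap.range T.mulVecLin, ?_, ?_, ?_⟩
  · rintro _ ⟨v, rfl⟩
    refine ⟨(fun i => delta c (v i)) + x • Am.mulVec v, ?_⟩
    have e1 : (fun i => delta c (T.mulVec v i)) =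
        (T.map (delta c)).mulVec v + T.mulVec (fun i => delta c (v i)) := by
      ext i : 1
      simp only [Matrix.mulVec, dotProduct, map_sum, Deriv.leibniz, Pi.add_apply,
        Finset.sum_add_distrib, Matrix.map_apply]
    have e2 : matConn (delta c) (x • B.map (HahnSeries.ofPowerSeries ℤ C)) (T.mulVec v) =
        (fun i => delta c (T.mulVec v i)) +
          (x • B.map (HahnSeries.ofPowerSeries ℤ C)).mulVec (T.mulVec v) := rfl
    rw [Matrix.mulVecLin_apply, Matrix.mulVecLin_apply, e2, e1, Matrix.mulVec_mulVec,
      Matrix.smul_mul, add_right_comm, ← Matrix.add_mulVec, hTA, Matrix.mulVec_add,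
      Matrix.mulVec_smul, Matrix.mulVec_mulVec, Matrix.smul_mulVec]
    abel
  · intro hbot
    apply h0
    rw [LinearMap.range_eq_bot] at hbot
    ext i j
    have e1 : T i j = 0 := by
      have := congrFun (LinearMap.congr_fun hbot (Pi.single j 1)) i
      rwa [Matrix.mulVecLin_apply, Matrix.mulVec_single_one] at this
    rw [hT, Matrix.map_apply, map_eq_zero_iff _ HahnSeries.ofPowerSeries_injective] at e1
    have := congrArg (PowerSeries.coeff 0) e1
    simp only [matMk, Matrix.of_apply, PowerSeries.coeff_mk, ht0, map_zero] at this
    exact this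
  · intro htop
    apply h1
    rw [LinearMap.range_eq_top] at htop
    have hinj : Function.Injective T.mulVecLin :=
      LinearMap.injective_iff_surjective.2 htop
    ext i j
    have e1 : ((1 - π).map HahnSeries.C : Matrix (Fin n) (Fin n) C⸨X⸩).mulVec (Pi.single j 1) = 0 := by
      apply hinj
      rw [Matrix.mulVecLin_apply, Matrix.mulVec_mulVec, hTπ, map_zero, Matrix.zero_mulVec]
    have e2 := congrFun e1 i
    rw [Matrix.mulVec_single_one] at e2
    have e3 : (1 - π) i j = 0 := by
      have : HahnSeries.C ((1 - π) i j) = (0 : C⸨X⸩) := e2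
      exact (map_eq_zero _).1 this
    rw [Matrix.sub_apply, sub_eq_zero] at e3
    exact e3.symm

/-- A matrix with an eigenvalue `μ` such that `B - μ` is not nilpotent has a spectral projector. -/
theorem exists_projector {n : ℕ} (B : Matrix (Fin n) (Fin n) C) (μ : C)
    (hμ : (B - Matrix.scalar _ μ).det = 0) (hnil : ¬ IsNilpotent (B - Matrix.scalar _ μ)) :
    ∃ π : Matrix (Fin n) (Fin n) C, π * π = π ∧ π * B = B * π ∧ π ≠ 0 ∧ π ≠ 1 ∧
      ∀ Y, (1 - π) * Y = Y → Y * π = Y →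
        ∃ X, (1 - π) * X = X ∧ X * π = X ∧ B * X - X * B = Y := by
  classical
  have hroot : B.charpoly.IsRoot μ := by
    rw [Polynomial.IsRoot, Matrix.eval_charpoly, ← neg_sub, Matrix.det_neg, hμ, mul_zero]
  have hP0 : B.charpoly ≠ 0 := (Matrix.charpoly_monic B).ne_zero
  -- Write the characteristic polynomial as `l^k Q` with `l = X - μ` prime to `Q`, and take a Bézout
  -- relation `a l^k + b Q = 1`. The projector is `π = (b Q)(B)`: `π = 0` would make `B - μ`
  -- invertible, and `π = 1` would make it nilpotent.
  obtain ⟨Q, hQ, hdvd⟩ := Polynomial.exists_eq_pow_rootMultiplicity_mul_and_not_dvd _ hP0 μ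
  set k := B.charpoly.rootMultiplicity μ with hk
  have hkpos : 0 < k := (Polynomial.rootMultiplicity_pos hP0).2 hroot
  set l : Polynomial C := Polynomial.X - Polynomial.C μ with hl
  obtain ⟨a, b, hab⟩ : IsCoprime (l ^ k) Q :=
    IsCoprime.pow_left (((Polynomial.irreducible_X_sub_C μ).coprime_iff_not_dvd).2 hdvd)
  let ev : Polynomial C →ₐ[C] Matrix (Fin n) (Fin n) C := Polynomial.aeval B
  have evl : ev l = B - Matrix.scalar _ μ := by
    simp only [ev, hl, map_sub, Polynomial.aeval_X, Polynomial.aeval_C]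
    rfl
  have evP : ev (l ^ k * Q) = 0 := by
    rw [← hQ]; exact Matrix.aeval_self_charpoly B
  have evX : ev Polynomial.X = B := Polynomial.aeval_X B
  have hcomm : ∀ p q, ev p * ev q = ev q * ev p := fun p q => by
    rw [← map_mul, ← map_mul, mul_comm]
  have hsum : ev (a * l ^ k) + ev (b * Q) = 1 := by rw [← map_add, hab, map_one]
  have hρ : 1 - ev (b * Q) = ev (a * l ^ k) := by rw [← hsum, add_sub_cancel_right]
  have hρπ : ev (a * l ^ k) * ev (b * Q) = 0 := by
    rw [← map_mul, show a * l ^ k * (b * Q) = a * b * (l ^ k * Q) by ring, map_mul, evP, mul_zero]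
  have hππ : ev (b * Q) * ev (b * Q) = ev (b * Q) := by
    have := congrArg (· * ev (b * Q)) hsum
    simpa only [add_mul, hρπ, zero_add, one_mul] using this
  have hρρ : ev (a * l ^ k) * ev (a * l ^ k) = ev (a * l ^ k) := by
    have := congrArg (ev (a * l ^ k) * ·) hsum
    simpa only [mul_add, hρπ, add_zero, mul_one] using this
  refine ⟨ev (b * Q), hππ, by rw [← evX]; exact hcomm _ _, fun h => ?_, fun h => hnil ⟨k, ?_⟩, ?_⟩
  · rw [h, add_zero] at hsum
    have : (ev (a * l ^ (k - 1)) * (B - Matrix.scalar _ μ)).det = 1 := by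
      rw [← evl, ← map_mul, mul_assoc, ← pow_succ, Nat.sub_add_cancel hkpos, hsum, Matrix.det_one]
    rw [Matrix.det_mul, hμ, mul_zero] at this
    exact zero_ne_one this
  · rw [← evl, ← map_pow, ← one_mul (ev (l ^ k)), ← h, ← map_mul,
      show b * Q * l ^ k = b * (l ^ k * Q) by ring, map_mul, evP, mul_zero]
  · rw [hρ]
    -- `G` inverts `l(B)` on the range of `1 - π`. The Sylvester equation is then solved by the sum
    -- of `G^{i+1} Y l(B)^i`, which is finite because `Y = Y π` is killed on the right by `l(B)^k`.
    set G := ev (a * l ^ (k - 1) * (a * l ^ k)) with hG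
    have hlG : ev l * G = ev (a * l ^ k) := by
      rw [hG, ← map_mul, show l * (a * l ^ (k - 1) * (a * l ^ k)) =
        (a * (l ^ (k - 1) * l)) * (a * l ^ k) by ring, ← pow_succ, Nat.sub_add_cancel hkpos,
        map_mul, hρρ]
    have hρG : ev (a * l ^ k) * G = G := by
      rw [hG, hcomm, map_mul, mul_assoc, hρρ]
    have key : ∀ j, ∀ Y, ev (a * l ^ k) * Y = Y → Y * ev (b * Q) = Y → Y * ev (l ^ j) = 0 →
        ∃ X, ev (a * l ^ k) * X = X ∧ X * ev (b * Q) = X ∧ ev l * X - X * ev l = Y := by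
      intro j
      induction j with
      | zero =>
        intro Y _ _ h
        rw [pow_zero, map_one, mul_one] at h
        exact ⟨0, by simp [h]⟩
      | succ j ih =>
        intro Y h1 h2 h3
        obtain ⟨X, hX1, hX2, hX3⟩ := ih (G * Y * ev l) (by
            rw [← mul_assoc, ← mul_assoc, hρG]) (by
            rw [mul_assoc, hcomm, ← mul_assoc, mul_assoc G, h2]) (by
            rw [mul_assoc, ← map_mul, ← pow_succ', mul_assoc, h3, mul_zero])
        refine ⟨G * Y + X, ?_, ?_, ?_⟩
        · rw [mul_add, ← mul_assoc, hρG, hX1]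
        · rw [add_mul, mul_assoc, h2, hX2]
        · rw [mul_add, add_mul, ← mul_assoc, hlG, h1, ← sub_sub, add_sub_right_comm]
          rw [sub_eq_iff_eq_add] at hX3
          rw [hX3]
          abel
    intro Y h1 h2
    obtain ⟨X, hX1, hX2, hX3⟩ := key k Y h1 h2 (by
      rw [← h2, mul_assoc, ← map_mul, show b * Q * l ^ k = b * (l ^ k * Q) by ring, map_mul, evP,
        mul_zero, mul_zero])
    refine ⟨X, hX1, hX2, ?_⟩
    rw [← hX3, evl, sub_mul, mul_sub, Matrix.scalar_commute μ (fun r => mul_comm _ _) X]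
    abel

end Irregular

namespace Connection

/-! ### Krylov spaces and cyclic vectors of irreducible connections -/

section Cyclic

variable {K : Type u} [Field K] {δ : Deriv K} {E : Type v} [AddCommGroup E] [Module K E]

/-- The span of `v, ∇ v, …, ∇^{k-1} v`. -/
def krylov (D : Connection δ E) (v : E) (k : ℕ) : Submodule K E :=
  Submodule.span K (Set.range fun i : Fin k => (D)^[i] v)

theorem iterate_mem_krylov (D : Connection δ E) (v : E) {i k : ℕ} (h : i < k) :
    (D)^[i] v ∈ D.krylov v k := Submodule.subset_span ⟨⟨i, h⟩, rfl⟩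

theorem krylov_le {D : Connection δ E} {v : E} {k : ℕ} {W : Submodule K E}
    (h : ∀ i < k, (D)^[i] v ∈ W) : D.krylov v k ≤ W := by
  refine Submodule.span_le.2 ?_
  rintro _ ⟨i, rfl⟩
  exact h i i.2

theorem krylov_mono (D : Connection δ E) (v : E) {k l : ℕ} (h : k ≤ l) :
    D.krylov v k ≤ D.krylov v l :=
  krylov_le fun _ hi => D.iterate_mem_krylov v (hi.trans_le h)

theorem apply_mem_krylov (D : Connection δ E) (v : E) {k : ℕ} {e : E} (he : e ∈ D.krylov v k) :
    D e ∈ D.krylov v (k + 1) := by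
  induction he using Submodule.span_induction with
  | mem x hx =>
    obtain ⟨i, rfl⟩ := hx
    simp only
    rw [← Function.iterate_succ_apply' D]
    exact D.iterate_mem_krylov v (by omega)
  | zero => rw [map_zero]; exact Submodule.zero_mem _
  | add x y _ _ hx hy => rw [map_add]; exact Submodule.add_mem _ hx hy
  | smul a x hx' hx =>
    rw [D.leibniz]
    exact Submodule.add_mem _ (Submodule.smul_mem _ _ (D.krylov_mono v k.le_succ hx'))
      (Submodule.smul_mem _ _ hx)

theorem twist_iterate_mem_krylov (D : Connection δ E) (g : K) (v : E) (i : ℕ) :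
    (D.twist g)^[i] v ∈ D.krylov v (i + 1) := by
  induction i with
  | zero => exact D.iterate_mem_krylov v Nat.one_pos
  | succ i ih =>
    rw [Function.iterate_succ_apply', twist_apply]
    exact Submodule.sub_mem _ (D.apply_mem_krylov v ih)
      (Submodule.smul_mem _ _ (D.krylov_mono v (Nat.le_succ _) ih))

theorem krylov_twist_le (D : Connection δ E) (g : K) (v : E) (k : ℕ) :
    (D.twist g).krylov v k ≤ D.krylov v k :=
  krylov_le fun i hi => D.krylov_mono v hi (D.twist_iterate_mem_krylov g v i)

theorem twist_twist_neg (D : Connection δ E) (g : K) : (D.twist g).twist (-g) = D := by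
  refine DFunLike.ext _ _ fun e => ?_
  rw [twist_apply, twist_apply, neg_smul]
  abel

theorem krylov_twist (D : Connection δ E) (g : K) (v : E) (k : ℕ) :
    (D.twist g).krylov v k = D.krylov v k := by
  refine le_antisymm (D.krylov_twist_le g v k) ?_
  have := (D.twist g).krylov_twist_le (-g) v k
  rwa [twist_twist_neg] at this

/-- Expanding `(∇ - g)^{i+1} v`, the only correction not involving derivatives of order below `i` is
`-(i+1) g ∇^i v`. This lets a twist remove the subleading coefficient of a cyclic equation. -/
theorem twist_iterate_sub_mem_krylov (D : Connection δ E) (g : K) (v : E) (i : ℕ) :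
    (D.twist g)^[i + 1] v - (D)^[i + 1] v + ((i + 1 : ℕ) * g) • (D)^[i] v ∈ D.krylov v i := by
  induction i with
  | zero =>
    simp [twist_apply]
  | succ i ih =>
    have h1 := D.apply_mem_krylov v ih
    have h2 := D.krylov_mono v i.le_succ ih
    rw [Function.iterate_succ_apply' (D.twist g) (i + 1), twist_apply]
    set y := (D.twist g)^[i + 1] v with hy
    have h3 : (D)^[i] v ∈ D.krylov v (i + 1) := D.iterate_mem_krylov v i.lt_succ_self
    rw [map_add, map_sub, D.leibniz, ← Function.iterate_succ_apply' D,
      ← Function.iterate_succ_apply' D] at h1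
    have e : D y - g • y - (D)^[i + 1 + 1] v + ((i + 1 + 1 : ℕ) * g) • (D)^[i + 1] v =
        (D y - (D)^[i + 1 + 1] v + (δ ((i + 1 : ℕ) * g) • (D)^[i] v +
          ((i + 1 : ℕ) * g) • (D)^[i + 1] v)) -
        g • (y - (D)^[i + 1] v + ((i + 1 : ℕ) * g) • (D)^[i] v) +
        (g * ((i + 1 : ℕ) * g) - δ ((i + 1 : ℕ) * g)) • (D)^[i] v := by
      push_cast
      module
    rw [e]
    exact Submodule.add_mem _ (Submodule.sub_mem _ h1 (Submodule.smul_mem _ _ h2))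
      (Submodule.smul_mem _ _ h3)

/-- Irreducibility of a connection. -/
def IsIrred (D : Connection δ E) : Prop := ∀ W : Submodule K E, D.IsStable W → W = ⊥ ∨ W = ⊤

theorem IsIrred.twist {D : Connection δ E} (h : D.IsIrred) (g : K) : (D.twist g).IsIrred :=
  fun W hW => h W hW.of_twist

/-- A first dependence of `∇^j v` on its predecessors would make their span stable. That span is
nonzero if `j > 0`, and has dimension at most `j ≤ m`, so irreducibility excludes it. -/
theorem IsIrred.linearIndependent {D : Connection δ E} (h : D.IsIrred) {m : ℕ}
    (hm : Module.finrank K E = m + 1) {v : E} (hv : v ≠ 0) :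
    LinearIndependent K fun i : Fin (m + 1) => (D)^[i] v := by
  have key : ∀ j ≤ m, (D)^[j] v ∉ D.krylov v j := by
    intro j hj hmem
    have hst : D.IsStable (D.krylov v j) := by
      refine isStable_span ?_
      rintro _ ⟨i, rfl⟩
      simp only
      rw [← Function.iterate_succ_apply' D]
      rcases Nat.lt_or_ge (i + 1) j with hi | hi
      · exact D.iterate_mem_krylov v hi
      · rwa [show (i : ℕ).succ = j by omega]
    rcases h _ hst with h0 | h0
    · rcases Nat.eq_zero_or_pos j with rfl | hj'
      · rw [h0] at hmem
        exact hv hmem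
      · have := D.iterate_mem_krylov v hj'
        rw [h0] at this
        exact hv this
    · have h1 : Module.finrank K (D.krylov v j) ≤ j :=
        (finrank_range_le_card (R := K) (fun i : Fin j => (D)^[i] v)).trans_eq (by simp)
      rw [h0, finrank_top] at h1
      omega
  have : ∀ k ≤ m + 1, LinearIndependent K fun i : Fin k => (D)^[i] v := by
    intro k
    induction k with
    | zero => intro _; exact linearIndependent_empty_type
    | succ k ih =>
      intro hk
      rw [linearIndependent_finSucc']
      exact ⟨ih (by omega), key k (by omega)⟩
  exact this _ le_rfl

/-- An irreducible connection has, after a twist, a cyclic basis `e₀, …, e_m` with `∇ e_m` in the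
span of `e₀, …, e_{m-1}`. -/
theorem IsIrred.exists_cyclic [CharZero K] {D : Connection δ E} (h : D.IsIrred) {m : ℕ}
    (hm : Module.finrank K E = m + 1) :
    ∃ (g : K) (e : Module.Basis (Fin (m + 1)) K E) (b : Fin (m + 1) → K), b (Fin.last m) = 0 ∧
      ∀ j, D.twist g (e j) = ∑ i, (if j = Fin.last m then b i else
        if (i : ℕ) = j + 1 then 1 else 0) • e i := by
  have : FiniteDimensional K E := Module.finite_of_finrank_eq_succ hm
  have : Nontrivial E := Module.nontrivial_of_finrank_pos (R := K) (by omega)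
  obtain ⟨v, hv⟩ := exists_ne (0 : E)
  have hli := h.linearIndependent hm hv
  obtain ⟨b₀, hb₀⟩ : ∃ b₀ : Fin (m + 1) → K, ∑ i, b₀ i • (D)^[i] v = (D)^[m + 1] v := by
    rw [← Submodule.mem_span_range_iff_exists_fun,
      hli.span_eq_top_of_card_eq_finrank (by simp [hm])]
    trivial
  -- Twisting by `g` subtracts `(m + 1) g` from the coefficient of `∇^m v` in `∇^{m+1} v`; this
  -- choice makes the trace of the companion matrix vanish.
  set g : K := b₀ (Fin.last m) / (m + 1 : ℕ) with hg
  have hli' := (h.twist g).linearIndependent hm hv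
  have hlast : (D.twist g)^[m + 1] v ∈ (D.twist g).krylov v m := by
    rw [krylov_twist]
    have h1 := D.twist_iterate_sub_mem_krylov g v m
    have h2 : ((m + 1 : ℕ) : K) * g = b₀ (Fin.last m) := by
      rw [hg]
      have : ((m + 1 : ℕ) : K) ≠ 0 := Nat.cast_ne_zero.2 (by omega)
      field_simp
    rw [h2, ← hb₀, Fin.sum_univ_castSucc, Fin.val_last] at h1
    have h3 : ∑ i : Fin m, b₀ i.castSucc • (D)^[(i.castSucc : ℕ)] v ∈ D.krylov v m :=
      Submodule.sum_mem _ fun i _ => Submodule.smul_mem _ _ (D.iterate_mem_krylov v i.2)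
    have := Submodule.add_mem _ h1 h3
    convert this using 1
    abel
  obtain ⟨b₁, hb₁⟩ := (Submodule.mem_span_range_iff_exists_fun K).1 hlast
  refine ⟨g, basisOfLinearIndependentOfCardEqFinrank hli' (by simp [hm]), Fin.snoc b₁ 0, by simp,
    fun j => ?_⟩
  simp only [coe_basisOfLinearIndependentOfCardEqFinrank]
  rw [← Function.iterate_succ_apply' (D.twist g)]
  split_ifs with hj
  · subst hj
    rw [Fin.sum_univ_castSucc]
    simpa using hb₁.symm
  · have hj' : (j : ℕ) + 1 < m + 1 := by
      have := j.2
      have : (j : ℕ) ≠ m := fun h => hj (Fin.ext h)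
      omega
    rw [Finset.sum_eq_single ⟨j + 1, hj'⟩]
    · simp
    · intro i _ hi
      rw [if_neg (fun h => hi (Fin.ext h)), zero_smul]
    · simp

end Cyclic

end Connection

/-! ### Newton slope, shearing, and the induction for Turrittin's theorem -/

section Turrittin

variable {C : Type u} [Field C] [IsAlgClosed C] [CharZero C]

omit [IsAlgClosed C] in
/-- A companion matrix with trace zero and nonzero last column has an eigenvalue whose generalized
eigenspace is not the whole space. -/
theorem not_isNilpotent_companion {m : ℕ} (B : Matrix (Fin (m + 1)) (Fin (m + 1)) C)
    (hB : ∀ i j, j ≠ Fin.last m → B i j = if (i : ℕ) = j + 1 then 1 else 0)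
    (hlast : B (Fin.last m) (Fin.last m) = 0) (i₀ : Fin (m + 1)) (hi₀ : B i₀ (Fin.last m) ≠ 0)
    (μ : C) : ¬ IsNilpotent (B - Matrix.scalar _ μ) := by
  intro hnil
  -- The trace of `B - μ` is `-(m + 1) μ`, so nilpotency forces `μ = 0`, and then `B^{m+1} = 0` by
  -- Cayley–Hamilton.
  have htr : B.trace = 0 := by
    refine Finset.sum_eq_zero fun i _ => ?_
    rw [Matrix.diag_apply]
    by_cases hi : i = Fin.last m
    · rw [hi, hlast]
    · rw [hB i i hi, if_neg (by omega)]
  have h1 := (Matrix.isNilpotent_trace_of_isNilpotent hnil).eq_zero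
  rw [Matrix.trace_sub, htr, zero_sub, neg_eq_zero, Matrix.scalar_apply, Matrix.trace_diagonal] at h1
  have hμ : μ = 0 := by
    simp only [Finset.sum_const, Finset.card_univ, Fintype.card_fin, nsmul_eq_mul] at h1
    exact (mul_eq_zero.1 h1).resolve_left (Nat.cast_ne_zero.2 (by omega))
  rw [hμ, map_zero, sub_zero] at hnil
  have h2 := (Matrix.isNilpotent_charpoly_sub_pow_of_isNilpotent hnil).eq_zero
  have h3 : B ^ (m + 1) = 0 := by
    have := Matrix.aeval_self_charpoly B
    rw [sub_eq_zero.1 h2] at this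
    simpa using this
  -- A companion matrix moves the first basis vector through the whole basis, so `B^{m+1} e_0` is
  -- the last column, which is nonzero.
  have h4 : ∀ k (hk : k < m + 1), (B ^ k).mulVec (Pi.single 0 1) = Pi.single ⟨k, hk⟩ 1 := by
    intro k
    induction k with
    | zero => intro hk; rw [pow_zero, Matrix.one_mulVec]; rfl
    | succ k ih =>
      intro hk
      rw [pow_succ', ← Matrix.mulVec_mulVec, ih (by omega), Matrix.mulVec_single_one]
      ext i
      rw [Matrix.col_apply, hB _ _ (fun h => by have := congrArg Fin.val h; simp at this; omega)]
      simp [Pi.single_apply, Fin.ext_iff]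
  have h5 : (B ^ (m + 1)).mulVec (Pi.single 0 1) i₀ = B i₀ (Fin.last m) := by
    rw [pow_succ', ← Matrix.mulVec_mulVec, h4 m (by omega), Matrix.mulVec_single_one]
    rfl
  rw [h3, Matrix.zero_mulVec] at h5
  exact hi₀ h5.symm

/-- The irregular cyclic case: after ramification, the connection becomes reducible. -/
theorem exists_ramified_isStable {c : C} {m : ℕ} (b : Fin (m + 1) → C⸨X⸩)
    (hlast : b (Fin.last m) = 0) (hpole : ∃ i, ∃ n < 0, (b i).coeff n ≠ 0) :
    ∃ (s : ℕ+) (d : Fin (m + 1) → C⸨X⸩) (A' : Matrix (Fin (m + 1)) (Fin (m + 1)) C⸨X⸩),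
      (∀ i, d i ≠ 0) ∧
      (∀ i j, d i * A' i j = ramify C s (if j = Fin.last m then b i else
        if (i : ℕ) = j + 1 then 1 else 0) * d j + if i = j then delta (c / (s : ℕ)) (d j) else 0) ∧
      ∃ W, (matConn (delta (c / (s : ℕ))) A').IsStable W ∧ W ≠ ⊥ ∧ W ≠ ⊤ := by
  -- The maximum of the pole order of `b i` divided by `m + 1 - i` is the steepest slope of the
  -- Newton polygon.
  obtain ⟨i₀, -, hmax⟩ := Finset.exists_max_image Finset.univ
    (fun i : Fin (m + 1) => (-(b i).order : ℚ) / (m + 1 - i : ℕ)) Finset.univ_nonempty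
  have hpos : ∀ i : Fin (m + 1), 0 < m + 1 - (i : ℕ) := fun i => by omega
  have hmax' : ∀ i, -(b i).order * (m + 1 - i₀ : ℕ) ≤ -(b i₀).order * (m + 1 - i : ℕ) := by
    intro i
    have := hmax i (Finset.mem_univ i)
    rw [div_le_div_iff₀ (by exact_mod_cast hpos i) (by exact_mod_cast hpos i₀)] at this
    exact_mod_cast this
  have hr₀ : (b i₀).order < 0 := by
    obtain ⟨i, n, hn, hne⟩ := hpole
    have h1 := HahnSeries.order_le_of_coeff_ne_zero hne
    have h2 := hmax' i
    by_contra h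
    have h3 : (0 : ℤ) < (m + 1 - i₀ : ℕ) := by exact_mod_cast hpos i₀
    have h4 : (0 : ℤ) < (m + 1 - i : ℕ) := by exact_mod_cast hpos i
    nlinarith
  obtain ⟨r, hr⟩ := Int.eq_ofNat_of_zero_le (show 0 ≤ -(b i₀).order by omega)
  have hrpos : 0 < r := by omega
  have hb₀ : (b i₀).coeff (-r) ≠ 0 := by
    rw [show (-(r : ℤ)) = (b i₀).order by omega]
    intro h
    rw [HahnSeries.coeff_order_eq_zero] at h
    rw [h] at hr₀
    simp at hr₀
  -- The slope is `r / s`, not necessarily in lowest terms. After adjoining an `s`-th root,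
  -- rescaling the `i`-th basis vector by `x_s^{r i}` turns the matrix into `x_s^{-r}` times an
  -- integral one.
  let s : ℕ+ := ⟨m + 1 - i₀, hpos i₀⟩
  have hs : ((s : ℕ) : ℤ) = (m + 1 - i₀ : ℕ) := rfl
  let x : ℤ → C⸨X⸩ := fun n => HahnSeries.single n 1
  have hx : ∀ p q, x p * x q = x (p + q) := fun p q => by simp [x, HahnSeries.single_mul_single]
  have hx0 : x 0 = 1 := HahnSeries.single_zero_one
  let A : Matrix (Fin (m + 1)) (Fin (m + 1)) C⸨X⸩ := fun i j =>
    if j = Fin.last m then b i else if (i : ℕ) = j + 1 then 1 else 0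
  -- `F` is `x_s^r` times the rescaled matrix. Its subdiagonal entries are `1`, the diagonal
  -- correction vanishes at `x_s = 0`, and maximality of the slope makes the last column integral
  -- with nonzero constant term at `i₀`.
  let F : Matrix (Fin (m + 1)) (Fin (m + 1)) C⸨X⸩ := fun i j =>
    ramify C s (A i j) * x (r * (j - i + 1)) +
      if i = j then HahnSeries.C (c / (s : ℕ) * (r * j)) * x r else 0
  have hxr : ∀ n ≤ (0 : ℤ), (x r).coeff n = 0 := fun n hn =>
    HahnSeries.coeff_single_of_ne (by omega)
  have hfin : ∀ i j : Fin (m + 1), j ≠ Fin.last m →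
      ramify C s (A i j) * x (r * (j - i + 1)) = if (i : ℕ) = j + 1 then 1 else 0 := by
    intro i j hj
    simp only [A, if_neg hj]
    split_ifs with h
    · rw [map_one, one_mul, h, ← hx0]
      congr 1
      push_cast
      ring
    · rw [map_zero, zero_mul]
  have hcol : ∀ (i : Fin (m + 1)) (n : ℤ), (ramify C s (A i (Fin.last m)) *
      x (r * ((Fin.last m : Fin (m + 1)) - i + 1))).coeff n =
      (ramify C s (b i)).coeff (n - r * (m + 1 - i : ℕ)) := by
    intro i n
    simp only [A, if_pos, x]
    rw [HahnSeries.coeff_mul_single, mul_one]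
    congr 2
    have := i.2
    rw [Nat.cast_sub (by omega), Fin.val_last]
    push_cast
    ring
  have hdiag : ∀ (i j : Fin (m + 1)) (n : ℤ), n ≤ 0 →
      (if i = j then HahnSeries.C (c / (s : ℕ) * (r * j)) * x r else 0 : C⸨X⸩).coeff n = 0 := by
    intro i j n hn
    split_ifs
    · rw [HahnSeries.C_mul_eq_smul, HahnSeries.coeff_smul, hxr n hn, smul_zero]
    · rfl
  have hFint : ∀ i j, ∀ n < 0, (F i j).coeff n = 0 := by
    intro i j n hn
    simp only [F, HahnSeries.coeff_add]
    rw [hdiag i j n hn.le, add_zero]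
    by_cases hj : j = Fin.last m
    · subst hj
      rw [hcol]
      refine ramify_coeff_eq_zero_of_lt s (N := (b i).order)
        (fun k hk => HahnSeries.coeff_eq_zero_of_lt_order hk) ?_
      have := hmax' i
      rw [hr] at this
      rw [hs]
      linarith
    · rw [hfin i j hj]
      split_ifs
      · rw [← HahnSeries.single_zero_one, HahnSeries.coeff_single_of_ne hn.ne]
      · rfl
  choose B hB using fun i j => exists_eq_ofPowerSeries (F i j) (hFint i j)
  have hB0 : ∀ i j, matCoeff 0 B i j = (F i j).coeff 0 := by
    intro i j
    rw [hB, PowerSeries.coeff_coe]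
    rfl
  have h0fin : ∀ i j, j ≠ Fin.last m → matCoeff 0 B i j = if (i : ℕ) = j + 1 then 1 else 0 := by
    intro i j hj
    rw [hB0]
    simp only [F, HahnSeries.coeff_add]
    rw [hdiag i j 0 le_rfl, add_zero, hfin i j hj]
    split_ifs
    · simp
    · rfl
  have h0col : ∀ i, matCoeff 0 B i (Fin.last m) =
      (ramify C s (b i)).coeff (0 - r * (m + 1 - i : ℕ)) := by
    intro i
    rw [hB0]
    simp only [F, HahnSeries.coeff_add]
    rw [hdiag i _ 0 le_rfl, add_zero, hcol]
  -- Any eigenvalue of the leading matrix serves here; extremality plays no role.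
  obtain ⟨μ, hμ, -⟩ := exists_extremal_eigenvalue (one_ne_zero (α := C)) (matCoeff 0 B)
  obtain ⟨π, h1, h2, h3, h4, h5⟩ := exists_projector (matCoeff 0 B) μ hμ
    (not_isNilpotent_companion _ h0fin (by rw [h0col, hlast, map_zero]; rfl) i₀ (by
      rw [h0col, show (0 - r * (m + 1 - i₀ : ℕ) : ℤ) = (s : ℕ) * (-r : ℤ) by rw [hs]; ring,
        ramify_coeff_mul]
      exact hb₀) μ)
  obtain ⟨W, hW⟩ := exists_isStable_of_projector (c / (s : ℕ)) hrpos B π h1 h2 h3 h4 h5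
  refine ⟨s, fun i => x (r * i), _, fun i => HahnSeries.single_ne_zero one_ne_zero, ?_, W, hW⟩
  intro i j
  change x (r * i) * (x (-r) * HahnSeries.ofPowerSeries ℤ C (B i j)) =
    ramify C s (A i j) * x (r * j) + if i = j then delta (c / (s : ℕ)) (x (r * j)) else 0
  rw [← hB]
  simp only [F]
  rw [← mul_assoc, hx, mul_add, mul_left_comm, hx]
  congr 1
  · congr 2; ring
  · split_ifs with hij
    · subst hij
      rw [mul_left_comm, hx]
      simp only [x]
      rw [delta_single]
      push_cast
      congr 2
      ring_nf
    · rw [mul_zero]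

/-- **Turrittin's theorem**, in the form: after a ramification, a connection has no nonzero
horizontal maps to connections without eigenvectors. -/
theorem exists_vanishing_aux (n : ℕ) : ∀ (c : C), c ≠ 0 → ∀ (E : Type u) [AddCommGroup E]
    [Module C⸨X⸩ E] [FiniteDimensional C⸨X⸩ E] (D : Connection (delta c) E),
    Module.finrank C⸨X⸩ E = n → ∃ s, Vanishing.{u, u, w} D s := by
  induction n using Nat.strong_induction_on with
  | _ n ih =>
  intro c hc E _ _ _ D hn
  -- A reducible connection is handled by induction on the subspace and the quotient. The claim is
  -- quantified over `c` and `E` because it is also applied after ramification, which changes `c` to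
  -- `c / s` while keeping the dimension.
  have reduc : ∀ (c : C), c ≠ 0 → ∀ (E : Type u) [AddCommGroup E]
      [Module C⸨X⸩ E] [FiniteDimensional C⸨X⸩ E] (D : Connection (delta c) E),
      Module.finrank C⸨X⸩ E = n → (∃ W, D.IsStable W ∧ W ≠ ⊥ ∧ W ≠ ⊤) →
      ∃ s, Vanishing.{u, u, w} D s := by
    rintro c hc E _ _ _ D hn ⟨W, hW, hbot, htop⟩
    have h1 := W.finrank_quotient_add_finrank
    have h2 : 0 < Module.finrank C⸨X⸩ W := by
      rw [Nat.pos_iff_ne_zero, ne_eq, Submodule.finrank_eq_zero]; exact hbot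
    have h3 := Submodule.finrank_lt htop
    obtain ⟨s, hs⟩ := ih _ (hn ▸ h3) c hc W (D.restrict W hW) rfl
    obtain ⟨s', hs'⟩ := ih _ (by omega) c hc (E ⧸ W) (D.quotient W hW) rfl
    exact ⟨s * s', .of_quotient W hW (hs.mul s') (hs'.mul' s)⟩
  rcases n with _ | m
  · have := Module.finrank_zero_iff.1 hn
    refine ⟨1, fun K' _ δ' ψ _ E' _ _ D' _ ι _ _ e => ?_⟩
    rw [Subsingleton.elim e 0, map_zero]
  by_cases hirr : D.IsIrred
  · have : CharZero C⸨X⸩ := charZero_of_injective_ringHom (HahnSeries.C_injective (Γ := ℤ) (R := C))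
    obtain ⟨g, e, b, hb, he⟩ := hirr.exists_cyclic hn
    have hspan : ∀ x : E, ∃ k : Fin (m + 1) → C⸨X⸩, x = ∑ i, k i • e i := fun x =>
      ⟨e.repr x, (e.sum_repr x).symm⟩
    by_cases hpole : ∃ i, ∃ n < 0, (b i).coeff n ≠ 0
    · obtain ⟨s, d, A', hd, hA', hW⟩ := exists_ramified_isStable (c := c) b hb hpole
      have hs : ((s : ℕ) : C) ≠ 0 := by exact_mod_cast s.pos.ne'
      obtain ⟨s', hs'⟩ := reduc (c / (s : ℕ)) (div_ne_zero hc hs) (Fin (m + 1) → C⸨X⸩)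
        (matConn (delta (c / (s : ℕ))) A') (by simp) hW
      exact ⟨s * s', .of_twist g (.of_matConn e hspan _ he s s' d hd A' hA' hs')⟩
    · push Not at hpole
      choose β hβ using fun i => exists_eq_ofPowerSeries (b i) (hpole i)
      let B : Matrix (Fin (m + 1)) (Fin (m + 1)) C⟦X⟧ := fun i j =>
        if j = Fin.last m then β i else if (i : ℕ) = j + 1 then 1 else 0
      obtain ⟨w, hw, μ, hwμ⟩ := exists_eigenvector_of_integral hc B
      have he' : ∀ j, D.twist g (e j) =
          ∑ i, (B.map (HahnSeries.ofPowerSeries ℤ C)) i j • e i := by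
        intro j
        rw [he]
        refine Finset.sum_congr rfl fun i _ => ?_
        congr 1
        rw [Matrix.map_apply]
        simp only [B]
        split_ifs
        · exact hβ i
        · rw [map_one]
        · rw [map_zero]
      set v := ∑ i, w i • e i with hv
      have hv0 : v ≠ 0 := by
        intro h0
        refine hw (funext fun i => ?_)
        exact Fintype.linearIndependent_iff.1 e.linearIndependent w h0 i
      have hDv : D.twist g v = μ • v := by
        rw [hv, Connection.apply_sum_basis _ e _ he', hwμ, Finset.smul_sum]
        simp only [Pi.smul_apply, smul_eq_mul, smul_smul]
      -- By irreducibility the eigenvector spans `E`. A horizontal map would send it to an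
      -- eigenvector of the target, hence to zero.
      have htop : Submodule.span C⸨X⸩ {v} = ⊤ := by
        refine ((hirr.twist g) _ (Connection.isStable_span_singleton hDv)).resolve_left fun h => ?_
        exact hv0 (Submodule.span_singleton_eq_bot.1 h)
      refine ⟨1, .of_twist g ?_⟩
      intro K' _ δ' ψ _ E' _ _ D' hD' ι hι hιD x
      have hx : x ∈ Submodule.span C⸨X⸩ {v} := htop ▸ Submodule.mem_top
      obtain ⟨k, rfl⟩ := Submodule.mem_span_singleton.1 hx
      rw [hι, hD' (ψ (ramify C 1 μ)) (ι v) (by rw [← hιD, hDv, hι]), smul_zero]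
  · simp only [Connection.IsIrred, not_forall, not_or] at hirr
    obtain ⟨W, hW, h1, h2⟩ := hirr
    exact reduc c hc E D hn ⟨W, hW, h1, h2⟩

/-- Writing the connection in a basis moves it to the universe of `C`, where the induction takes
place. The change of basis is phrased as a ramification of index `1` with trivial rescaling. -/
theorem exists_vanishing {c : C} (hc : c ≠ 0) {E : Type v} [AddCommGroup E] [Module C⸨X⸩ E]
    [FiniteDimensional C⸨X⸩ E] (D : Connection (delta c) E) : ∃ s, Vanishing.{u, v, w} D s := by
  let e := Module.finBasis C⸨X⸩ E
  let A : Matrix _ _ C⸨X⸩ := fun i j => e.repr (D (e j)) i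
  obtain ⟨s, hs⟩ := exists_vanishing_aux.{u, w} _ (c / ((1 : ℕ+) : ℕ)) (by simpa using hc) _
    (matConn (delta (c / ((1 : ℕ+) : ℕ))) (A.map (ramify C 1))) rfl
  refine ⟨1 * s, .of_matConn e (fun x => ⟨e.repr x, (e.sum_repr x).symm⟩) A
    (fun j => (e.sum_repr _).symm) 1 s (fun _ => 1) (fun _ => one_ne_zero) _ (fun i j => ?_) hs⟩
  have : delta (c / ((1 : ℕ+) : ℕ)) (1 : C⸨X⸩) = 0 := delta_C _ 1
  rw [this, ite_self, one_mul, mul_one, add_zero, Matrix.map_apply]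

end Turrittin

namespace Connection

/-! ### Transport of generalized eigenvectors and operators defined by types -/

section Transport

variable {K : Type u} [Field K] {δ : Deriv K} {E : Type v} [AddCommGroup E] [Module K E]

/-- One semilinear statement serves for horizontal linear maps, for Galois conjugation and for
embeddings of ramified fields. -/
theorem genEigen_map {K' : Type*} [CommRing K'] {δ' : Deriv K'} {E' : Type*} [AddCommGroup E']
    [Module K' E'] {D : Connection δ E} {D' : Connection δ' E'} (ρ : K → K') (j : E → E')
    (hj0 : j 0 = 0) (hjs : ∀ a b, j (a - b) = j a - j b)
    (hj : ∀ k e, j (k • e) = ρ k • j e) (hjD : ∀ e, j (D e) = D' (j e)) {f : K} {u : E}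
    (hu : u ∈ D.genEigen f) : j u ∈ D'.genEigen (ρ f) := by
  obtain ⟨q, hq⟩ := hu
  refine ⟨q, ?_⟩
  have : ∀ r, (D'.twist (ρ f))^[r] (j u) = j ((D.twist f)^[r] u) := by
    intro r
    induction r with
    | zero => rfl
    | succ r ih =>
      rw [Function.iterate_succ_apply', Function.iterate_succ_apply', ih, twist_apply, twist_apply,
        hjs, hj, hjD]
  rw [this, hq, hj0]

/-- The equation for `y` says `(∇ - g)(y u) = y (∇ - f) u`, so multiplication by `y` changes the
type from `f` to `g`. -/
theorem genEigen_smul {D : Connection δ E} {f g y : K} (hy : δ y + (f - g) * y = 0) {u : E}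
    (hu : u ∈ D.genEigen f) : y • u ∈ D.genEigen g := by
  obtain ⟨q, hq⟩ := hu
  refine ⟨q, ?_⟩
  have : ∀ r, (D.twist g)^[r] (y • u) = y • (D.twist f)^[r] u := by
    intro r
    induction r with
    | zero => rfl
    | succ r ih =>
      rw [Function.iterate_succ_apply', Function.iterate_succ_apply', ih, twist_apply, twist_apply,
        D.leibniz, show δ y = (g - f) * y by linear_combination hy]
      module
  rw [this, hq, smul_zero]

theorem isotypic_eq_typeSpan (D : Connection δ E) (f : K) : D.isotypic f = D.typeSpan {f} := by
  rw [isotypic_eq_span, typeSpan]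
  congr 1
  ext e
  simp

theorem mem_typeSpan {D : Connection δ E} {Φ : Set K} {f : K} (hf : f ∈ Φ) {e : E}
    (he : e ∈ D.genEigen f) : e ∈ D.typeSpan Φ := Submodule.subset_span ⟨f, hf, he⟩

theorem exists_linearMap_of_isInternal {ι : Type*} [DecidableEq ι] {A : ι → Submodule K E}
    (h : DirectSum.IsInternal A) (a : ι → K) :
    ∃ S : E →ₗ[K] E, ∀ i, ∀ u ∈ A i, S u = a i • u := by
  let eq := LinearEquiv.ofBijective (DirectSum.coeLinearMap A) h
  refine ⟨(DirectSum.toModule K ι E fun i => a i • (A i).subtype).comp eq.symm.toLinearMap,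
    fun i u hu => ?_⟩
  have h1 : eq.symm u = DirectSum.lof K ι (fun i => A i) i ⟨u, hu⟩ := by
    rw [LinearEquiv.symm_apply_eq]
    exact (DirectSum.coeLinearMap_lof A i ⟨u, hu⟩).symm
  rw [LinearMap.comp_apply, LinearEquiv.coe_coe, h1, DirectSum.toModule_lof]
  rfl

/-- If generalized eigenvectors span, there is a linear map acting as multiplication by `p f` on the
generalized eigenvectors of type `f`, where `p` is a function compatible with logarithmic
derivatives. -/
theorem exists_linearMap_of_typeSpan {D : Connection δ E} (p : K → K)
    (hp : ∀ f g, (∃ k : K, k ≠ 0 ∧ f - g = k⁻¹ * δ k) → p f = p g)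
    (htop : D.typeSpan Set.univ = ⊤) :
    ∃ S : E →ₗ[K] E, ∀ g, ∀ u ∈ D.genEigen g, S u = p g • u := by
  classical
  -- Types are grouped by the value of `p`. Different values belong to inequivalent types, so these
  -- spans are independent, and no representatives of the classes need to be chosen.
  obtain ⟨A, hA⟩ : ∃ A : K → Submodule K E, ∀ a, A a = D.typeSpan {f | p f = a} :=
    ⟨_, fun _ => rfl⟩
  have hind : iSupIndep A := by
    rw [funext hA]
    refine iSupIndep_typeSpan ?_
    rintro a b hab f rfl g rfl h
    exact hab (hp f g h)
  have hmem : ∀ g, ∀ u ∈ D.genEigen g, u ∈ A (p g) := fun g u hu => by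
    rw [hA]
    exact mem_typeSpan (f := g) (by simp) hu
  have hsup : ⨆ a : K, A a = ⊤ := by
    rw [eq_top_iff, ← htop]
    refine Submodule.span_le.2 ?_
    rintro e ⟨f, -, he⟩
    exact Submodule.mem_iSup_of_mem (p f) (hmem f e he)
  have hint : DirectSum.IsInternal A :=
    DirectSum.isInternal_submodule_of_iSupIndep_of_iSup_eq_top hind hsup
  obtain ⟨S, hS⟩ := exists_linearMap_of_isInternal (A := A) (ι := K) hint id
  exact ⟨S, fun g u hu => hS (p g) u (hmem g u hu)⟩

/-- A map with the right action on a spanning set of generalized eigenvectors equals the one built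
from all of them. It therefore suffices to test the action on a spanning set. -/
theorem linearMap_apply_of_span {D : Connection δ E} (p : K → K)
    (hp : ∀ f g, (∃ k : K, k ≠ 0 ∧ f - g = k⁻¹ * δ k) → p f = p g) (S : E →ₗ[K] E)
    (htop : Submodule.span K {u | ∃ f, u ∈ D.genEigen f ∧ S u = p f • u} = ⊤) {g : K} {u : E}
    (hu : u ∈ D.genEigen g) : S u = p g • u := by
  obtain ⟨S', hS'⟩ := exists_linearMap_of_typeSpan p hp (D := D) (by
    rw [eq_top_iff, ← htop]
    exact Submodule.span_mono fun u ⟨f, hf, _⟩ => ⟨f, trivial, hf⟩)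
  have : S = S' := LinearMap.ext_on htop fun u ⟨f, hf, hS⟩ => by rw [hS, hS' f u hf]
  rw [this, hS' g u hu]

/-- If generalized eigenvectors span a finite dimensional space, it is the direct sum of finitely
many isotypic components with types distinct modulo logarithmic derivatives. -/
theorem exists_isInternal_isotypic [FiniteDimensional K E] {D : Connection δ E}
    (htop : D.typeSpan Set.univ = ⊤) :
    ∃ (m : ℕ) (f : Fin m → K), (∀ i j, i ≠ j → ¬ ∃ k : K, k ≠ 0 ∧ f i - f j = k⁻¹ * δ k) ∧
      DirectSum.IsInternal fun i => D.isotypic (f i) := by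
  classical
  -- A finite spanning set of types of least cardinality contains no two equivalent ones, since
  -- equivalent types have the same isotypic subspace.
  have hex : ∃ m : ℕ, ∃ F : Finset K, F.card = m ∧ ⨆ f ∈ F, D.isotypic f = ⊤ := by
    have h1 : (⊤ : Submodule K E) ≤ ⨆ f : K, D.isotypic f := by
      rw [← htop]
      refine Submodule.span_le.2 ?_
      rintro e ⟨f, -, he⟩
      exact Submodule.mem_iSup_of_mem f (Submodule.subset_span he)
    obtain ⟨F, hF⟩ := CompleteLattice.IsCompactElement.exists_finset_of_le_iSup _
      ((Submodule.fg_iff_compact _).1 (Module.Finite.fg_top (R := K) (M := E))) _ h1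
    exact ⟨_, F, rfl, eq_top_iff.2 hF⟩
  obtain ⟨F, hF, hFtop⟩ := Nat.find_spec hex
  have hdist : ∀ f ∈ F, ∀ g ∈ F, f ≠ g → ¬ ∃ k : K, k ≠ 0 ∧ f - g = k⁻¹ * δ k := by
    rintro f hf g hg hfg ⟨k, hk, hkfg⟩
    have hle : D.isotypic g ≤ D.isotypic f := by
      refine Submodule.span_le.2 fun u hu => ?_
      have h1 := genEigen_smul (y := k) (f := g) (g := f) (by
        rw [← neg_sub f g, hkfg]; field_simp; ring) hu
      have h2 := (D.isotypic f).smul_mem k⁻¹ (Submodule.subset_span h1)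
      rwa [smul_smul, inv_mul_cancel₀ hk, one_smul] at h2
    refine Nat.find_min hex (m := (F.erase g).card) ?_ ⟨F.erase g, rfl, ?_⟩
    · rw [← hF]; exact Finset.card_erase_lt_of_mem hg
    · rw [eq_top_iff, ← hFtop]
      refine iSup₂_le fun h hh => ?_
      by_cases hhg : h = g
      · subst hhg
        exact hle.trans (le_iSup₂_of_le f (Finset.mem_erase.2 ⟨hfg, hf⟩) le_rfl)
      · exact le_iSup₂_of_le h (Finset.mem_erase.2 ⟨hhg, hh⟩) le_rfl
  refine ⟨F.card, fun i => F.equivFin.symm i, fun i j hij => ?_, ?_⟩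
  · refine hdist _ (F.equivFin.symm i).2 _ (F.equivFin.symm j).2 fun h => hij ?_
    exact F.equivFin.symm.injective (Subtype.ext h)
  · refine DirectSum.isInternal_submodule_of_iSupIndep_of_iSup_eq_top ?_ ?_
    · simp only [isotypic_eq_typeSpan]
      refine iSupIndep_typeSpan ?_
      rintro i j hij f rfl g rfl
      refine hdist _ (F.equivFin.symm i).2 _ (F.equivFin.symm j).2 fun h => hij ?_
      exact F.equivFin.symm.injective (Subtype.ext h)
    · rw [eq_top_iff, ← hFtop]
      refine iSup₂_le fun f hf => ?_
      refine le_iSup_of_le (F.equivFin ⟨f, hf⟩) ?_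
      simp only [Equiv.symm_apply_apply, le_refl]

/-- The difference of two connections, as a linear map. -/
def diff (D D' : Connection δ E) : E →ₗ[K] E where
  toFun e := D e - D' e
  map_add' a b := by rw [map_add, map_add]; abel
  map_smul' k e := by rw [D.leibniz, D'.leibniz, RingHom.id_apply, smul_sub]; abel

theorem diff_apply (D D' : Connection δ E) (e : E) : D.diff D' e = D e - D' e := rfl

/-- The connection `∇ - S` for a linear map `S`. -/
def subLinear (D : Connection δ E) (S : E →ₗ[K] E) : Connection δ E where
  toFun e := D e - S e
  map_zero' := by simp
  map_add' a b := by rw [map_add, map_add]; abel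
  leibniz' f e := by rw [D.leibniz, map_smul, smul_sub]; abel

theorem subLinear_apply (D : Connection δ E) (S : E →ₗ[K] E) (e : E) :
    D.subLinear S e = D e - S e := rfl

theorem diff_subLinear (D : Connection δ E) (S : E →ₗ[K] E) : D.diff (D.subLinear S) = S := by
  ext e; rw [diff_apply, subLinear_apply, sub_sub_cancel]

end Transport

end Connection

/-! ### Turrittin's theorem over a ramified extension -/

section Ram

variable {C : Type u} [Field C]

theorem principalPart_coeff {A : Type u} [CommRing A] (f : A⸨X⸩) (n : ℤ) :
    (principalPart f).coeff n = if n < 0 then f.coeff n else 0 := by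
  rw [principalPart, HahnSeries.coeff_truncLT]

theorem principalPartRam_eq (s : ℕ+) (f g : Ramified C s)
    (h : ∃ k : Ramified C s, k ≠ 0 ∧ f - g = k⁻¹ * thetaRam C s k) :
    principalPartRam C s f = principalPartRam C s g := by
  obtain ⟨k, hk, hfg⟩ := h
  change principalPart (A := C) f = principalPart (A := C) g
  ext n
  refine (principalPart_coeff (A := C) f n).trans
    (Eq.trans ?_ (principalPart_coeff (A := C) g n).symm)
  split_ifs with hn
  · have := coeff_logDeriv (C := C) ((s : ℕ) : C)⁻¹ (u := k) (g := f - g) hk hfg hn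
    exact sub_eq_zero.1 ((HahnSeries.coeff_sub (R := C) ..).symm.trans this)
  · rfl

variable [CharZero C] (s : ℕ+) {E : Type v} [AddCommGroup E] [Module C⸨X⸩ E]

theorem exists_thetaRam_add (h k : Ramified C s) :
    ∃ a y : Ramified C s, k = thetaRam C s a + h * a + y ∧ thetaRam C s y + h * y = 0 :=
  exists_delta_add (C := C) (c := ((s : ℕ) : C)⁻¹)
    (inv_ne_zero (by exact_mod_cast s.pos.ne')) h k

theorem ram_tmul (D : Connection (theta C) E) (g : Ramified C s) (e : E) :
    D.ram s (g ⊗ₜ e) = thetaRam C s g ⊗ₜ[C⸨X⸩] e + g ⊗ₜ[C⸨X⸩] D e := rfl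

theorem thetaRam_one : thetaRam C s 1 = 0 := by
  have := thetaRam_algebraMap C s 1
  rw [map_one] at this
  rw [this, ← HahnSeries.C_one, theta_C, map_zero]

/-- **Turrittin's theorem**: over some `C((x_s))`, generalized eigenvectors span. -/
theorem exists_typeSpan_ram_eq_top [IsAlgClosed C] [FiniteDimensional C⸨X⸩ E]
    (D : Connection (theta C) E) : ∃ s, (D.ram s).typeSpan Set.univ = ⊤ := by
  let D₁ : Connection (delta (1 : C)) E :=
    { toAddMonoidHom := D.toAddMonoidHom
      leibniz' := by rw [delta_one_eq]; exact D.leibniz' }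
  obtain ⟨s, hs⟩ := exists_vanishing.{u, v, max u v} one_ne_zero D₁
  refine ⟨s, ?_⟩
  set T := (D.ram s).typeSpan Set.univ with hT
  have hst : (D.ram s).IsStable T := Connection.isStable_typeSpan _ _
  -- The vanishing property is applied to `e ↦ 1 ⊗ e` modulo the span `T` of all generalized
  -- eigenvectors.
  have key := hs (Ramified C s) (thetaRam C s) (show C⸨X⸩ →+* Ramified C s from RingHom.id C⸨X⸩)
    (fun f => by
      rw [one_div]
      rfl)
    (Ramified C s ⊗[C⸨X⸩] E ⧸ T) ((D.ram s).quotient T hst)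
    (fun f e he => by
      induction e using Submodule.Quotient.induction_on with
      | H e =>
        refine (Submodule.Quotient.mk_eq_zero _).2
          (Connection.mem_typeSpan_univ_of_twist (exists_thetaRam_add s) f e ?_)
        have h1 : T.mkQ (D.ram s e - f • e) = 0 := by
          rw [map_sub, map_smul, ← Connection.quotient_mk _ _ hst]
          exact sub_eq_zero.2 he
        exact (Submodule.Quotient.mk_eq_zero _).1 h1)
    (T.mkQ.toAddMonoidHom.comp
      (TensorProduct.mk C⸨X⸩ (Ramified C s) E 1).toAddMonoidHom)
    (fun k e => by
      change T.mkQ ((1 : Ramified C s) ⊗ₜ[C⸨X⸩] (k • e)) =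
        (algebraMap C⸨X⸩ (Ramified C s) k) • T.mkQ ((1 : Ramified C s) ⊗ₜ[C⸨X⸩] e)
      rw [← map_smul, TensorProduct.tmul_smul, algebraMap_smul])
    (fun e => by
      change T.mkQ ((1 : Ramified C s) ⊗ₜ[C⸨X⸩] (D e)) = T.mkQ (D.ram s (1 ⊗ₜ e))
      rw [ram_tmul, thetaRam_one, TensorProduct.zero_tmul, zero_add])
  rw [eq_top_iff]
  rintro z -
  induction z using TensorProduct.induction_on with
  | zero => exact T.zero_mem
  | add a b ha hb => exact T.add_mem ha hb
  | tmul k e =>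
    have h1 : (1 : Ramified C s) ⊗ₜ[C⸨X⸩] e ∈ T := (Submodule.Quotient.mk_eq_zero _).1 (key e)
    have := T.smul_mem k h1
    rwa [TensorProduct.smul_tmul', smul_eq_mul, mul_one] at this

end Ram

/-! ### The decomposition `C((x_s)) = ⨁ x_s^j C((x))` and the rotation `x_s ↦ ζ x_s` -/

section RamCoeff

variable {C : Type u} [Field C] (s : ℕ+)

/-- The component `∑ₘ f_{sm+j} xᵐ` of `f ∈ C((x_s))`. -/
def ramComponent (j : ℕ) (f : C⸨X⸩) : C⸨X⸩ where
  coeff m := f.coeff ((s : ℕ) * m + j)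
  isPWO_support' := by
    obtain ⟨N, hN⟩ := exists_coeff_bound f
    refine (BddBelow.isWF ⟨-(N : ℤ) - j, fun m hm => ?_⟩).isPWO
    by_contra h
    refine hm (hN _ ?_)
    have hs : (1 : ℤ) ≤ (s : ℕ) := by exact_mod_cast s.pos
    nlinarith

theorem ramComponent_coeff (j : ℕ) (f : C⸨X⸩) (m : ℤ) :
    (ramComponent s j f).coeff m = f.coeff ((s : ℕ) * m + j) := rfl

theorem ramComponent_add (j : ℕ) (f g : C⸨X⸩) :
    ramComponent s j (f + g) = ramComponent s j f + ramComponent s j g := rfl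

theorem coeff_single_mul_ramify (i : ℕ) (h : C⸨X⸩) {j : ℕ} (hi : i < s) (hj : j < s) (m : ℤ) :
    ((HahnSeries.single (i : ℤ) 1 : C⸨X⸩) * ramify C s h).coeff ((s : ℕ) * m + j) =
      if i = j then h.coeff m else 0 := by
  rw [HahnSeries.coeff_single_mul, one_mul]
  split_ifs with hij
  · subst hij
    rw [add_sub_cancel_right, ramify_coeff_mul]
  · refine ramify_coeff_eq_zero C s h ?_
    rintro ⟨k, hk⟩
    have h1 : ((s : ℕ) : ℤ) ∣ (j : ℤ) - i := ⟨k - m, by linear_combination -hk⟩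
    have h2 := Int.eq_zero_of_abs_lt_dvd h1 (by rw [abs_lt]; constructor <;> omega)
    omega

theorem eq_sum_ramComponent (f : C⸨X⸩) :
    f = ∑ j ∈ Finset.range s, (HahnSeries.single (j : ℤ) 1 : C⸨X⸩) *
      ramify C s (ramComponent s j f) := by
  ext n
  have hs : (0 : ℤ) < (s : ℕ) := by exact_mod_cast s.pos
  obtain ⟨j, hj⟩ := Int.eq_ofNat_of_zero_le (Int.emod_nonneg n hs.ne')
  have hj' : j < s := by have := Int.emod_lt_of_pos n hs; omega
  have hn : n = (s : ℕ) * (n / (s : ℕ)) + j := by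
    have := Int.mul_ediv_add_emod n (s : ℕ)
    rw [hj] at this
    exact this.symm
  generalize n / (s : ℕ) = m at hn
  subst hn
  rw [HahnSeries.coeff_sum, Finset.sum_congr rfl fun i hi =>
    coeff_single_mul_ramify s i _ (Finset.mem_range.1 hi) hj' m]
  simp [hj', ramComponent_coeff]

theorem ramComponent_sum (h : ℕ → C⸨X⸩) {j : ℕ} (hj : j < s) :
    ramComponent s j (∑ i ∈ Finset.range s, (HahnSeries.single (i : ℤ) 1 : C⸨X⸩) *
      ramify C s (h i)) = h j := by
  ext m
  rw [ramComponent_coeff, HahnSeries.coeff_sum, Finset.sum_congr rfl fun i hi =>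
    coeff_single_mul_ramify s i _ (Finset.mem_range.1 hi) hj m]
  simp [hj]

theorem ramComponent_ramify_mul {j : ℕ} (hj : j < s) (g f : C⸨X⸩) :
    ramComponent s j (ramify C s g * f) = g * ramComponent s j f := by
  conv_lhs => rw [eq_sum_ramComponent s f, Finset.mul_sum]
  rw [← ramComponent_sum s (fun i => g * ramComponent s i f) hj]
  congr 1
  refine Finset.sum_congr rfl fun i _ => ?_
  rw [map_mul]
  ring

theorem ramComponent_zero_one : ramComponent s 0 (1 : C⸨X⸩) = 1 := by
  ext m
  rw [ramComponent_coeff, ← HahnSeries.single_zero_one, HahnSeries.coeff_single,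
    HahnSeries.coeff_single]
  simp

/-- The extra term comes from `ϑ(x_s^j) = (j/s) x_s^j`. -/
theorem ramComponent_delta [CharZero C] (j : ℕ) (f : C⸨X⸩) :
    ramComponent s j (delta ((s : ℕ) : C)⁻¹ f) =
      theta C (ramComponent s j f) + HahnSeries.C ((j : C) / (s : ℕ)) * ramComponent s j f := by
  have hs : ((s : ℕ) : C) ≠ 0 := by exact_mod_cast s.pos.ne'
  ext m
  rw [ramComponent_coeff, delta_coeff, HahnSeries.coeff_add, theta_coeff,
    HahnSeries.C_mul_eq_smul, HahnSeries.coeff_smul, ramComponent_coeff, smul_eq_mul]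
  push_cast
  field_simp

/-- The automorphism `x ↦ ζ x` of `C((x))`. -/
def rotate {ζ : C} (hζ : ζ ≠ 0) : C⸨X⸩ →+* C⸨X⸩ where
  toFun f :=
    { coeff := fun n => ζ ^ n * f.coeff n
      isPWO_support' := f.isPWO_support.mono fun n hn h => hn (by simp [h]) }
  map_one' := by
    ext n
    simp only [HahnSeries.coeff_one]
    split_ifs with h
    · simp [h]
    · simp
  map_zero' := by ext n; simp
  map_add' f g := by ext n; simp [mul_add]
  map_mul' f g := by
    ext n
    change ζ ^ n * (f * g).coeff n = _
    rw [HahnSeries.coeff_mul, HahnSeries.coeff_mul, Finset.mul_sum]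
    refine Finset.sum_congr ?_ fun ij hij => ?_
    · ext ij
      simp [Finset.mem_antidiagonal, hζ, zpow_ne_zero]
    · rw [Finset.mem_antidiagonal] at hij
      rw [← hij.2.2, zpow_add₀ hζ]
      ring

theorem rotate_coeff {ζ : C} (hζ : ζ ≠ 0) (f : C⸨X⸩) (n : ℤ) :
    (rotate hζ f).coeff n = ζ ^ n * f.coeff n := rfl

theorem delta_rotate {ζ : C} (hζ : ζ ≠ 0) (c : C) (f : C⸨X⸩) :
    rotate hζ (delta c f) = delta c (rotate hζ f) := by
  ext n
  rw [rotate_coeff, delta_coeff, delta_coeff, rotate_coeff]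
  ring

theorem rotate_ramify {ζ : C} (hζ : ζ ≠ 0) (hs : ζ ^ (s : ℕ) = 1) (f : C⸨X⸩) :
    rotate hζ (ramify C s f) = ramify C s f := by
  ext n
  rw [rotate_coeff]
  by_cases h : ∃ m : ℤ, ((s : ℕ) : ℤ) * m = n
  · obtain ⟨m, rfl⟩ := h
    rw [zpow_mul, zpow_natCast, hs, one_zpow, one_mul]
  · rw [ramify_coeff_eq_zero C s f h, mul_zero]

theorem ramComponent_rotate {ζ : C} (hζ : ζ ≠ 0) (hs : ζ ^ (s : ℕ) = 1) (j : ℕ) (f : C⸨X⸩) :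
    ramComponent s j (rotate hζ f) = HahnSeries.C (ζ ^ j) * ramComponent s j f := by
  ext m
  rw [ramComponent_coeff, rotate_coeff, HahnSeries.C_mul_eq_smul, HahnSeries.coeff_smul,
    ramComponent_coeff, smul_eq_mul, zpow_add₀ hζ, zpow_mul, zpow_natCast, hs, one_zpow, one_mul,
    zpow_natCast]

theorem principalPart_rotate {ζ : C} (hζ : ζ ≠ 0) (f : C⸨X⸩) :
    principalPart (rotate hζ f) = rotate hζ (principalPart f) := by
  ext n
  rw [principalPart_coeff, rotate_coeff, rotate_coeff, principalPart_coeff]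
  split_ifs <;> simp

theorem principalPart_ramify (f : C⸨X⸩) :
    principalPart (ramify C s f) = ramify C s (principalPart f) := by
  have hs : (0 : ℤ) < (s : ℕ) := by exact_mod_cast s.pos
  ext n
  rw [principalPart_coeff]
  by_cases h : ∃ m : ℤ, ((s : ℕ) : ℤ) * m = n
  · obtain ⟨m, rfl⟩ := h
    rw [ramify_coeff_mul, ramify_coeff_mul, principalPart_coeff]
    have : ((s : ℕ) : ℤ) * m < 0 ↔ m < 0 := by
      constructor
      · intro h; by_contra h'; nlinarith
      · intro h; nlinarith
    simp only [this]
  · rw [ramify_coeff_eq_zero C s f h, ramify_coeff_eq_zero C s _ h, ite_self]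

end RamCoeff

/-! ### Galois descent and functoriality of irregular parts -/

section Descent

variable {C : Type u} [Field C] (s : ℕ+) {E : Type v} [AddCommGroup E] [Module C⸨X⸩ E]

/-- `ramComponent` as a linear map over `C((x))`. -/
def ramProj (j : Fin s) : Ramified C s →ₗ[C⸨X⸩] C⸨X⸩ where
  toFun f := ramComponent s j (show C⸨X⸩ from f)
  map_add' f g := ramComponent_add s j _ _
  map_smul' g f := by
    rw [Algebra.smul_def]
    exact ramComponent_ramify_mul s j.2 g f

/-- The `j`-th component of an element of `C((x_s)) ⊗ E = ⨁ⱼ x_sʲ E`. -/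
def tensorProj (j : Fin s) : Ramified C s ⊗[C⸨X⸩] E →ₗ[C⸨X⸩] E :=
  TensorProduct.lift ((LinearMap.lsmul C⸨X⸩ E).comp (ramProj s j))

theorem tensorProj_tmul (j : Fin s) (f : Ramified C s) (e : E) :
    tensorProj s j (f ⊗ₜ e) = ramProj s j f • e := rfl

/-- The element `x_s ^ j`. -/
def ramPow (C : Type u) [Field C] (s : ℕ+) (j : ℕ) : Ramified C s :=
  show C⸨X⸩ from HahnSeries.single (j : ℤ) 1

theorem eq_sum_ramProj (f : Ramified C s) :
    f = ∑ j : Fin s, ramPow C s j * algebraMap C⸨X⸩ (Ramified C s) (ramProj s j f) := by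
  refine (eq_sum_ramComponent s (show C⸨X⸩ from f)).trans ?_
  exact Finset.sum_range fun j => (HahnSeries.single (j : ℤ) 1 : C⸨X⸩) *
      ramify C s (ramComponent s j f)

theorem eq_sum_tensorProj (z : Ramified C s ⊗[C⸨X⸩] E) :
    z = ∑ j : Fin s, ramPow C s j ⊗ₜ[C⸨X⸩] tensorProj s j z := by
  induction z using TensorProduct.induction_on with
  | zero => simp
  | add a b ha hb =>
    simp only [map_add, TensorProduct.tmul_add, Finset.sum_add_distrib]
    rw [← ha, ← hb]
  | tmul f e =>
    conv_lhs => rw [eq_sum_ramProj s f, TensorProduct.sum_tmul]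
    refine Finset.sum_congr rfl fun j _ => ?_
    rw [tensorProj_tmul, mul_comm, ← Algebra.smul_def, TensorProduct.smul_tmul]

theorem tensorProj_zero_one_tmul (e : E) : tensorProj (C := C) s ⟨0, s.pos⟩ (1 ⊗ₜ e) = e := by
  rw [tensorProj_tmul]
  have : ramProj (C := C) s ⟨0, s.pos⟩ 1 = 1 := ramComponent_zero_one s
  rw [this, one_smul]

theorem ramPow_zero : ramPow C s 0 = 1 := HahnSeries.single_zero_one

theorem one_tmul_injective : Function.Injective fun e : E => (1 : Ramified C s) ⊗ₜ[C⸨X⸩] e := by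
  intro a b h
  have := congrArg (tensorProj s ⟨0, s.pos⟩) h
  simpa only [tensorProj_zero_one_tmul] using this

/-- The Galois automorphism `x_s ↦ ζ x_s`. -/
def galois {ζ : C} (hζ : ζ ≠ 0) (hs : ζ ^ (s : ℕ) = 1) : Ramified C s →ₐ[C⸨X⸩] Ramified C s where
  toRingHom := show C⸨X⸩ →+* C⸨X⸩ from rotate hζ
  commutes' f := rotate_ramify s hζ hs f

theorem tensorProj_galois {ζ : C} (hζ : ζ ≠ 0) (hs : ζ ^ (s : ℕ) = 1) (j : Fin s)
    (z : Ramified C s ⊗[C⸨X⸩] E) :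
    tensorProj s j ((galois s hζ hs).toLinearMap.rTensor E z) =
      (HahnSeries.C (ζ ^ (j : ℕ)) : C⸨X⸩) • tensorProj s j z := by
  induction z using TensorProduct.induction_on with
  | zero => simp
  | add a b ha hb => simp only [map_add, smul_add, ha, hb]
  | tmul f e =>
    rw [LinearMap.rTensor_tmul, tensorProj_tmul, tensorProj_tmul, smul_smul]
    congr 1
    exact ramComponent_rotate s hζ hs j f

/-- Galois descent for vectors. -/
theorem eq_one_tmul_of_galois {ζ : C} (hζ : IsPrimitiveRoot ζ s)
    (z : Ramified C s ⊗[C⸨X⸩] E)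
    (hz : (galois s (hζ.ne_zero s.pos.ne') hζ.pow_eq_one).toLinearMap.rTensor E z = z) :
    z = 1 ⊗ₜ tensorProj s ⟨0, s.pos⟩ z := by
  conv_lhs => rw [eq_sum_tensorProj s z]
  rw [Finset.sum_eq_single ⟨0, s.pos⟩, ramPow_zero]
  · intro j _ hj
    have h1 := tensorProj_galois s (hζ.ne_zero s.pos.ne') hζ.pow_eq_one j z
    rw [hz] at h1
    -- The automorphism multiplies the `j`-th component by `ζ^j`, and `ζ^j ≠ 1` for `0 < j < s`
    -- because `ζ` is primitive.
    have h2 : (HahnSeries.C (ζ ^ (j : ℕ) - 1) : C⸨X⸩) • tensorProj s j z = 0 := by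
      rw [map_sub, sub_smul, ← h1, map_one, one_smul, sub_self]
    rcases smul_eq_zero.1 h2 with h3 | h3
    · have h4 : ζ ^ (j : ℕ) = 1 := sub_eq_zero.1 ((map_eq_zero _).1 h3)
      have h5 := (hζ.pow_eq_one_iff_dvd _).1 h4
      have h6 := Nat.eq_zero_of_dvd_of_lt h5 j.2
      exact absurd (Fin.ext h6) hj
    · rw [h3, TensorProduct.tmul_zero]
  · simp

variable [CharZero C]

theorem tensorProj_ram (D : Connection (theta C) E) (j : Fin s) (z : Ramified C s ⊗[C⸨X⸩] E) :
    tensorProj s j (D.ram s z) = D (tensorProj s j z) +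
      (HahnSeries.C ((j : ℕ) / (s : ℕ) : C) : C⸨X⸩) • tensorProj s j z := by
  induction z using TensorProduct.induction_on with
  | zero => simp
  | add a b ha hb => simp only [map_add, smul_add, ha, hb]; abel
  | tmul f e =>
    rw [ram_tmul, map_add, tensorProj_tmul, tensorProj_tmul, tensorProj_tmul, D.leibniz, smul_smul]
    have : ramProj s j (thetaRam C s f) = theta C (ramProj s j f) +
        HahnSeries.C ((j : ℕ) / (s : ℕ) : C) * ramProj s j f := ramComponent_delta s j f
    rw [this, add_smul]
    abel

theorem galois_ram {ζ : C} (hζ : ζ ≠ 0) (hs : ζ ^ (s : ℕ) = 1) (D : Connection (theta C) E)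
    (z : Ramified C s ⊗[C⸨X⸩] E) :
    (galois s hζ hs).toLinearMap.rTensor E (D.ram s z) =
      D.ram s ((galois s hζ hs).toLinearMap.rTensor E z) := by
  induction z using TensorProduct.induction_on with
  | zero => simp
  | add a b ha hb => simp only [map_add, ha, hb]
  | tmul f e =>
    rw [ram_tmul, map_add, LinearMap.rTensor_tmul, LinearMap.rTensor_tmul, LinearMap.rTensor_tmul,
      ram_tmul]
    congr 2
    exact delta_rotate (C := C) hζ _ f

omit [CharZero C] in
theorem rTensor_smul {s t : ℕ+} (g : Ramified C s →ₐ[C⸨X⸩] Ramified C t) (k : Ramified C s)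
    (z : Ramified C s ⊗[C⸨X⸩] E) :
    g.toLinearMap.rTensor E (k • z) = g k • g.toLinearMap.rTensor E z := by
  induction z using TensorProduct.induction_on with
  | zero => simp
  | add a b ha hb => simp only [map_add, smul_add, ha, hb]
  | tmul f e =>
    rw [TensorProduct.smul_tmul', LinearMap.rTensor_tmul, LinearMap.rTensor_tmul,
      TensorProduct.smul_tmul']
    simp

/-- `S` is the irregular part of `∇`: over `C((x_s))`, generalized eigenvectors span, and `S` acts
on those of type `f` as multiplication by the principal part of `f`. -/
def IsIrregularPart (D : Connection (theta C) E) (S : E →ₗ[C⸨X⸩] E) : Prop :=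
  (D.ram s).typeSpan Set.univ = ⊤ ∧ ∀ g, ∀ u ∈ (D.ram s).genEigen g,
    S.baseChange (Ramified C s) u = principalPartRam C s g • u

theorem isIrregularPart_of_span (D : Connection (theta C) E) (S : E →ₗ[C⸨X⸩] E)
    (h : Submodule.span (Ramified C s) {u | ∃ f, u ∈ (D.ram s).genEigen f ∧
      S.baseChange (Ramified C s) u = principalPartRam C s f • u} = ⊤) :
    IsIrregularPart s D S := by
  refine ⟨?_, fun g u hu => Connection.linearMap_apply_of_span _ (principalPartRam_eq s) _ h hu⟩
  rw [eq_top_iff, ← h]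
  exact Submodule.span_mono fun u ⟨f, hf, _⟩ => ⟨f, trivial, hf⟩

/-- Conjugation by `x_s ↦ ζ x_s` sends type `f` to its rotate, and the principal part rotates along
with it. The operator over `C((x_s))` thus commutes with the Galois action and preserves the
invariants `1 ⊗ E`. -/
theorem exists_isIrregularPart [IsAlgClosed C] [FiniteDimensional C⸨X⸩ E]
    (D : Connection (theta C) E) : ∃ s, ∃ S : E →ₗ[C⸨X⸩] E, IsIrregularPart s D S := by
  obtain ⟨s, hs⟩ := exists_typeSpan_ram_eq_top D
  obtain ⟨S, hS⟩ := Connection.exists_linearMap_of_typeSpan _ (principalPartRam_eq s) hs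
  have : NeZero ((s : ℕ) : C) := ⟨by exact_mod_cast s.pos.ne'⟩
  obtain ⟨ζ, hζ⟩ := HasEnoughRootsOfUnity.exists_primitiveRoot C (s : ℕ)
  set σ := galois s (hζ.ne_zero s.pos.ne') hζ.pow_eq_one with hσ
  have hcomm : ∀ z : Ramified C s ⊗[C⸨X⸩] E, S (σ.toLinearMap.rTensor E z) =
      σ.toLinearMap.rTensor E (S z) := by
    intro z
    have hz : z ∈ (D.ram s).typeSpan Set.univ := hs ▸ Submodule.mem_top
    induction hz using Submodule.span_induction with
    | mem u hu =>
      obtain ⟨f, -, hu⟩ := hu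
      have h1 : σ.toLinearMap.rTensor E u ∈ (D.ram s).genEigen (σ f) :=
        Connection.genEigen_map σ _ (map_zero _) (map_sub _) (rTensor_smul σ)
          (galois_ram s _ _ D) hu
      rw [hS _ _ h1, hS _ _ hu, rTensor_smul]
      congr 1
      exact principalPart_rotate (C := C) (hζ.ne_zero s.pos.ne') f
    | zero => simp
    | add a b _ _ ha hb => simp only [map_add, ha, hb]
    | smul k a _ ha => rw [rTensor_smul, map_smul, map_smul, ha, rTensor_smul]
  let S₀ : E →ₗ[C⸨X⸩] E := (tensorProj s ⟨0, s.pos⟩).comp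
    ((S.restrictScalars C⸨X⸩).comp (TensorProduct.mk C⸨X⸩ (Ramified C s) E 1))
  have h1 : ∀ e : E, S (1 ⊗ₜ e) = 1 ⊗ₜ S₀ e := by
    intro e
    refine eq_one_tmul_of_galois s hζ _ ?_
    rw [← hcomm, LinearMap.rTensor_tmul]
    congr 2
    exact map_one σ
  have h2 : S₀.baseChange (Ramified C s) = S := by
    refine LinearMap.ext fun z => ?_
    induction z using TensorProduct.induction_on with
    | zero => simp
    | add a b ha hb => simp only [map_add, ha, hb]
    | tmul f e =>
      have : f ⊗ₜ[C⸨X⸩] e = f • ((1 : Ramified C s) ⊗ₜ[C⸨X⸩] e) := by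
        rw [TensorProduct.smul_tmul', smul_eq_mul, mul_one]
      rw [this, map_smul, map_smul, h1, LinearMap.baseChange_tmul]
  exact ⟨s, S₀, hs, fun g u hu => by rw [h2, hS g u hu]⟩

/-- The embedding of `C((x_s))` into `C((x_t))` for `t = s s'`. -/
def ramEmbed {s t : ℕ+} (s' : ℕ+) (h : s * s' = t) : Ramified C s →ₐ[C⸨X⸩] Ramified C t where
  toRingHom := show C⸨X⸩ →+* C⸨X⸩ from ramify C s'
  commutes' f := by
    subst h
    exact ramify_ramify s s' f

theorem ramEmbed_ram {s t : ℕ+} (s' : ℕ+) (h : s * s' = t) (D : Connection (theta C) E)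
    (z : Ramified C s ⊗[C⸨X⸩] E) :
    (ramEmbed s' h).toLinearMap.rTensor E (D.ram s z) =
      D.ram t ((ramEmbed s' h).toLinearMap.rTensor E z) := by
  induction z using TensorProduct.induction_on with
  | zero => simp
  | add a b ha hb => simp only [map_add, ha, hb]
  | tmul f e =>
    rw [ram_tmul, map_add, LinearMap.rTensor_tmul, LinearMap.rTensor_tmul, LinearMap.rTensor_tmul,
      ram_tmul]
    congr 2
    have h1 := delta_ramify (C := C) ((s : ℕ) : C)⁻¹ s' f
    have h2 : ((s : ℕ) : C)⁻¹ / (s' : ℕ) = ((t : ℕ) : C)⁻¹ := by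
      subst h
      push_cast
      rw [mul_inv, div_eq_mul_inv]
    rw [h2] at h1
    exact h1.symm

omit [CharZero C] in
theorem baseChange_rTensor {E' : Type*} [AddCommGroup E'] [Module C⸨X⸩ E'] {s t : ℕ+}
    (g : Ramified C s →ₐ[C⸨X⸩] Ramified C t) (S : E →ₗ[C⸨X⸩] E') (z : Ramified C s ⊗[C⸨X⸩] E) :
    S.baseChange (Ramified C t) (g.toLinearMap.rTensor E z) =
      g.toLinearMap.rTensor E' (S.baseChange (Ramified C s) z) := by
  induction z using TensorProduct.induction_on with
  | zero => simp
  | add a b ha hb => simp only [map_add, ha, hb]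
  | tmul f e => simp

/-- Images of generalized eigenvectors over `C((x_s))` span over `C((x_t))` and have the expected
eigenvalues. This allows irregular parts found at different indices to be compared over a common
extension. -/
theorem IsIrregularPart.ramify {s t : ℕ+} (s' : ℕ+) (h : s * s' = t) {D : Connection (theta C) E}
    {S : E →ₗ[C⸨X⸩] E} (hS : IsIrregularPart s D S) : IsIrregularPart t D S := by
  refine isIrregularPart_of_span t D S ?_
  set T := Submodule.span (Ramified C t) {u | ∃ f, u ∈ (D.ram t).genEigen f ∧
      S.baseChange (Ramified C t) u = principalPartRam C t f • u} with hT
  have key : ∀ z : Ramified C s ⊗[C⸨X⸩] E, (ramEmbed s' h).toLinearMap.rTensor E z ∈ T := by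
    intro z
    have hz : z ∈ (D.ram s).typeSpan Set.univ := hS.1 ▸ Submodule.mem_top
    induction hz using Submodule.span_induction with
    | mem u hu =>
      obtain ⟨f, -, hu⟩ := hu
      refine Submodule.subset_span ⟨ramEmbed s' h f, Connection.genEigen_map (ramEmbed s' h) _
        (map_zero _) (map_sub _) (rTensor_smul _) (ramEmbed_ram s' h D) hu, ?_⟩
      rw [baseChange_rTensor, hS.2 f u hu, rTensor_smul]
      congr 1
      exact (principalPart_ramify (C := C) s' f).symm
    | zero => rw [map_zero]; exact T.zero_mem
    | add a b _ _ ha hb => rw [map_add]; exact T.add_mem ha hb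
    | smul k a _ ha => rw [rTensor_smul]; exact T.smul_mem _ ha
  rw [eq_top_iff]
  rintro z -
  induction z using TensorProduct.induction_on with
  | zero => exact T.zero_mem
  | add a b ha hb => exact T.add_mem ha hb
  | tmul f e =>
    have := T.smul_mem f (key (1 ⊗ₜ e))
    rwa [LinearMap.rTensor_tmul, AlgHom.toLinearMap_apply, map_one, TensorProduct.smul_tmul',
      smul_eq_mul, mul_one] at this

/-- Horizontal maps commute with irregular parts. -/
theorem IsIrregularPart.comm {E' : Type w} [AddCommGroup E'] [Module C⸨X⸩ E'] {s s' : ℕ+}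
    {D : Connection (theta C) E} {S : E →ₗ[C⸨X⸩] E} (hS : IsIrregularPart s D S)
    {D' : Connection (theta C) E'} {S' : E' →ₗ[C⸨X⸩] E'} (hS' : IsIrregularPart s' D' S')
    (φ : E →ₗ[C⸨X⸩] E') (hφ : ∀ e, φ (D e) = D' (φ e)) (e : E) : φ (S e) = S' (φ e) := by
  replace hS := hS.ramify (t := s * s') s' rfl
  replace hS' := hS'.ramify (t := s * s') s (mul_comm _ _)
  set t := s * s'
  have hD : ∀ z, φ.baseChange (Ramified C t) (D.ram t z) = D'.ram t (φ.baseChange _ z) := by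
    intro z
    induction z using TensorProduct.induction_on with
    | zero => simp
    | add a b ha hb => simp only [map_add, ha, hb]
    | tmul f e =>
      simp only [ram_tmul, map_add, LinearMap.baseChange_tmul, hφ]
  have key : ∀ z, φ.baseChange (Ramified C t) (S.baseChange _ z) =
      S'.baseChange _ (φ.baseChange (Ramified C t) z) := by
    intro z
    have hz : z ∈ (D.ram t).typeSpan Set.univ := hS.1 ▸ Submodule.mem_top
    induction hz using Submodule.span_induction with
    | mem u hu =>
      obtain ⟨f, -, hu⟩ := hu
      have h1 : φ.baseChange (Ramified C t) u ∈ (D'.ram t).genEigen f :=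
        Connection.genEigen_map id _ (map_zero _) (map_sub _) (map_smul _) hD hu
      rw [hS.2 f u hu, hS'.2 f _ h1, map_smul]
    | zero => simp
    | add a b _ _ ha hb => simp only [map_add, ha, hb]
    | smul k a _ ha => simp only [map_smul, ha]
  have := key (1 ⊗ₜ e)
  simp only [LinearMap.baseChange_tmul] at this
  exact one_tmul_injective t this

theorem baseChange_diff (D D' : Connection (theta C) E) (z : Ramified C s ⊗[C⸨X⸩] E) :
    (D.diff D').baseChange (Ramified C s) z = D.ram s z - D'.ram s z := by
  induction z using TensorProduct.induction_on with
  | zero => simp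
  | add a b ha hb => simp only [map_add, ha, hb]; abel
  | tmul f e =>
    rw [LinearMap.baseChange_tmul, ram_tmul, ram_tmul, Connection.diff_apply,
      TensorProduct.tmul_sub]
    abel

theorem IsRegularSingularPart.exists_isIrregularPart {D D' : Connection (theta C) E}
    (h : IsRegularSingularPart D D') : ∃ s, IsIrregularPart s D (D.diff D') := by
  obtain ⟨-, s, m, f, hf, hp⟩ := h
  refine ⟨s, isIrregularPart_of_span s D _ ?_⟩
  rw [eq_top_iff, ← hf.isInternal.submodule_iSup_eq_top]
  refine iSup_le fun i => Submodule.span_le.2 fun u hu => Submodule.subset_span ⟨f i, hu, ?_⟩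
  rw [baseChange_diff, hp i u (Submodule.subset_span hu)]

theorem IsIrregularPart.isRegularSingularPart [FiniteDimensional C⸨X⸩ E] {s : ℕ+}
    {D : Connection (theta C) E} {S : E →ₗ[C⸨X⸩] E} (hS : IsIrregularPart s D S)
    (hreg : IsRegularSingular (D.subLinear S)) : IsRegularSingularPart D (D.subLinear S) := by
  obtain ⟨m, f, hdist, hint⟩ := Connection.exists_isInternal_isotypic hS.1
  refine ⟨hreg, s, m, f, ⟨fun i j hij => hdist i j hij, hint⟩, fun i e he => ?_⟩
  rw [← baseChange_diff, Connection.diff_subLinear]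
  induction he using Submodule.span_induction with
  | mem u hu => exact hS.2 _ u hu
  | zero => simp
  | add a b _ _ ha hb => simp only [map_add, smul_add, ha, hb]
  | smul k a _ ha => rw [map_smul, ha, smul_comm]

/-- Over `C((x_s))`, generalized eigenvectors with constant eigenvalues span the regular singular
part. -/
theorem IsIrregularPart.typeSpan_subLinear {s : ℕ+} {D : Connection (theta C) E}
    {S : E →ₗ[C⸨X⸩] E} (hS : IsIrregularPart s D S) :
    ((D.subLinear S).ram s).typeSpan (Set.range fun a : C =>
      algebraMap C⸨X⸩ (Ramified C s) (HahnSeries.C a)) = ⊤ := by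
  have hsub : ∀ z, (D.subLinear S).ram s z = D.ram s z - S.baseChange (Ramified C s) z := by
    intro z
    rw [← Connection.diff_subLinear D S, baseChange_diff, Connection.diff_subLinear,
      sub_sub_cancel]
  rw [eq_top_iff, ← hS.1]
  refine Submodule.span_le.2 ?_
  rintro u ⟨f, -, q, hq⟩
  -- Subtracting `S` removes the principal part `p` of `f`, and a solution `y` for the strictly
  -- positive part `f - p - a` gauges the rest to the constant `a`.
  set a : C := HahnSeries.coeff (R := C) f 0 with ha
  set p := principalPartRam C s f with hp
  set c : Ramified C s := algebraMap C⸨X⸩ (Ramified C s) (HahnSeries.C a) with hc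
  obtain ⟨y, hy0, hy⟩ : ∃ y : Ramified C s, y ≠ 0 ∧ thetaRam C s y + (f - p - c) * y = 0 := by
    refine exists_gauge (C := C) (c := ((s : ℕ) : C)⁻¹) (inv_ne_zero (by exact_mod_cast s.pos.ne'))
      _ (fun n hn => ?_)
    have h1 : HahnSeries.coeff (R := C) c n = if n = 0 then a else 0 := by
      have : c = HahnSeries.C (R := C) a := ramify_C s a
      rw [this, HahnSeries.C_apply, HahnSeries.coeff_single]
      split_ifs <;> rfl
    have h2 : HahnSeries.coeff (R := C) p n = if n < 0 then HahnSeries.coeff (R := C) f n else 0 :=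
      principalPart_coeff (A := C) f n
    have h3 : HahnSeries.coeff (R := C) (f - p - c) n = HahnSeries.coeff (R := C) f n -
      HahnSeries.coeff (R := C) p n - HahnSeries.coeff (R := C) c n := rfl
    rw [h3, h1, h2]
    rcases hn.lt_or_eq with hn | rfl
    · rw [if_pos hn, if_neg hn.ne]; ring
    · rw [if_neg (lt_irrefl _), if_pos rfl, ha]; ring
  have hit : ∀ r, (((D.subLinear S).ram s).twist c)^[r] (y • u) =
      y • ((D.ram s).twist f)^[r] u := by
    intro r
    induction r with
    | zero => rfl
    | succ r ih =>
      -- All iterates keep the type `f`, so `S` acts on each of them as `p`.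
      have hmem : ((D.ram s).twist f)^[r] u ∈ (D.ram s).genEigen f := by
        refine ⟨q, ?_⟩
        rw [← Function.iterate_add_apply, add_comm, Function.iterate_add_apply, hq,
          Connection.iterate_zero_vec]
      rw [Function.iterate_succ_apply', Function.iterate_succ_apply', ih, Connection.twist_apply,
        Connection.twist_apply, hsub, LinearMap.map_smul, hS.2 f _ hmem, (D.ram s).leibniz,
        show thetaRam C s y = -((f - p - c) * y) by linear_combination hy]
      module
  have h4 : y • u ∈ ((D.subLinear S).ram s).typeSpan (Set.range fun a : C =>
      algebraMap C⸨X⸩ (Ramified C s) (HahnSeries.C a)) :=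
    Connection.mem_typeSpan (f := c) (Set.mem_range_self a) ⟨q, by rw [hit, hq, smul_zero]⟩
  have h5 := Submodule.smul_mem _ y⁻¹ h4
  rwa [smul_smul, inv_mul_cancel₀ hy0, one_smul] at h5

end Descent

/-! ### Constant types: descent to `C((x))` and normalization to `τ` -/

section Constants

variable {C : Type u} [Field C] [CharZero C] {E : Type v} [AddCommGroup E] [Module C⸨X⸩ E]

/-- On the summand `x_s^j ⊗ E` the connection is `∇ + j/s`, and it respects the decomposition; each
component is thus a generalized eigenvector with the exponent lowered by `j/s`. -/
theorem tensorProj_mem_genEigen (s : ℕ+) {D : Connection (theta C) E} {a : C}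
    {z : Ramified C s ⊗[C⸨X⸩] E}
    (hz : z ∈ (D.ram s).genEigen (algebraMap C⸨X⸩ (Ramified C s) (HahnSeries.C a))) (j : Fin s) :
    tensorProj s j z ∈ D.genEigen (HahnSeries.C (a - (j : ℕ) / (s : ℕ))) := by
  obtain ⟨q, hq⟩ := hz
  refine ⟨q, ?_⟩
  have : ∀ r, (D.twist (HahnSeries.C (a - (j : ℕ) / (s : ℕ))))^[r] (tensorProj s j z) =
      tensorProj s j
        (((D.ram s).twist (algebraMap C⸨X⸩ (Ramified C s) (HahnSeries.C a)))^[r] z) := by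
    intro r
    induction r with
    | zero => rfl
    | succ r ih =>
      rw [Function.iterate_succ_apply', Function.iterate_succ_apply', ih, Connection.twist_apply,
        Connection.twist_apply, map_sub HahnSeries.C, map_sub (tensorProj s j), tensorProj_ram, algebraMap_smul, map_smul, sub_smul]
      abel
  rw [this, hq, map_zero]

/-- Descent of spanning by generalized eigenvectors with constant eigenvalues. -/
theorem typeSpan_const_of_ram (s : ℕ+) {D : Connection (theta C) E}
    (h : (D.ram s).typeSpan (Set.range fun a : C =>
      algebraMap C⸨X⸩ (Ramified C s) (HahnSeries.C a)) = ⊤) :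
    D.typeSpan (Set.range HahnSeries.C) = ⊤ := by
  set W := D.typeSpan (Set.range HahnSeries.C) with hW
  -- The projection is linear over `C((x))` only. Quantifying over the multiplier `k` makes the
  -- induction over a `C((x_s))`-span go through.
  have key : ∀ z : Ramified C s ⊗[C⸨X⸩] E, ∀ k : Ramified C s,
      tensorProj s ⟨0, s.pos⟩ (k • z) ∈ W := by
    intro z
    have hz : z ∈ (D.ram s).typeSpan (Set.range fun a : C =>
      algebraMap C⸨X⸩ (Ramified C s) (HahnSeries.C a)) := h ▸ Submodule.mem_top
    induction hz using Submodule.span_induction with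
    | mem u hu =>
      intro k
      obtain ⟨_, ⟨a, rfl⟩, hu⟩ := hu
      rw [eq_sum_tensorProj s u, Finset.smul_sum, map_sum]
      refine W.sum_mem fun j _ => ?_
      rw [TensorProduct.smul_tmul', tensorProj_tmul]
      exact W.smul_mem _ (Connection.mem_typeSpan (Set.mem_range_self _) (tensorProj_mem_genEigen s hu j))
    | zero => intro k; rw [smul_zero, map_zero]; exact W.zero_mem
    | add a b _ _ ha hb => intro k; rw [smul_add, map_add]; exact W.add_mem (ha k) (hb k)
    | smul c a _ ha => intro k; rw [smul_smul]; exact ha _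
  rw [eq_top_iff]
  rintro e -
  have := key (1 ⊗ₜ e) 1
  rwa [one_smul, tensorProj_zero_one_tmul] at this

-- Multiplication by `x^{-n}` lowers an exponent by the integer `n`, which carries it to its
-- representative in `τ` without changing the subspace spanned.
omit [CharZero C] in
theorem typeSpan_of_const {τ : Set C} (hτ : ∀ c : C, ∃ a ∈ τ, ∃ n : ℤ, c - a = n)
    {D : Connection (theta C) E} (h : D.typeSpan (Set.range HahnSeries.C) = ⊤) :
    D.typeSpan (HahnSeries.C '' τ) = ⊤ := by
  rw [eq_top_iff, ← h]
  refine Submodule.span_le.2 ?_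
  rintro u ⟨_, ⟨c, rfl⟩, hu⟩
  obtain ⟨a, ha, n, hn⟩ := hτ c
  have h1 : theta C (HahnSeries.single (-n) 1) +
      (HahnSeries.C c - HahnSeries.C a) * HahnSeries.single (-n) 1 = 0 := by
    rw [← delta_one_eq, delta_single, ← map_sub, hn, ← add_mul, ← map_add]
    simp
  have h2 := Submodule.smul_mem _ (HahnSeries.single n 1 : C⸨X⸩)
    (Connection.mem_typeSpan (Set.mem_image_of_mem _ ha) (Connection.genEigen_smul h1 hu))
  rwa [smul_smul, HahnSeries.single_mul_single, add_neg_cancel, mul_one,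
    HahnSeries.single_zero_one, one_smul] at h2

end Constants

/-! ### Constant matrices with eigenvalues in `τ`, and strictness for their lattices -/

section EulerBasis

variable {C : Type u} [Field C] {E : Type v} [AddCommGroup E] [Module C⸨X⸩ E]

/-- A basis in which the connection has a constant matrix with eigenvalues in `τ`. -/
structure EulerBasis (τ : Set C) (D : Connection (theta C) E) where
  ι : Type
  fintype : Fintype ι
  decEq : DecidableEq ι
  basis : Module.Basis ι C⸨X⸩ E
  mat : Matrix ι ι C
  apply_basis : ∀ j, D (basis j) = ∑ i, (HahnSeries.C (mat i j) : C⸨X⸩) • basis i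
  eigenvalue_mem : ∀ (c : C) (v : ι → C), v ≠ 0 → mat.mulVec v = c • v → c ∈ τ

attribute [instance] EulerBasis.fintype EulerBasis.decEq

/-- The coefficient of `xⁿ` requires `(N - (a - n)) h_n = k_n`, which is solvable for `n ≠ 0` since
`a - n` is not an eigenvalue of `N`. Only the constant term of `k` is left over. -/
theorem exists_const_add {ι : Type*} [Fintype ι] [DecidableEq ι] {N : Matrix ι ι C} {a : C}
    (hN : ∀ n : ℤ, n ≠ 0 → ∀ v, N.mulVec v = (a - n) • v → v = 0) (k : ι → C⸨X⸩) :
    ∃ (h : ι → C⸨X⸩) (k₀ : ι → C), ∀ i, theta C (h i) +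
      ∑ j, HahnSeries.C (N i j) * h j - HahnSeries.C a * h i = k i - HahnSeries.C (k₀ i) := by
  have hu : ∀ n : ℤ, n ≠ 0 → ∀ w, ∃ v, N.mulVec v - (a - n) • v = w := by
    intro n hn w
    have hinj : Function.Injective ((N - (a - n) • (1 : Matrix ι ι C)).mulVec) := by
      rw [← Matrix.coe_mulVecLin, ← LinearMap.ker_eq_bot, LinearMap.ker_eq_bot']
      intro v hv
      rw [Matrix.mulVecLin_apply, Matrix.sub_mulVec, Matrix.smul_mulVec, Matrix.one_mulVec,
        sub_eq_zero] at hv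
      exact hN n hn v hv
    obtain ⟨v, hv⟩ := Matrix.mulVec_surjective_iff_isUnit.2
      (Matrix.mulVec_injective_iff_isUnit.1 hinj) w
    refine ⟨v, ?_⟩
    rw [← hv, Matrix.sub_mulVec, Matrix.smul_mulVec, Matrix.one_mulVec]
  choose! F hF using hu
  have hbound : ∃ B : ℕ, ∀ i, ∀ n : ℤ, n < -B → (k i).coeff n = 0 := by
    choose b hb using fun i => exists_coeff_bound (k i)
    refine ⟨Finset.univ.sup b, fun i n hn => hb i n (hn.trans_le ?_)⟩
    have := Finset.le_sup (f := b) (Finset.mem_univ i)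
    omega
  obtain ⟨B, hB⟩ := hbound
  let H : ℤ → ι → C := fun n =>
    if n = 0 ∨ n < -B then 0 else F n fun i => (k i).coeff n
  refine ⟨fun i => ⟨fun n => H n i, (BddBelow.isWF ⟨-(B : ℤ), fun n hn => ?_⟩).isPWO⟩,
    fun i => (k i).coeff 0, fun i => ?_⟩
  · by_contra h
    exact hn (by simp only [H]; rw [if_pos (Or.inr (by omega))]; rfl)
  ext n
  rw [HahnSeries.coeff_sub, HahnSeries.coeff_add, theta_coeff, HahnSeries.coeff_sum,
    HahnSeries.coeff_sub, HahnSeries.C_mul_eq_smul, HahnSeries.coeff_smul]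
  simp only [HahnSeries.C_mul_eq_smul, HahnSeries.coeff_smul, smul_eq_mul]
  have hmul : ∀ v : ι → C, (N.mulVec v) i = ∑ j, N i j * v j := fun v => rfl
  rw [← hmul]
  by_cases h0 : n = 0
  · subst h0
    have : H 0 = 0 := if_pos (Or.inl rfl)
    simp [this]
  · rw [HahnSeries.C_apply, HahnSeries.coeff_single_of_ne h0, sub_zero]
    by_cases h1 : n < -B
    · have : H n = 0 := if_pos (Or.inr h1)
      simp [this, hB i n h1]
    · have h2 : H n = F n fun i => (k i).coeff n := if_neg (not_or.2 ⟨h0, h1⟩)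
      have h3 := congrFun (hF n h0 fun i => (k i).coeff n) i
      rw [← h2, Pi.sub_apply, Pi.smul_apply, smul_eq_mul] at h3
      linear_combination h3

/-- The basis grows by one vector at a time. A generalized eigenvector outside the current span `F`
is replaced by an iterate `u ∉ F` with `(∇ - a) u ∈ F`, and `u` is corrected by an element of `F`
until `(∇ - a) u` has constant coordinates. The new matrix is block triangular with additional
eigenvalue `a ∈ τ`. The parameter `d` counts the missing dimensions. -/
theorem exists_eulerBasis [FiniteDimensional C⸨X⸩ E] {τ : Set C}
    (hτ : ∀ a ∈ τ, ∀ n : ℤ, a - n ∈ τ → n = 0) {D : Connection (theta C) E}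
    (h : D.typeSpan (HahnSeries.C '' τ) = ⊤) : Nonempty (EulerBasis τ D) := by
  suffices H : ∀ (d : ℕ) (ι : Type) (_ : Fintype ι) (_ : DecidableEq ι) (v : ι → E)
      (N : Matrix ι ι C), LinearIndependent C⸨X⸩ v →
      (∀ j, D (v j) = ∑ i, (HahnSeries.C (N i j) : C⸨X⸩) • v i) →
      (∀ (c : C) (w : ι → C), w ≠ 0 → N.mulVec w = c • w → c ∈ τ) →
      Fintype.card ι + d = Module.finrank C⸨X⸩ E → Nonempty (EulerBasis τ D) by
    exact H (Module.finrank C⸨X⸩ E) Empty inferInstance inferInstance Empty.elim 0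
      linearIndependent_empty_type (fun j => j.elim)
      (fun c w hw => absurd (Subsingleton.elim _ _) hw) (by simp)
  intro d
  induction d with
  | zero =>
    intro ι _ _ v N hv hD hN hcard
    refine ⟨⟨ι, _, ‹_›, basisOfLinearIndependentOfCardEqFinrank' v hv hcard, N, ?_, hN⟩⟩
    simpa using hD
  | succ d ih =>
    intro ι _ _ v N hv hD hN hcard
    set F := Submodule.span C⸨X⸩ (Set.range v) with hF
    have hFtop : F ≠ ⊤ := by
      intro h0
      have := finrank_span_eq_card hv
      rw [← hF, h0, finrank_top] at this
      omega
    obtain ⟨a, ha, u, hu, huF⟩ : ∃ a ∈ τ, ∃ u ∈ D.genEigen (HahnSeries.C a), u ∉ F := by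
      by_contra! hcon
      refine hFtop (top_le_iff.1 (h ▸ Submodule.span_le.2 ?_))
      rintro u ⟨_, ⟨a, ha, rfl⟩, hu⟩
      exact hcon a ha u hu
    obtain ⟨u, huF, huF'⟩ : ∃ u, u ∉ F ∧ D.twist (HahnSeries.C a) u ∈ F := by
      obtain ⟨q, hq⟩ := hu
      induction q generalizing u with
      | zero => exact absurd (show u = 0 from hq) fun h0 => huF (h0 ▸ F.zero_mem)
      | succ q ihq =>
        by_cases h1 : D.twist (HahnSeries.C a) u ∈ F
        · exact ⟨u, huF, h1⟩
        · exact ihq _ h1 hq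
    obtain ⟨k, hk⟩ := (Submodule.mem_span_range_iff_exists_fun _).1 huF'
    obtain ⟨y, k₀, hy⟩ := exists_const_add (a := a) (N := N) (fun n hn w hw => by
      by_contra hw0
      exact hn (hτ a ha n (hN _ w hw0 hw))) k
    set u' := u - ∑ i, y i • v i with hu'
    have hsum : ∑ i, y i • v i ∈ F :=
      F.sum_mem fun i _ => F.smul_mem _ (Submodule.subset_span ⟨i, rfl⟩)
    have hDu' : D u' = (HahnSeries.C a : C⸨X⸩) • u' +
        ∑ i, (HahnSeries.C (k₀ i) : C⸨X⸩) • v i := by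
      have e1 : D (∑ i, y i • v i) = ∑ i, (theta C (y i) +
          ∑ j, HahnSeries.C (N i j) * y j) • v i := by
        rw [map_sum]
        simp only [D.leibniz, hD, add_smul, Finset.sum_add_distrib, Finset.sum_smul,
          Finset.smul_sum, smul_smul]
        congr 1
        rw [Finset.sum_comm]
        exact Finset.sum_congr rfl fun i _ => Finset.sum_congr rfl fun j _ => by rw [mul_comm]
      have e2 : D u = (HahnSeries.C a : C⸨X⸩) • u + ∑ i, k i • v i := by
        rw [hk, Connection.twist_apply, add_sub_cancel]
      have e3 : ∑ i, (HahnSeries.C (k₀ i) : C⸨X⸩) • v i = ∑ i, k i • v i -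
          ∑ i, (theta C (y i) + ∑ j, HahnSeries.C (N i j) * y j) • v i +
          (HahnSeries.C a : C⸨X⸩) • ∑ i, y i • v i := by
        rw [Finset.smul_sum, ← Finset.sum_sub_distrib, ← Finset.sum_add_distrib]
        refine Finset.sum_congr rfl fun i _ => ?_
        rw [smul_smul, ← sub_smul, ← add_smul]
        congr 1
        linear_combination hy i
      rw [hu', map_sub, e1, e2, e3, smul_sub]
      abel
    refine ih (Option ι) inferInstance inferInstance (fun o => o.elim u' v)
      (fun o o' => o'.elim (o.elim a k₀) fun j => o.elim 0 fun i => N i j) ?_ ?_ ?_ ?_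
    · rw [linearIndependent_option]
      refine ⟨hv, fun h0 => huF ?_⟩
      have : u = u' + ∑ i, y i • v i := by rw [hu', sub_add_cancel]
      rw [this]
      exact F.add_mem h0 hsum
    · rintro (_ | j)
      · simpa [Fintype.sum_option] using hDu'
      · simpa [Fintype.sum_option] using hD j
    · intro c w hw hc
      have h1 : a * w none = c * w none := by
        have := congrFun hc none
        simpa [Matrix.mulVec, dotProduct, Fintype.sum_option] using this
      by_cases h2 : w none = 0
      · refine hN c (fun i => w (some i)) (fun h3 => hw ?_) ?_
        · funext o
          cases o with
          | none => exact h2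
          | some i => exact congrFun h3 i
        · funext i
          have := congrFun hc (some i)
          simpa [Matrix.mulVec, dotProduct, Fintype.sum_option, h2] using this
      · exact mul_right_cancel₀ h2 h1 ▸ ha
    · rw [Fintype.card_option]; omega

namespace EulerBasis

variable {τ : Set C} {D : Connection (theta C) E} (B : EulerBasis τ D)

/-- The coefficients of `xⁿ`. -/
def coeffVec (n : ℤ) : E →+ (B.ι → C) where
  toFun e i := (B.basis.repr e i).coeff n
  map_zero' := by ext; simp
  map_add' a b := by ext; simp

theorem coeffVec_apply (n : ℤ) (e : E) (i : B.ι) :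
    B.coeffVec n e i = (B.basis.repr e i).coeff n := rfl

theorem coeffVec_sum (n : ℤ) (k : B.ι → C⸨X⸩) (i : B.ι) :
    B.coeffVec n (∑ i, k i • B.basis i) i = (k i).coeff n := by
  rw [coeffVec_apply, B.basis.repr_sum_self]

theorem ext_coeffVec {e e' : E} (h : ∀ n, B.coeffVec n e = B.coeffVec n e') : e = e' :=
  B.basis.repr.injective (Finsupp.ext fun i => HahnSeries.ext (funext fun n => congrFun (h n) i))

theorem repr_apply (e : E) (i : B.ι) : B.basis.repr (D e) i =
    theta C (B.basis.repr e i) + ∑ j, HahnSeries.C (B.mat i j) * B.basis.repr e j := by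
  have h : D e = ∑ i, (theta C (B.basis.repr e i) +
      ∑ j, HahnSeries.C (B.mat i j) * B.basis.repr e j) • B.basis i := by
    conv_lhs => rw [← B.basis.sum_repr e]
    rw [map_sum]
    simp only [D.leibniz, B.apply_basis, add_smul, Finset.sum_add_distrib, Finset.sum_smul,
      Finset.smul_sum, smul_smul]
    congr 1
    rw [Finset.sum_comm]
    exact Finset.sum_congr rfl fun i _ => Finset.sum_congr rfl fun j _ => by rw [mul_comm]
  rw [h, B.basis.repr_sum_self]

theorem coeffVec_conn (n : ℤ) (e : E) :
    B.coeffVec n (D e) = (n : C) • B.coeffVec n e + B.mat.mulVec (B.coeffVec n e) := by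
  funext i
  rw [coeffVec_apply, repr_apply, HahnSeries.coeff_add, theta_coeff, HahnSeries.coeff_sum]
  simp only [HahnSeries.C_mul_eq_smul, HahnSeries.coeff_smul, smul_eq_mul]
  rfl

theorem coeffVec_single_smul (m n : ℤ) (e : E) :
    B.coeffVec n ((HahnSeries.single m 1 : C⸨X⸩) • e) = B.coeffVec (n - m) e := by
  funext i
  rw [coeffVec_apply, map_smul, Finsupp.smul_apply, smul_eq_mul, HahnSeries.coeff_single_mul,
    one_mul, coeffVec_apply]

theorem coeffVec_C_smul (n : ℤ) (c : C) (e : E) :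
    B.coeffVec n ((HahnSeries.C c : C⸨X⸩) • e) = c • B.coeffVec n e := by
  funext i
  rw [coeffVec_apply, map_smul, Finsupp.smul_apply, smul_eq_mul, HahnSeries.C_mul_eq_smul,
    HahnSeries.coeff_smul]
  rfl

theorem exists_coeffVec_bound (e : E) : ∃ N : ℕ, ∀ n : ℤ, n < -N → B.coeffVec n e = 0 := by
  choose b hb using fun i => exists_coeff_bound (B.basis.repr e i)
  refine ⟨Finset.univ.sup b, fun n hn => funext fun i => hb i n (hn.trans_le ?_)⟩
  have := Finset.le_sup (f := b) (Finset.mem_univ i)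
  omega

theorem exists_truncate (e : E) :
    ∃ e₁, ∀ n, B.coeffVec n e₁ = if n < 0 then 0 else B.coeffVec n e := by
  refine ⟨∑ i, (B.basis.repr e i - principalPart (B.basis.repr e i)) • B.basis i, fun n => ?_⟩
  funext i
  rw [coeffVec_sum, HahnSeries.coeff_sub, principalPart_coeff]
  split_ifs <;> simp [coeffVec_apply]

/-- The `C[[x]]`-lattice generated by the basis. -/
def lattice : LogModel D where
  carrier :=
    { carrier := {e | ∀ n < 0, B.coeffVec n e = 0}
      add_mem' := fun {a b} ha hb n hn => by rw [map_add, ha n hn, hb n hn, add_zero]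
      zero_mem' := fun n _ => map_zero _
      neg_mem' := fun {a} ha n hn => by rw [map_neg, ha n hn, neg_zero] }
  smul_mem f e he n hn := by
    funext i
    obtain ⟨g, hg⟩ := exists_eq_ofPowerSeries (B.basis.repr e i) fun n hn => congrFun (he n hn) i
    rw [coeffVec_apply, map_smul, Finsupp.smul_apply, smul_eq_mul, hg, ← map_mul,
      ofPowerSeries_coeff_of_neg _ hn]
    rfl
  fg := by
    refine ⟨Fintype.card B.ι, fun i => B.basis ((Fintype.equivFin B.ι).symm i), fun i n hn => ?_,
      fun e he => ?_⟩
    · funext j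
      rw [coeffVec_apply, B.basis.repr_self]
      by_cases h : (Fintype.equivFin B.ι).symm i = j
      · rw [h, Finsupp.single_eq_same, HahnSeries.coeff_one, if_neg hn.ne]; rfl
      · rw [Finsupp.single_eq_of_ne (Ne.symm h)]; rfl
    · choose g hg using fun i => exists_eq_ofPowerSeries (B.basis.repr e i)
        fun n hn => congrFun (he n hn) i
      refine ⟨fun i => g ((Fintype.equivFin B.ι).symm i), ?_⟩
      rw [Equiv.sum_comp (Fintype.equivFin B.ι).symm
        (fun i => HahnSeries.ofPowerSeries ℤ C (g i) • B.basis i)]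
      conv_lhs => rw [← B.basis.sum_repr e]
      exact Finset.sum_congr rfl fun i _ => by rw [hg]
  stable e he n hn := by
    rw [coeffVec_conn, he n hn, smul_zero, Matrix.mulVec_zero, add_zero]
  spans e := by
    obtain ⟨N, hN⟩ := B.exists_coeffVec_bound e
    refine ⟨N, fun n hn => ?_⟩
    rw [xElt, HahnSeries.single_pow, one_pow, coeffVec_single_smul]
    exact hN _ (by simp; omega)

/-- Constant coefficient vectors identify the lattice modulo `x` with `C^ι`, and there the residue
is the matrix `mat`. -/
theorem isDeligneManin_lattice : B.lattice.IsDeligneManin τ := by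
  rintro c ⟨e, he, hex, e', he', hee'⟩
  refine B.eigenvalue_mem c (B.coeffVec 0 e) (fun h0 => hex ?_) ?_
  · refine ⟨(HahnSeries.single (-1) 1 : C⸨X⸩) • e, fun n hn => ?_, ?_⟩
    · rw [coeffVec_single_smul]
      rcases eq_or_ne n (-1) with rfl | h
      · simpa using h0
      · exact he _ (by omega)
    · rw [xElt, smul_smul, HahnSeries.single_mul_single]
      simp
  · have := congrArg (B.coeffVec 0) hee'
    rw [map_sub, coeffVec_conn, coeffVec_C_smul, xElt, coeffVec_single_smul, he' _ (by norm_num),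
      Int.cast_zero, zero_smul, zero_add, sub_eq_zero] at this
    exact this

end EulerBasis

theorem exists_mulVec_eq_smul {ι : Type*} [Fintype ι] [DecidableEq ι] {A : Matrix ι ι C} {c : C}
    (hc : A.charpoly.IsRoot c) : ∃ v, v ≠ 0 ∧ A.mulVec v = c • v := by
  rw [Polynomial.IsRoot.def, Matrix.eval_charpoly] at hc
  obtain ⟨v, hv, hv'⟩ := Matrix.exists_mulVec_eq_zero_iff.2 hc
  refine ⟨v, hv, ?_⟩
  rw [Matrix.sub_mulVec, sub_eq_zero, Matrix.scalar_apply, ← Matrix.smul_one_eq_diagonal,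
    Matrix.smul_mulVec, Matrix.one_mulVec] at hv'
  exact hv'.symm

/-- The relation gives `p(N') W = W p(N)` for every polynomial `p`. For the characteristic
polynomial of `N'` the left side vanishes by Cayley–Hamilton, while `p(N)` is invertible because the
spectra are disjoint. -/
theorem sylvester_eq_zero [IsAlgClosed C] {ι ι' : Type*} [Fintype ι] [DecidableEq ι] [Fintype ι']
    [DecidableEq ι'] {N : Matrix ι ι C} {N' : Matrix ι' ι' C} {W : Matrix ι' ι C}
    (h : N' * W = W * N)
    (hN : ∀ (c : C) (v : ι → C) (v' : ι' → C), v ≠ 0 → v' ≠ 0 → N.mulVec v = c • v → N'.mulVec v' ≠ c • v') : W = 0 := by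
  rcases isEmpty_or_nonempty ι' with hι | hι
  · ext i; exact isEmptyElim i
  have hp : ∀ p : Polynomial C, Polynomial.aeval N' p * W = W * Polynomial.aeval N p := by
    intro p
    induction p using Polynomial.induction_on' with
    | add p q hp hq => rw [map_add, map_add, Matrix.add_mul, Matrix.mul_add, hp, hq]
    | monomial n a =>
      have : ∀ n, N' ^ n * W = W * N ^ n := by
        intro n
        induction n with
        | zero => simp
        | succ n ih => rw [pow_succ, Matrix.mul_assoc, h, ← Matrix.mul_assoc, ih, Matrix.mul_assoc,
            pow_succ]
      rw [Polynomial.aeval_monomial, Polynomial.aeval_monomial, Matrix.algebraMap_eq_diagonal,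
        Matrix.algebraMap_eq_diagonal]
      simp only [Pi.algebraMap_def, Algebra.algebraMap_self, RingHom.id_apply,
        ← Matrix.smul_one_eq_diagonal, Matrix.smul_mul, Matrix.one_mul, Matrix.mul_smul, this]
  have hunit : IsUnit (Polynomial.aeval N N'.charpoly) := by
    by_contra hcon
    have h0 : (0 : C) ∈ spectrum C (Polynomial.aeval N N'.charpoly) := spectrum.zero_mem C hcon
    rw [spectrum.map_polynomial_aeval_of_degree_pos N N'.charpoly (by
      rw [Matrix.charpoly_degree_eq_dim]
      exact_mod_cast Fintype.card_pos)] at h0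
    obtain ⟨c, hc, hc'⟩ := h0
    obtain ⟨v, hv, hvc⟩ := exists_mulVec_eq_smul (Matrix.mem_spectrum_iff_isRoot_charpoly.1 hc)
    obtain ⟨v', hv', hvc'⟩ := exists_mulVec_eq_smul (A := N') (c := c) hc'
    exact hN c v v' hv hv' hvc hvc'
  have h1 := hp N'.charpoly
  rw [Matrix.aeval_self_charpoly, Matrix.zero_mul] at h1
  obtain ⟨y, hy⟩ := hunit.exists_right_inv
  have : W * (Polynomial.aeval N N'.charpoly * y) = 0 := by
    rw [← Matrix.mul_assoc, ← h1, Matrix.zero_mul]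
  rwa [hy, Matrix.mul_one] at this

namespace EulerBasis

variable {τ : Set C} {D : Connection (theta C) E} (B : EulerBasis τ D) [IsAlgClosed C]
  {E' : Type w} [AddCommGroup E'] [Module C⸨X⸩ E'] {D' : Connection (theta C) E'}
  (B' : EulerBasis τ D')

/-- Horizontal maps act on coefficients through a constant matrix. -/
theorem exists_matrix (hτ : ∀ a ∈ τ, ∀ n : ℤ, a - n ∈ τ → n = 0) (φ : E →ₗ[C⸨X⸩] E')
    (hφ : ∀ e, φ (D e) = D' (φ e)) :
    ∃ W : Matrix B'.ι B.ι C, ∀ n e, B'.coeffVec n (φ e) = W.mulVec (B.coeffVec n e) := by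
  -- Horizontality says `N' W_n = W_n (N - n)`. A common eigenvalue `c` would put both `c` and `c +
  -- n` in `τ`, so `W_n = 0` for `n ≠ 0`.
  let W : ℤ → Matrix B'.ι B.ι C := fun n => Matrix.of fun i j => B'.coeffVec n (φ (B.basis j)) i
  have hW : ∀ n, n ≠ 0 → W n = 0 := by
    intro n hn
    refine sylvester_eq_zero (N := B.mat - (n : C) • (1 : Matrix B.ι B.ι C)) (N' := B'.mat) ?_ ?_
    · have h1 : ∀ j, (n : C) • B'.coeffVec n (φ (B.basis j)) +
          B'.mat.mulVec (B'.coeffVec n (φ (B.basis j))) =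
          ∑ i, B.mat i j • B'.coeffVec n (φ (B.basis i)) := by
        intro j
        rw [← B'.coeffVec_conn, ← hφ, B.apply_basis, map_sum, map_sum]
        exact Finset.sum_congr rfl fun i _ => by rw [map_smul, coeffVec_C_smul]
      rw [Matrix.mul_sub, Matrix.mul_smul, Matrix.mul_one]
      ext i j
      have h2 := congrFun (h1 j) i
      simp only [Pi.add_apply, Pi.smul_apply, smul_eq_mul, Finset.sum_apply] at h2
      have h5 : W n i j = B'.coeffVec n (φ (B.basis j)) i := rfl
      have h3 : (B'.mat * W n) i j = (B'.mat.mulVec (B'.coeffVec n (φ (B.basis j)))) i := rfl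
      have h4 : (W n * B.mat) i j = ∑ k, B.mat k j * B'.coeffVec n (φ (B.basis k)) i :=
        Finset.sum_congr rfl fun k _ => mul_comm _ _
      rw [h3, Matrix.sub_apply, h4, Matrix.smul_apply, smul_eq_mul, h5]
      linear_combination h2
    · intro c v v' hv hv' h1 h2
      refine hn ?_
      rw [Matrix.sub_mulVec, Matrix.smul_mulVec, Matrix.one_mulVec, sub_eq_iff_eq_add,
        ← add_smul] at h1
      refine hτ (c + n) (B.eigenvalue_mem _ v hv h1) n ?_
      rw [add_sub_cancel_right]
      exact B'.eigenvalue_mem c v' hv' h2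
  have hcol : ∀ j, φ (B.basis j) = ∑ i, (HahnSeries.C (W 0 i j) : C⸨X⸩) • B'.basis i := by
    intro j
    refine B'.ext_coeffVec fun n => funext fun i => ?_
    rw [coeffVec_sum]
    by_cases hn : n = 0
    · subst hn
      rw [HahnSeries.C_apply, HahnSeries.coeff_single_same]
      rfl
    · rw [HahnSeries.C_apply, HahnSeries.coeff_single_of_ne hn]
      exact congrFun (congrFun (hW n hn) i) j
  refine ⟨W 0, fun n e => funext fun i => ?_⟩
  have h1 : φ e = ∑ i, (∑ j, HahnSeries.C (W 0 i j) * B.basis.repr e j) • B'.basis i := by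
    conv_lhs => rw [← B.basis.sum_repr e]
    rw [map_sum]
    simp only [map_smul, hcol, Finset.sum_smul, Finset.smul_sum, smul_smul]
    rw [Finset.sum_comm]
    exact Finset.sum_congr rfl fun i _ => Finset.sum_congr rfl fun j _ => by rw [mul_comm]
  rw [h1, coeffVec_sum, HahnSeries.coeff_sum]
  simp only [HahnSeries.C_mul_eq_smul, HahnSeries.coeff_smul, smul_eq_mul]
  rfl

theorem map_mem_lattice (hτ : ∀ a ∈ τ, ∀ n : ℤ, a - n ∈ τ → n = 0) (φ : E →ₗ[C⸨X⸩] E')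
    (hφ : ∀ e, φ (D e) = D' (φ e)) {e : E} (he : e ∈ B.lattice.carrier) :
    φ e ∈ B'.lattice.carrier := by
  obtain ⟨W, hW⟩ := B.exists_matrix B' hτ φ hφ
  intro n hn
  rw [hW, he n hn, Matrix.mulVec_zero]

/-- A constant matrix commutes with dropping negative powers of `x`, so the truncation of `e` has
the same image. This strictness controls both surjectivity and kernels in the limit. -/
theorem exists_mem_lattice_of_map (hτ : ∀ a ∈ τ, ∀ n : ℤ, a - n ∈ τ → n = 0)
    (φ : E →ₗ[C⸨X⸩] E') (hφ : ∀ e, φ (D e) = D' (φ e)) {e : E}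
    (he : φ e ∈ B'.lattice.carrier) : ∃ e₁ ∈ B.lattice.carrier, φ e₁ = φ e := by
  obtain ⟨W, hW⟩ := B.exists_matrix B' hτ φ hφ
  obtain ⟨e₁, he₁⟩ := B.exists_truncate e
  refine ⟨e₁, fun n hn => by rw [he₁, if_pos hn], B'.ext_coeffVec fun n => ?_⟩
  rw [hW, he₁]
  split_ifs with hn
  · rw [he n hn, Matrix.mulVec_zero]
  · rw [hW]

end EulerBasis

end EulerBasis

/-! ### Regular singular parts: Euler bases and uniqueness -/

section Existence

variable {C : Type u} [Field C] [CharZero C] {E : Type v} [AddCommGroup E]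
  [Module C⸨X⸩ E] [FiniteDimensional C⸨X⸩ E]

theorem IsIrregularPart.exists_eulerBasis {τ : Set C}
    (hτ : ∀ c : C, ∃ a ∈ τ, ∃ n : ℤ, c - a = n) (hτ' : ∀ a ∈ τ, ∀ n : ℤ, a - n ∈ τ → n = 0)
    {s : ℕ+} {D : Connection (theta C) E} {S : E →ₗ[C⸨X⸩] E} (hS : IsIrregularPart s D S) :
    Nonempty (EulerBasis τ (D.subLinear S)) :=
  RegSing.exists_eulerBasis hτ'
    (typeSpan_of_const hτ (typeSpan_const_of_ram s hS.typeSpan_subLinear))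

-- Two irregular parts of the same connection agree, because the identity is horizontal and hence
-- intertwines them.
omit [FiniteDimensional C⸨X⸩ E] in
theorem IsRegularSingularPart.eq_subLinear {s : ℕ+} {D D' : Connection (theta C) E}
    {S : E →ₗ[C⸨X⸩] E} (hS : IsIrregularPart s D S) (h : IsRegularSingularPart D D') :
    D' = D.subLinear S := by
  obtain ⟨s', hs'⟩ := h.exists_isIrregularPart
  refine DFunLike.ext _ _ fun e => ?_
  have := hs'.comm hS LinearMap.id (fun _ => rfl) e
  rw [LinearMap.id_apply, LinearMap.id_apply, Connection.diff_apply] at this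
  rw [Connection.subLinear_apply, ← this, sub_sub_cancel]

end Existence

/-- Above level `ℓ` preimages are chosen recursively, below it the element is projected down;
shifting the system reduces to `ℓ = 0`. -/
theorem exists_compatible {X : ℕ → Type*} (p : ∀ ℓ, X (ℓ + 1) → X ℓ)
    (hp : ∀ ℓ, Function.Surjective (p ℓ)) (ℓ : ℕ) (m : X ℓ) :
    ∃ e : ∀ ℓ, X ℓ, (∀ k, p k (e (k + 1)) = e k) ∧ e ℓ = m := by
  induction ℓ generalizing X with
  | zero =>
    choose g hg using hp
    exact ⟨fun n => Nat.rec m (fun k e => g k e) n, fun k => hg k _, rfl⟩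
  | succ ℓ ih =>
    obtain ⟨e, he, hm⟩ := ih (X := fun k => X (k + 1)) (fun k => p (k + 1)) (fun k => hp (k + 1)) m
    refine ⟨fun | 0 => p 0 (e 0) | k + 1 => e k, ?_, hm⟩
    rintro (_ | k)
    · rfl
    · exact he k

/-! ### Successive approximation in `t`-adic inverse systems -/

section LimitSystem

variable {A : Type u} [CommRing A] {X : ℕ → Type v} [∀ ℓ, AddCommGroup (X ℓ)]
  [∀ ℓ, Module A (X ℓ)]

/-- The inverse limit of subgroups `M ℓ`. -/
def limitGroup (p : ∀ ℓ, X (ℓ + 1) →ₗ[A] X ℓ) (M : ∀ ℓ, AddSubgroup (X ℓ)) :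
    AddSubgroup (∀ ℓ, X ℓ) where
  carrier := {e | (∀ ℓ, e ℓ ∈ M ℓ) ∧ ∀ ℓ, p ℓ (e (ℓ + 1)) = e ℓ}
  add_mem' := fun {a b} ha hb => ⟨fun ℓ => (M ℓ).add_mem (ha.1 ℓ) (hb.1 ℓ), fun ℓ => by
    rw [Pi.add_apply, map_add, ha.2, hb.2]; rfl⟩
  zero_mem' := ⟨fun ℓ => (M ℓ).zero_mem, fun ℓ => map_zero _⟩
  neg_mem' := fun {a} ha => ⟨fun ℓ => (M ℓ).neg_mem (ha.1 ℓ), fun ℓ => by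
    rw [Pi.neg_apply, map_neg, ha.2]; rfl⟩

/-- The conditions under which the limit of the `M ℓ` reduces to `M ℓ` modulo `t ^ (ℓ + 1)`. -/
structure IsAdicSystem (p : ∀ ℓ, X (ℓ + 1) →ₗ[A] X ℓ) (t : A) (M : ∀ ℓ, AddSubgroup (X ℓ)) :
    Prop where
  smul_mem : ∀ ℓ, ∀ e ∈ M ℓ, t • e ∈ M ℓ
  map_mem : ∀ ℓ, ∀ e ∈ M (ℓ + 1), p ℓ e ∈ M ℓ
  surj : ∀ ℓ, ∀ m ∈ M ℓ, ∃ e ∈ M (ℓ + 1), p ℓ e = m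
  ker : ∀ ℓ, ∀ e ∈ M (ℓ + 1), p ℓ e = 0 → ∃ m ∈ M (ℓ + 1), e = t ^ (ℓ + 1) • m
  torsion : ∀ ℓ, ∀ e : X ℓ, t ^ (ℓ + 1) • e = 0

namespace IsAdicSystem

variable {p : ∀ ℓ, X (ℓ + 1) →ₗ[A] X ℓ} {t : A} {M : ∀ ℓ, AddSubgroup (X ℓ)}

theorem apply_eq_zero {e : ∀ ℓ, X ℓ} (he : e ∈ limitGroup p M) {j n : ℕ} (hjn : j ≤ n)
    (hn : e n = 0) : e j = 0 := by
  induction n, hjn using Nat.le_induction with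
  | base => exact hn
  | succ n _ ih => exact ih (by rw [← he.2, hn, map_zero])

variable (h : IsAdicSystem p t M)
include h

theorem pow_smul_mem (n ℓ : ℕ) {e : X ℓ} (he : e ∈ M ℓ) : t ^ n • e ∈ M ℓ := by
  induction n with
  | zero => rwa [pow_zero, one_smul]
  | succ n ih => rw [pow_succ', mul_smul]; exact h.smul_mem ℓ _ ih

theorem pow_smul_mem_limit (n : ℕ) {e : ∀ ℓ, X ℓ} (he : e ∈ limitGroup p M) :
    t ^ n • e ∈ limitGroup p M :=
  ⟨fun ℓ => h.pow_smul_mem n ℓ (he.1 ℓ), fun ℓ => by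
    rw [Pi.smul_apply, map_smul, he.2]; rfl⟩

theorem torsion_of_le {n ℓ : ℕ} (hn : ℓ < n) (e : X ℓ) : t ^ n • e = 0 := by
  obtain ⟨k, rfl⟩ := Nat.exists_eq_add_of_le' (Nat.succ_le_of_lt hn)
  rw [pow_add, mul_smul, Nat.succ_eq_add_one, h.torsion, smul_zero]

theorem exists_lift {ℓ : ℕ} {m : X ℓ} (hm : m ∈ M ℓ) : ∃ e ∈ limitGroup p M, e ℓ = m := by
  obtain ⟨e, he, hem⟩ := exists_compatible (X := fun ℓ => M ℓ)
    (fun ℓ e => ⟨p ℓ e, h.map_mem ℓ _ e.2⟩)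
    (fun ℓ m => by
      obtain ⟨e, he, hp⟩ := h.surj ℓ m m.2
      exact ⟨⟨e, he⟩, Subtype.ext hp⟩) ℓ ⟨m, hm⟩
  exact ⟨fun ℓ => e ℓ, ⟨fun ℓ => (e ℓ).2, fun ℓ => congrArg Subtype.val (he ℓ)⟩,
    congrArg Subtype.val hem⟩

theorem exists_sub_apply_eq_zero {e : ∀ ℓ, X ℓ} (he : e ∈ limitGroup p M) {j : ℕ} (hj : e j = 0) :
    ∃ y ∈ limitGroup p M, (e - t ^ (j + 1) • y) (j + 1) = 0 := by
  obtain ⟨m, hm, hem⟩ := h.ker j _ (he.1 (j + 1)) (by rw [he.2, hj])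
  obtain ⟨y, hy, hym⟩ := h.exists_lift hm
  exact ⟨y, hy, by rw [Pi.sub_apply, Pi.smul_apply, hym, hem, sub_self]⟩

/-- Convergence of `t`-adic series. -/
theorem exists_sum {y : ℕ → ∀ ℓ, X ℓ} (hy : ∀ k, y k ∈ limitGroup p M) :
    ∃ e ∈ limitGroup p M, ∀ n ℓ, ℓ < n → e ℓ = ∑ k ∈ Finset.range n, t ^ k • y k ℓ := by
  have key : ∀ n ℓ, ℓ < n → ∑ k ∈ Finset.range (ℓ + 1), t ^ k • y k ℓ =
      ∑ k ∈ Finset.range n, t ^ k • y k ℓ := by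
    intro n ℓ hn
    refine Finset.sum_subset (fun k hk => ?_) fun k _ hk => ?_
    · rw [Finset.mem_range] at hk ⊢; omega
    · rw [Finset.mem_range, not_lt] at hk
      exact h.torsion_of_le hk _
  refine ⟨fun ℓ => ∑ k ∈ Finset.range (ℓ + 1), t ^ k • y k ℓ, ⟨fun ℓ => ?_, fun ℓ => ?_⟩, key⟩
  · exact AddSubgroup.sum_mem _ fun k _ => h.pow_smul_mem k ℓ ((hy k).1 ℓ)
  · simp only
    rw [map_sum, key (ℓ + 1 + 1) ℓ (by omega)]
    exact Finset.sum_congr rfl fun k _ => by rw [map_smul, (hy k).2]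

/-- The kernel condition allows a multiple of `t^{ℓ+1}` to be subtracted so that the remainder
vanishes one level further up. Iterating with growing powers of `t` gives a convergent series whose
sum is the quotient `y`. -/
theorem exists_eq_pow_smul {e : ∀ ℓ, X ℓ} (he : e ∈ limitGroup p M) {ℓ : ℕ} (hℓ : e ℓ = 0) :
    ∃ y ∈ limitGroup p M, e = t ^ (ℓ + 1) • y := by
  choose! F hF hF' using fun (e : ∀ ℓ, X ℓ) (he : e ∈ limitGroup p M) j (hj : e j = 0) =>
    h.exists_sub_apply_eq_zero he hj
  let z : ∀ n, {z : ∀ ℓ, X ℓ // z ∈ limitGroup p M ∧ z (ℓ + n) = 0} := fun n =>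
    Nat.rec ⟨e, he, hℓ⟩ (fun n z => ⟨z.1 - t ^ (ℓ + n + 1) • F z.1 (ℓ + n),
      AddSubgroup.sub_mem _ z.2.1 (h.pow_smul_mem_limit _ (hF _ z.2.1 _ z.2.2)),
      hF' _ z.2.1 _ z.2.2⟩) n
  have hz : ∀ n, e = (z n).1 + ∑ k ∈ Finset.range n, t ^ (ℓ + k + 1) • F (z k).1 (ℓ + k) := by
    intro n
    induction n with
    | zero => rw [Finset.sum_range_zero, add_zero]; rfl
    | succ n ih =>
      have : (z (n + 1)).1 = (z n).1 - t ^ (ℓ + n + 1) • F (z n).1 (ℓ + n) := rfl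
      rw [Finset.sum_range_succ, this]
      nth_rewrite 1 [ih]
      abel
  obtain ⟨y, hy, hy'⟩ := h.exists_sum (y := fun k => F (z k).1 (ℓ + k))
    fun k => hF _ (z k).2.1 _ (z k).2.2
  refine ⟨y, hy, funext fun j => ?_⟩
  rw [hz (j + 1), Pi.add_apply, apply_eq_zero (z (j + 1)).2.1 (by omega) (z (j + 1)).2.2, zero_add,
    Pi.smul_apply, hy' (j + 1) j (by omega), Finset.smul_sum, Finset.sum_apply]
  refine Finset.sum_congr rfl fun k _ => ?_
  rw [Pi.smul_apply, smul_smul, ← pow_add]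
  congr 2
  omega

/-- Lifts of generators modulo `t` generate the limit. -/
theorem exists_eq_sum {ι : Type*} [Fintype ι] {G : ι → ∀ ℓ, X ℓ} (hG : ∀ i, G i ∈ limitGroup p M)
    -- `P` will be `C[[x]]`, the coefficients available modulo `t`, and `Q` will be `R[[x]]`; `hQ`
    -- provides `t`-adic sums of elements of `P` in `Q`.
    {P Q : Set A} (hP : ∀ a ∈ P, ∀ e ∈ limitGroup p M, a • e ∈ limitGroup p M)
    (hgen : ∀ m ∈ M 0, ∃ a : ι → A, (∀ i, a i ∈ P) ∧ m = ∑ i, a i • G i 0)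
    (hQ : ∀ a : ℕ → A, (∀ k, a k ∈ P) → ∃ b ∈ Q, ∀ n, ∃ c,
      b - ∑ k ∈ Finset.range n, t ^ k * a k = t ^ n * c)
    {e : ∀ ℓ, X ℓ} (he : e ∈ limitGroup p M) :
    ∃ b : ι → A, (∀ i, b i ∈ Q) ∧ e = ∑ i, b i • G i := by
  have hstep : ∀ e ∈ limitGroup p M, ∃ (a : ι → A) (y : ∀ ℓ, X ℓ), (∀ i, a i ∈ P) ∧
      y ∈ limitGroup p M ∧ e = ∑ i, a i • G i + t • y := by
    intro e he
    obtain ⟨a, ha, hea⟩ := hgen _ (he.1 0)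
    obtain ⟨y, hy, hey⟩ := h.exists_eq_pow_smul (e := e - ∑ i, a i • G i)
      (AddSubgroup.sub_mem _ he (AddSubgroup.sum_mem _ fun i _ => hP _ (ha i) _ (hG i))) (ℓ := 0)
      (by rw [Pi.sub_apply, Finset.sum_apply, hea, sub_eq_zero]; rfl)
    refine ⟨a, y, ha, hy, ?_⟩
    rw [zero_add, pow_one] at hey
    rw [← hey, add_sub_cancel]
  choose! a y ha hy hay using hstep
  have hz : ∀ n, y^[n] e ∈ limitGroup p M := by
    intro n
    induction n with
    | zero => exact he
    | succ n ih => rw [Function.iterate_succ_apply']; exact hy _ ih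
  choose b hb hb' using fun i => hQ (fun k => a (y^[k] e) i) fun k => ha _ (hz k) i
  refine ⟨b, hb, funext fun ℓ => ?_⟩
  have hsum : ∀ n, e = ∑ i, (∑ k ∈ Finset.range n, t ^ k * a (y^[k] e) i) • G i +
      t ^ n • y^[n] e := by
    intro n
    induction n with
    | zero => simp
    | succ n ih =>
      nth_rewrite 1 [ih]
      simp only [Finset.sum_range_succ, add_smul, Finset.sum_add_distrib]
      rw [add_assoc]
      congr 1
      nth_rewrite 1 [hay _ (hz n)]
      rw [smul_add, Finset.smul_sum, smul_smul, ← pow_succ, Function.iterate_succ_apply']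
      simp only [smul_smul]
  conv_lhs => rw [hsum (ℓ + 1)]
  rw [Pi.add_apply, Pi.smul_apply, h.torsion, add_zero, Finset.sum_apply, Finset.sum_apply]
  refine Finset.sum_congr rfl fun i _ => ?_
  obtain ⟨c, hc⟩ := hb' i (ℓ + 1)
  rw [Pi.smul_apply, Pi.smul_apply, sub_eq_iff_eq_add.1 hc, add_smul, mul_comm, mul_smul,
    h.torsion, smul_zero, zero_add]

end IsAdicSystem

end LimitSystem

/-! ### Expansion of elements of `R((x))` in powers of `t` -/

section Coefficients

variable {C : Type u} [Field C]

/-- The reduction `R((x)) → C((x))` modulo `t`, as a map. -/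
def redC (f : (C⟦X⟧)⸨X⸩) : C⸨X⸩ where
  coeff n := PowerSeries.coeff 0 (f.coeff n)
  isPWO_support' := f.isPWO_support.mono fun n hn h => hn (by simp [h])

/-- The quotient of `f - f(0)` by `t`. -/
def divT (f : (C⟦X⟧)⸨X⸩) : (C⟦X⟧)⸨X⸩ where
  coeff n := PowerSeries.mk fun k => PowerSeries.coeff (k + 1) (f.coeff n)
  isPWO_support' := f.isPWO_support.mono fun n hn h => hn (by ext; simp [h])

theorem redC_coeff (f : (C⟦X⟧)⸨X⸩) (n : ℤ) :
    (redC f).coeff n = PowerSeries.coeff 0 (f.coeff n) := rfl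

theorem divT_coeff (f : (C⟦X⟧)⸨X⸩) (n : ℤ) :
    (divT f).coeff n = PowerSeries.mk fun k => PowerSeries.coeff (k + 1) (f.coeff n) := rfl

theorem tElt_mul_coeff (f : (C⟦X⟧)⸨X⸩) (n : ℤ) :
    (tElt C * f).coeff n = PowerSeries.X * f.coeff n := by
  rw [tElt, HahnSeries.C_mul_eq_smul, HahnSeries.coeff_smul, smul_eq_mul]

theorem eq_inclC_add (f : (C⟦X⟧)⸨X⸩) : f = inclC C (redC f) + tElt C * divT f := by
  ext n k
  rw [HahnSeries.coeff_add, inclC_coeff, tElt_mul_coeff, redC_coeff, divT_coeff, map_add]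
  cases k with
  | zero => simp
  | succ k => simp [PowerSeries.coeff_succ_X_mul]

theorem theta_eq_inclC_add (f : (C⟦X⟧)⸨X⸩) :
    theta (C⟦X⟧) f = inclC C (theta C (redC f)) + tElt C * theta (C⟦X⟧) (divT f) := by
  conv_lhs => rw [eq_inclC_add f]
  rw [map_add, theta_inclC, (theta (C⟦X⟧)).leibniz, tElt, theta_C, zero_mul, zero_add]

theorem inclC_xElt_pow (n : ℕ) : inclC C (xElt C ^ n) = xElt (C⟦X⟧) ^ n := by
  rw [map_pow]
  congr 1
  refine HahnSeries.ext (funext fun m => ?_)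
  rw [inclC_coeff, xElt, xElt, HahnSeries.coeff_single, HahnSeries.coeff_single]
  split_ifs <;> simp

theorem exists_redC_ofPowerSeries (f : (C⟦X⟧)⟦X⟧) : ∃ g : C⟦X⟧,
    redC (HahnSeries.ofPowerSeries ℤ _ f) = HahnSeries.ofPowerSeries ℤ C g :=
  exists_eq_ofPowerSeries _ fun n hn => by
    rw [redC_coeff, ofPowerSeries_coeff_of_neg _ hn, map_zero]

theorem exists_divT_ofPowerSeries (f : (C⟦X⟧)⟦X⟧) : ∃ g : (C⟦X⟧)⟦X⟧,
    divT (HahnSeries.ofPowerSeries ℤ _ f) = HahnSeries.ofPowerSeries ℤ _ g :=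
  exists_eq_ofPowerSeries _ fun n hn => by
    rw [divT_coeff, ofPowerSeries_coeff_of_neg _ hn]
    ext; simp

theorem exists_inclC_ofPowerSeries (f : C⟦X⟧) : ∃ g : (C⟦X⟧)⟦X⟧,
    inclC C (HahnSeries.ofPowerSeries ℤ C f) = HahnSeries.ofPowerSeries ℤ _ g :=
  exists_eq_ofPowerSeries _ fun n hn => by
    rw [inclC_coeff, ofPowerSeries_coeff_of_neg _ hn, map_zero]

/-- The element `∑ tᵏ hₖ` of `R[[x]]`. -/
def tSeries (h : ℕ → C⟦X⟧) : (C⟦X⟧)⟦X⟧ :=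
  PowerSeries.mk fun n => PowerSeries.mk fun k => PowerSeries.coeff n (h k)

theorem tSeries_eq (h : ℕ → C⟦X⟧) : HahnSeries.ofPowerSeries ℤ _ (tSeries h) =
    inclC C (HahnSeries.ofPowerSeries ℤ C (h 0)) +
      tElt C * HahnSeries.ofPowerSeries ℤ _ (tSeries fun k => h (k + 1)) := by
  ext n k
  rw [HahnSeries.coeff_add, inclC_coeff, tElt_mul_coeff, PowerSeries.coeff_coe,
    PowerSeries.coeff_coe, PowerSeries.coeff_coe, map_add]
  split_ifs
  · simp
  · cases k with
    | zero => simp [tSeries]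
    | succ k => simp [tSeries, PowerSeries.coeff_succ_X_mul]

theorem exists_tSeries_sub (h : ℕ → C⟦X⟧) (n : ℕ) : ∃ c,
    HahnSeries.ofPowerSeries ℤ _ (tSeries h) - ∑ k ∈ Finset.range n,
      tElt C ^ k * inclC C (HahnSeries.ofPowerSeries ℤ C (h k)) = tElt C ^ n * c := by
  induction n generalizing h with
  | zero => exact ⟨HahnSeries.ofPowerSeries ℤ _ (tSeries h), by simp⟩
  | succ n ih =>
    obtain ⟨c, hc⟩ := ih fun k => h (k + 1)
    refine ⟨c, ?_⟩
    rw [pow_succ', mul_assoc, ← hc, tSeries_eq, Finset.sum_range_succ', mul_sub, Finset.mul_sum]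
    simp only [pow_succ', mul_assoc, pow_zero, one_mul]
    ring

end Coefficients

/-! ### Reductions of connections and of their structure over `R((x))` -/

section ReductionLemmas

variable {C : Type u} [Field C] {E : Type v} [AddCommGroup E] [Module (C⟦X⟧)⸨X⸩ E]

namespace Reduction

theorem mk_surjective (ℓ : ℕ) : Function.Surjective (mk C E ℓ) := Submodule.mkQ_surjective _

theorem mk_eq_zero {ℓ : ℕ} {e : E} : mk C E ℓ e = 0 ↔ ∃ w, e = tElt C ^ (ℓ + 1) • w := by
  refine (Submodule.Quotient.mk_eq_zero (tPow C E ℓ)).trans ?_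
  exact ⟨fun ⟨w, hw⟩ => ⟨w, hw.symm⟩, fun ⟨w, hw⟩ => ⟨w, hw.symm⟩⟩

theorem transition_mk (ℓ : ℕ) (e : E) : transition C E ℓ (mk C E (ℓ + 1) e) = mk C E ℓ e := rfl

theorem transition_surjective (ℓ : ℕ) : Function.Surjective (transition C E ℓ) := fun e => by
  obtain ⟨e, rfl⟩ := mk_surjective ℓ e
  exact ⟨mk C E (ℓ + 1) e, rfl⟩

theorem tElt_pow_smul (ℓ : ℕ) (e : Reduction C E ℓ) : tElt C ^ (ℓ + 1) • e = 0 := by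
  obtain ⟨e, rfl⟩ := mk_surjective ℓ e
  rw [← map_smul, mk_eq_zero]
  exact ⟨e, rfl⟩

theorem exists_of_transition_eq_zero {ℓ : ℕ} {e : Reduction C E (ℓ + 1)}
    (he : transition C E ℓ e = 0) : ∃ w, e = tElt C ^ (ℓ + 1) • w := by
  obtain ⟨e, rfl⟩ := mk_surjective _ e
  rw [transition_mk, mk_eq_zero] at he
  obtain ⟨w, rfl⟩ := he
  exact ⟨mk C E (ℓ + 1) w, map_smul _ _ _⟩

/-- Here `P k` is a claim multiplied by `t^k`. It is trivial for `k = ℓ + 1`, where `t^{ℓ+1} = 0`,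
and writing `f = f_0 + t f_1` reduces `P k` to the case of `f_0 ∈ C((x))` and to `P (k + 1)`. -/
theorem tElt_induction {ℓ : ℕ} {P : ℕ → Prop} (h0 : P (ℓ + 1)) (hs : ∀ k, P (k + 1) → P k) :
    P 0 := by
  have : ∀ n k, k + n = ℓ + 1 → P k := by
    intro n
    induction n with
    | zero => rintro k rfl; exact h0
    | succ n ih => exact fun k hk => hs k (ih (k + 1) (by omega))
  exact this (ℓ + 1) 0 (by omega)

/-- An `R((x))`-linear map, as a `C((x))`-linear map. -/
def restrictC {ℓ ℓ' : ℕ} (φ : Reduction C E ℓ →ₗ[(C⟦X⟧)⸨X⸩] Reduction C E ℓ') :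
    Reduction C E ℓ →ₗ[C⸨X⸩] Reduction C E ℓ' where
  toFun := φ
  map_add' := map_add φ
  map_smul' f e := by rw [smul_def, map_smul]; rfl

/-- The products of the generators with `t^k`, `k ≤ ℓ`, generate over `C((x))`. -/
theorem finite [Module.Finite (C⟦X⟧)⸨X⸩ E] (ℓ : ℕ) : Module.Finite C⸨X⸩ (Reduction C E ℓ) := by
  obtain ⟨n, g, hg⟩ := Module.Finite.exists_fin (R := (C⟦X⟧)⸨X⸩) (M := E)
  let b : Fin (ℓ + 1) × Fin n → Reduction C E ℓ := fun i => tElt C ^ (i.1 : ℕ) • mk C E ℓ (g i.2)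
  set S := Submodule.span C⸨X⸩ (Set.range b) with hS
  have key : ∀ (i : Fin n) (f : (C⟦X⟧)⸨X⸩), tElt C ^ 0 • f • mk C E ℓ (g i) ∈ S := by
    intro i
    refine tElt_induction (ℓ := ℓ) (P := fun k => ∀ f : (C⟦X⟧)⸨X⸩,
      tElt C ^ k • f • mk C E ℓ (g i) ∈ S) (fun f => ?_) fun k ih f => ?_
    · rw [tElt_pow_smul]; exact S.zero_mem
    · rw [eq_inclC_add f, add_smul, smul_add]
      refine S.add_mem ?_ ?_
      · rw [smul_comm, ← smul_def]
        refine S.smul_mem _ ?_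
        by_cases hk : k < ℓ + 1
        · exact Submodule.subset_span ⟨(⟨k, hk⟩, i), rfl⟩
        · obtain ⟨m, rfl⟩ := Nat.exists_eq_add_of_le' (not_lt.1 hk)
          rw [pow_add, mul_smul, tElt_pow_smul, smul_zero]
          exact S.zero_mem
      · have := ih (divT f)
        rwa [pow_succ, mul_smul, smul_smul (tElt C)] at this
  refine ⟨Submodule.fg_def.2 ⟨Set.range b, Set.finite_range b, ?_⟩⟩
  rw [eq_top_iff]
  rintro e -
  obtain ⟨e, rfl⟩ := mk_surjective ℓ e
  have he : e ∈ Submodule.span (C⟦X⟧)⸨X⸩ (Set.range g) := hg ▸ Submodule.mem_top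
  obtain ⟨c, rfl⟩ := (Submodule.mem_span_range_iff_exists_fun _).1 he
  rw [map_sum]
  refine Submodule.sum_mem _ fun i _ => ?_
  have := key i (c i)
  rwa [pow_zero, one_smul, ← map_smul] at this

end Reduction

theorem Connection.reduce_leibniz (D : Connection (theta (C⟦X⟧)) E) (ℓ : ℕ) (f : (C⟦X⟧)⸨X⸩)
    (e : Reduction C E ℓ) :
    D.reduce ℓ (f • e) = theta (C⟦X⟧) f • e + f • D.reduce ℓ e := by
  obtain ⟨e, rfl⟩ := Reduction.mk_surjective ℓ e
  rw [← map_smul, D.reduce_mk, D.reduce_mk, D.leibniz, map_add, map_smul, map_smul]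

theorem Connection.transition_reduce (D : Connection (theta (C⟦X⟧)) E) (ℓ : ℕ)
    (e : Reduction C E (ℓ + 1)) :
    Reduction.transition C E ℓ (D.reduce (ℓ + 1) e) =
      D.reduce ℓ (Reduction.transition C E ℓ e) := by
  obtain ⟨e, rfl⟩ := Reduction.mk_surjective _ e
  rw [D.reduce_mk, Reduction.transition_mk, Reduction.transition_mk, D.reduce_mk]

/-- Multiplication by a constant `r ∈ R` and the projections are horizontal for the reductions of
`∇`, so they commute with irregular parts. -/
theorem IsCompatibleSystem.of_isIrregularPart [CharZero C]
    (nabla : Connection (theta (C⟦X⟧)) E) (s : ℕ → ℕ+)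
    (S : ∀ ℓ, Reduction C E ℓ →ₗ[C⸨X⸩] Reduction C E ℓ)
    (hS : ∀ ℓ, IsIrregularPart (s ℓ) (nabla.reduce ℓ) (S ℓ)) :
    IsCompatibleSystem fun ℓ => (nabla.reduce ℓ).subLinear (S ℓ) := by
  constructor
  · intro ℓ r e
    have hr : ∀ e : Reduction C E ℓ, (HahnSeries.C r : (C⟦X⟧)⸨X⸩) • nabla.reduce ℓ e =
        nabla.reduce ℓ ((HahnSeries.C r : (C⟦X⟧)⸨X⸩) • e) := fun e => by
      rw [nabla.reduce_leibniz, theta_C, zero_smul, zero_add]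
    have := (hS ℓ).comm (hS ℓ)
      (Reduction.restrictC (LinearMap.lsmul _ _ (HahnSeries.C r : (C⟦X⟧)⸨X⸩))) hr e
    rw [Connection.subLinear_apply, Connection.subLinear_apply, ← hr, smul_sub]
    exact congrArg _ this.symm
  · intro ℓ e
    have := (hS (ℓ + 1)).comm (hS ℓ) (Reduction.restrictC (Reduction.transition C E ℓ))
      (nabla.transition_reduce ℓ) e
    rw [Connection.subLinear_apply, Connection.subLinear_apply, map_sub, nabla.transition_reduce]
    exact congrArg _ this

/-- The Leibniz rule over `C((x))` and linearity in `t` imply it over `R((x))`, by expanding `f` in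
powers of `t`. -/
theorem IsCompatibleSystem.leibniz {D : ∀ ℓ, Connection (theta C) (Reduction C E ℓ)}
    (hD : IsCompatibleSystem D) (ℓ : ℕ) (f : (C⟦X⟧)⸨X⸩) (e : Reduction C E ℓ) :
    D ℓ (f • e) = theta (C⟦X⟧) f • e + f • D ℓ e := by
  have ht : ∀ (k : ℕ) (e : Reduction C E ℓ), D ℓ (tElt C ^ k • e) = tElt C ^ k • D ℓ e := by
    intro k e
    rw [tElt, ← map_pow]
    exact hD.linear ℓ _ e
  have := Reduction.tElt_induction (ℓ := ℓ) (P := fun k => ∀ f : (C⟦X⟧)⸨X⸩,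
      tElt C ^ k • D ℓ (f • e) = tElt C ^ k • (theta (C⟦X⟧) f • e + f • D ℓ e))
    (fun f => by rw [Reduction.tElt_pow_smul, Reduction.tElt_pow_smul]) (fun k ih f => by
      have h1 := ih (divT f)
      have h2 : D ℓ (inclC C (redC f) • e) = inclC C (theta C (redC f)) • e +
        inclC C (redC f) • D ℓ e := (D ℓ).leibniz (redC f) e
      have h3 := ht 1 (divT f • e)
      rw [pow_one] at h3
      have h4 : D ℓ (f • e) = inclC C (theta C (redC f)) • e + inclC C (redC f) • D ℓ e +
          tElt C • D ℓ (divT f • e) := by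
        conv_lhs => rw [eq_inclC_add f]
        rw [add_smul, map_add, h2, mul_smul, h3]
      have h5 : f • D ℓ e = inclC C (redC f) • D ℓ e + (tElt C * divT f) • D ℓ e := by
        rw [← add_smul, ← eq_inclC_add]
      rw [h4, smul_add, smul_smul (tElt C ^ k) (tElt C), ← pow_succ, h1, theta_eq_inclC_add f, h5,
        pow_succ]
      simp only [smul_add, add_smul, mul_smul]
      abel) f
  simpa using this

end ReductionLemmas

/-! ### Deligne–Manin lattices as a `t`-adic system -/

section System

variable {C : Type u} [Field C] [IsAlgClosed C] {E : Type v} [AddCommGroup E]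
  [Module (C⟦X⟧)⸨X⸩ E] {τ : Set C} {D : ∀ ℓ, Connection (theta C) (Reduction C E ℓ)}

/-- Projections and multiplication by powers of `t` are horizontal. Strictness of the projections
gives surjectivity on lattices, and strictness of `t^{ℓ+1}` gives the kernels. -/
theorem isAdicSystem_lattice (hτ : ∀ a ∈ τ, ∀ n : ℤ, a - n ∈ τ → n = 0)
    (hD : IsCompatibleSystem D) (B : ∀ ℓ, EulerBasis τ (D ℓ)) :
    IsAdicSystem (Reduction.transition C E) (tElt C) fun ℓ => (B ℓ).lattice.carrier := by
  have ht : ∀ (k ℓ : ℕ) (e : Reduction C E ℓ), tElt C ^ k • D ℓ e = D ℓ (tElt C ^ k • e) := by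
    intro k ℓ e
    rw [tElt, ← map_pow]
    exact (hD.linear ℓ _ e).symm
  refine ⟨fun ℓ e he => ?_, fun ℓ e he => ?_, fun ℓ m hm => ?_, fun ℓ e he hpe => ?_,
    fun ℓ e => Reduction.tElt_pow_smul ℓ e⟩
  · have := (B ℓ).map_mem_lattice (B ℓ) hτ
      (Reduction.restrictC (LinearMap.lsmul _ _ (tElt C ^ 1))) (ht 1 ℓ) he
    change tElt C ^ 1 • e ∈ _ at this
    rwa [pow_one] at this
  · exact (B (ℓ + 1)).map_mem_lattice (B ℓ) hτ
      (Reduction.restrictC (Reduction.transition C E ℓ)) (hD.horizontal ℓ) he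
  · obtain ⟨e, rfl⟩ := Reduction.transition_surjective ℓ m
    exact (B (ℓ + 1)).exists_mem_lattice_of_map (B ℓ) hτ
      (Reduction.restrictC (Reduction.transition C E ℓ)) (hD.horizontal ℓ) hm
  · obtain ⟨w, rfl⟩ := Reduction.exists_of_transition_eq_zero hpe
    obtain ⟨m, hm, hmw⟩ := (B (ℓ + 1)).exists_mem_lattice_of_map (B (ℓ + 1)) hτ
      (Reduction.restrictC (LinearMap.lsmul _ _ (tElt C ^ (ℓ + 1)))) (ht (ℓ + 1) (ℓ + 1)) he
    exact ⟨m, hm, hmw.symm⟩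

theorem ofPowerSeries_smul_mem_lattice (hτ : ∀ a ∈ τ, ∀ n : ℤ, a - n ∈ τ → n = 0)
    (hD : IsCompatibleSystem D) (B : ∀ ℓ, EulerBasis τ (D ℓ)) (ℓ : ℕ) (f : (C⟦X⟧)⟦X⟧)
    {e : Reduction C E ℓ} (he : e ∈ (B ℓ).lattice.carrier) :
    HahnSeries.ofPowerSeries ℤ _ f • e ∈ (B ℓ).lattice.carrier := by
  have h := isAdicSystem_lattice hτ hD B
  have := Reduction.tElt_induction (ℓ := ℓ) (P := fun k => ∀ f : (C⟦X⟧)⟦X⟧,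
      tElt C ^ k • HahnSeries.ofPowerSeries ℤ _ f • e ∈ (B ℓ).lattice.carrier)
    (fun f => by rw [Reduction.tElt_pow_smul]; exact AddSubgroup.zero_mem _) (fun k ih f => by
      obtain ⟨g, hg⟩ := exists_redC_ofPowerSeries f
      obtain ⟨g', hg'⟩ := exists_divT_ofPowerSeries f
      rw [eq_inclC_add (HahnSeries.ofPowerSeries ℤ _ f), add_smul, smul_add]
      refine AddSubgroup.add_mem _ ?_ ?_
      · refine h.pow_smul_mem k ℓ ?_
        rw [hg]
        exact (B ℓ).lattice.smul_mem g e he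
      · have := ih g'
        rwa [pow_succ, mul_smul, smul_smul (tElt C), ← hg'] at this) f
  rwa [pow_zero, one_smul] at this

end System


/-! ### The limit connection and its logarithmic model -/

section LimitConnection

variable {C : Type u} [Field C] {E : Type v} [AddCommGroup E] [Module (C⟦X⟧)⸨X⸩ E]

theorem single_neg_mul_xElt_pow {A : Type u} [CommRing A] (n : ℕ) :
    (HahnSeries.single (-(n : ℤ)) 1 : A⸨X⸩) * xElt A ^ n = 1 := by
  rw [xElt, HahnSeries.single_pow, HahnSeries.single_mul_single]
  simp

theorem xElt_pow_eq {A : Type u} [CommRing A] (n : ℕ) :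
    xElt A ^ n = HahnSeries.ofPowerSeries ℤ A (PowerSeries.X ^ n) := by
  rw [xElt, HahnSeries.ofPowerSeries_X_pow, HahnSeries.single_pow]
  simp

theorem exists_xElt_pow_mul {A : Type u} [CommRing A] (f : A⸨X⸩) :
    ∃ (n : ℕ) (g : A⟦X⟧), xElt A ^ n * f = HahnSeries.ofPowerSeries ℤ A g := by
  obtain ⟨n, hn⟩ := exists_coeff_bound f
  obtain ⟨g, hg⟩ := exists_eq_single_mul f (-n) hn
  refine ⟨n, g, ?_⟩
  rw [hg, ← mul_assoc, mul_comm (xElt A ^ n), single_neg_mul_xElt_pow, one_mul]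

variable {M : ∀ ℓ, AddSubgroup (Reduction C E ℓ)}

/-- The union of the `x⁻ⁿ lim M ℓ` inside the product of the `E|_ℓ`. -/
def limitModule (hM : ∀ ℓ (f : (C⟦X⟧)⟦X⟧), ∀ e ∈ M ℓ, HahnSeries.ofPowerSeries ℤ _ f • e ∈ M ℓ) :
    -- Lifting the index set places the limit in `Type (max u v)`.
    Submodule (C⟦X⟧)⸨X⸩ (∀ ℓ : ULift.{u} ℕ, Reduction C E ℓ.down) where
  carrier := {e | (∀ ℓ, Reduction.transition C E ℓ (e ⟨ℓ + 1⟩) = e ⟨ℓ⟩) ∧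
    ∃ n : ℕ, ∀ ℓ, xElt (C⟦X⟧) ^ n • e ⟨ℓ⟩ ∈ M ℓ}
  add_mem' := by
    rintro a b ⟨ha, n, hn⟩ ⟨hb, m, hm⟩
    refine ⟨fun ℓ => by rw [Pi.add_apply, map_add, ha, hb]; rfl, n + m, fun ℓ => ?_⟩
    rw [Pi.add_apply, smul_add]
    refine (M ℓ).add_mem ?_ ?_
    · rw [pow_add, mul_comm, mul_smul, xElt_pow_eq m]
      exact hM ℓ _ _ (hn ℓ)
    · rw [pow_add, mul_smul, xElt_pow_eq n]
      exact hM ℓ _ _ (hm ℓ)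
  zero_mem' := ⟨fun ℓ => map_zero _, 0, fun ℓ => by
    rw [Pi.zero_apply, smul_zero]; exact (M ℓ).zero_mem⟩
  smul_mem' := by
    rintro f e ⟨he, n, hn⟩
    refine ⟨fun ℓ => by rw [Pi.smul_apply, map_smul, he]; rfl, ?_⟩
    obtain ⟨m, g, hg⟩ := exists_xElt_pow_mul f
    refine ⟨m + n, fun ℓ => ?_⟩
    have := hM ℓ g _ (hn ℓ)
    rwa [← hg, smul_smul, mul_right_comm, ← pow_add, mul_smul] at this

variable {hM : ∀ ℓ (f : (C⟦X⟧)⟦X⟧), ∀ e ∈ M ℓ, HahnSeries.ofPowerSeries ℤ _ f • e ∈ M ℓ}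

/-- The projection to `E|_ℓ`. -/
def limitProj (hM : ∀ ℓ (f : (C⟦X⟧)⟦X⟧), ∀ e ∈ M ℓ, HahnSeries.ofPowerSeries ℤ _ f • e ∈ M ℓ)
    (ℓ : ℕ) : limitModule hM →ₗ[(C⟦X⟧)⸨X⸩] Reduction C E ℓ :=
  (LinearMap.proj (R := (C⟦X⟧)⸨X⸩) (φ := fun ℓ : ULift.{u} ℕ => Reduction C E ℓ.down) ⟨ℓ⟩).comp
    (limitModule hM).subtype

theorem limitProj_ext {e e' : limitModule hM} (h : ∀ ℓ, limitProj hM ℓ e = limitProj hM ℓ e') :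
    e = e' :=
  Subtype.ext (funext fun ℓ => h ℓ.down)

theorem transition_limitProj (ℓ : ℕ) (e : limitModule hM) :
    Reduction.transition C E ℓ (limitProj hM (ℓ + 1) e) = limitProj hM ℓ e := e.2.1 ℓ

theorem exists_pow_smul_limitProj_mem (e : limitModule hM) :
    ∃ n : ℕ, ∀ ℓ, xElt (C⟦X⟧) ^ n • limitProj hM ℓ e ∈ M ℓ := e.2.2

theorem exists_limitProj_eq {e : ∀ ℓ, Reduction C E ℓ}
    (he : e ∈ limitGroup (Reduction.transition C E) M) :
    ∃ e' : limitModule hM, ∀ ℓ, limitProj hM ℓ e' = e ℓ :=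
  ⟨⟨fun ℓ => e ℓ.down, he.2, 0, fun ℓ => by rw [pow_zero, one_smul]; exact he.1 ℓ⟩, fun _ => rfl⟩

theorem limitProj_mem_limitGroup {e : limitModule hM} (he : ∀ ℓ, limitProj hM ℓ e ∈ M ℓ) :
    (fun ℓ => limitProj hM ℓ e) ∈ limitGroup (Reduction.transition C E) M :=
  ⟨he, fun ℓ => transition_limitProj ℓ e⟩

/-- A power of `x`, uniform in the level, moves the element into the limit of the lattices. Division
by `t^{ℓ+1}` takes place there, and the power of `x` is then inverted. -/
theorem exists_limitProj_eq_smul (h : IsAdicSystem (Reduction.transition C E) (tElt C) M)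
    {ℓ : ℕ} {e : limitModule hM} (he : limitProj hM ℓ e = 0) :
    ∃ w, e = tElt C ^ (ℓ + 1) • w := by
  obtain ⟨n, hn⟩ := exists_pow_smul_limitProj_mem e
  have h1 := limitProj_mem_limitGroup (e := xElt (C⟦X⟧) ^ n • e) fun ℓ => by
    rw [map_smul]; exact hn ℓ
  obtain ⟨y, hy, hey⟩ := h.exists_eq_pow_smul h1 (ℓ := ℓ) (by rw [map_smul, he, smul_zero])
  obtain ⟨w, hw⟩ := exists_limitProj_eq (hM := hM) hy
  refine ⟨(HahnSeries.single (-(n : ℤ)) 1 : (C⟦X⟧)⸨X⸩) • w, limitProj_ext fun k => ?_⟩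
  have h2 : xElt (C⟦X⟧) ^ n • limitProj hM k e = tElt C ^ (ℓ + 1) • y k := by
    rw [← map_smul]
    exact congrFun hey k
  rw [map_smul, map_smul, hw, smul_comm, ← h2, smul_smul, single_neg_mul_xElt_pow, one_smul]

theorem limitProj_surjective (h : IsAdicSystem (Reduction.transition C E) (tElt C) M)
    (hspan : ∀ ℓ (e : Reduction C E ℓ), ∃ n : ℕ, xElt (C⟦X⟧) ^ n • e ∈ M ℓ) (ℓ : ℕ) :
    Function.Surjective (limitProj hM ℓ) := by
  intro e
  obtain ⟨n, hn⟩ := hspan ℓ e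
  obtain ⟨y, hy, hey⟩ := h.exists_lift hn
  obtain ⟨w, hw⟩ := exists_limitProj_eq (hM := hM) hy
  refine ⟨(HahnSeries.single (-(n : ℤ)) 1 : (C⟦X⟧)⸨X⸩) • w, ?_⟩
  rw [map_smul, hw, hey, smul_smul, single_neg_mul_xElt_pow, one_smul]

theorem ker_limitProj (h : IsAdicSystem (Reduction.transition C E) (tElt C) M) (ℓ : ℕ) :
    tPow C (limitModule hM) ℓ = LinearMap.ker (limitProj hM ℓ) := by
  ext e
  rw [LinearMap.mem_ker]
  constructor
  · rintro ⟨w, rfl⟩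
    rw [LinearMap.lsmul_apply, map_smul, Reduction.tElt_pow_smul]
  · intro he
    obtain ⟨w, hw⟩ := exists_limitProj_eq_smul h he
    exact ⟨w, hw.symm⟩

/-- The reductions of the limit. -/
def limitEquiv (h : IsAdicSystem (Reduction.transition C E) (tElt C) M)
    (hspan : ∀ ℓ (e : Reduction C E ℓ), ∃ n : ℕ, xElt (C⟦X⟧) ^ n • e ∈ M ℓ) (ℓ : ℕ) :
    Reduction C (limitModule hM) ℓ ≃ₗ[(C⟦X⟧)⸨X⸩] Reduction C E ℓ :=
  (Submodule.quotEquivOfEq _ _ (ker_limitProj (hM := hM) h ℓ)).trans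
    ((limitProj hM ℓ).quotKerEquivOfSurjective (limitProj_surjective h hspan ℓ))

theorem limitEquiv_mk (h : IsAdicSystem (Reduction.transition C E) (tElt C) M)
    (hspan : ∀ ℓ (e : Reduction C E ℓ), ∃ n : ℕ, xElt (C⟦X⟧) ^ n • e ∈ M ℓ) (ℓ : ℕ)
    (e : limitModule hM) :
    limitEquiv h hspan ℓ (Reduction.mk C (limitModule hM) ℓ e) = limitProj hM ℓ e := rfl

variable {D : ∀ ℓ, Connection (theta C) (Reduction C E ℓ)}

theorem IsCompatibleSystem.xElt_pow_smul (hD : IsCompatibleSystem D) (n ℓ : ℕ)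
    (e : Reduction C E ℓ) : xElt (C⟦X⟧) ^ n • D ℓ e =
      D ℓ (xElt (C⟦X⟧) ^ n • e) - HahnSeries.ofPowerSeries ℤ _ (PowerSeries.C (n : C⟦X⟧)) •
        xElt (C⟦X⟧) ^ n • e := by
  have : theta (C⟦X⟧) (xElt (C⟦X⟧) ^ n) =
      HahnSeries.ofPowerSeries ℤ _ (PowerSeries.C (n : C⟦X⟧)) * xElt (C⟦X⟧) ^ n := by
    rw [HahnSeries.ofPowerSeries_C, xElt, HahnSeries.single_pow]
    refine HahnSeries.ext (funext fun m => ?_)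
    rw [theta_coeff, HahnSeries.C_mul_eq_smul, HahnSeries.coeff_smul, smul_eq_mul]
    by_cases hm : m = n
    · subst hm; simp
    · rw [HahnSeries.coeff_single_of_ne (by simpa using hm), mul_zero, mul_zero]
  rw [hD.leibniz, this, smul_smul, add_sub_cancel_left]

/-- The limit of the connections `D ℓ`. -/
def limitConn (hD : IsCompatibleSystem D) (hst : ∀ ℓ, ∀ e ∈ M ℓ, D ℓ e ∈ M ℓ)
    (hM : ∀ ℓ (f : (C⟦X⟧)⟦X⟧), ∀ e ∈ M ℓ, HahnSeries.ofPowerSeries ℤ _ f • e ∈ M ℓ) :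
    Connection (theta (C⟦X⟧)) (limitModule hM) where
  toFun e := ⟨fun ℓ => D ℓ.down (limitProj hM ℓ.down e), fun ℓ => by
    rw [hD.horizontal, transition_limitProj], by
    obtain ⟨n, hn⟩ := exists_pow_smul_limitProj_mem e
    refine ⟨n, fun ℓ => ?_⟩
    -- Commuting `x^n` past the connection costs only `n x^n`, so the same exponent `n` bounds the
    -- poles of `∇ e` at every level.
    rw [hD.xElt_pow_smul]
    exact (M ℓ).sub_mem (hst ℓ _ (hn ℓ)) (hM ℓ _ _ (hn ℓ))⟩
  map_zero' := Subtype.ext (funext fun ℓ => by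
    change D ℓ.down (limitProj hM ℓ.down 0) = 0
    rw [map_zero, map_zero])
  map_add' a b := Subtype.ext (funext fun ℓ => by
    change D ℓ.down (limitProj hM ℓ.down (a + b)) =
      D ℓ.down (limitProj hM ℓ.down a) + D ℓ.down (limitProj hM ℓ.down b)
    rw [map_add, map_add])
  leibniz' f e := Subtype.ext (funext fun ℓ => by
    change D ℓ.down (limitProj hM ℓ.down (f • e)) =
      theta (C⟦X⟧) f • limitProj hM ℓ.down e + f • D ℓ.down (limitProj hM ℓ.down e)
    rw [map_smul, hD.leibniz])

theorem limitProj_limitConn (hD : IsCompatibleSystem D) (hst : ∀ ℓ, ∀ e ∈ M ℓ, D ℓ e ∈ M ℓ)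
    (ℓ : ℕ) (e : limitModule hM) :
    limitProj hM ℓ (limitConn hD hst hM e) = D ℓ (limitProj hM ℓ e) := rfl

/-- Finite generation of the limit. -/
theorem exists_generators (h : IsAdicSystem (Reduction.transition C E) (tElt C) M)
    (hM : ∀ ℓ (f : (C⟦X⟧)⟦X⟧), ∀ e ∈ M ℓ, HahnSeries.ofPowerSeries ℤ _ f • e ∈ M ℓ)
    (hfg : ∃ (n : ℕ) (g : Fin n → Reduction C E 0), (∀ i, g i ∈ M 0) ∧
      ∀ e ∈ M 0, ∃ a : Fin n → C⟦X⟧, e = ∑ i, HahnSeries.ofPowerSeries ℤ C (a i) • g i) :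
    ∃ (n : ℕ) (G : Fin n → limitModule hM), (∀ i ℓ, limitProj hM ℓ (G i) ∈ M ℓ) ∧
      ∀ e : limitModule hM, (∀ ℓ, limitProj hM ℓ e ∈ M ℓ) →
        ∃ a : Fin n → (C⟦X⟧)⟦X⟧, e = ∑ i, HahnSeries.ofPowerSeries ℤ _ (a i) • G i := by
  obtain ⟨n, g, hg, hgen⟩ := hfg
  choose G₀ hG₀ hG₀g using fun i => h.exists_lift (hg i)
  choose G hG using fun i => exists_limitProj_eq (hM := hM) (hG₀ i)
  refine ⟨n, G, fun i ℓ => by rw [hG]; exact (hG₀ i).1 ℓ, fun e he => ?_⟩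
  -- Lifts of `C[[x]]`-generators at level `0` generate over `R[[x]]` by `t`-adic completeness.
  obtain ⟨b, hb, heb⟩ := h.exists_eq_sum hG₀
    (P := Set.range fun a : C⟦X⟧ => inclC C (HahnSeries.ofPowerSeries ℤ C a))
    (Q := Set.range (HahnSeries.ofPowerSeries ℤ (C⟦X⟧)))
    (by
      rintro _ ⟨a, rfl⟩ e he
      obtain ⟨a', ha'⟩ := exists_inclC_ofPowerSeries a
      refine ⟨fun ℓ => ?_, fun ℓ => by rw [Pi.smul_apply, map_smul, he.2]; rfl⟩
      simp only [ha']
      exact hM ℓ a' _ (he.1 ℓ))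
    (by
      intro m hm
      obtain ⟨a, rfl⟩ := hgen m hm
      refine ⟨fun i => inclC C (HahnSeries.ofPowerSeries ℤ C (a i)), fun i => ⟨a i, rfl⟩, ?_⟩
      exact Finset.sum_congr rfl fun i _ => by rw [hG₀g]; rfl)
    (by
      intro a ha
      choose a' ha' using ha
      refine ⟨_, ⟨tSeries a', rfl⟩, fun n => ?_⟩
      obtain ⟨c, hc⟩ := exists_tSeries_sub a' n
      refine ⟨c, ?_⟩
      rw [← hc]
      simp only [ha'])
    (limitProj_mem_limitGroup he)
  choose a ha using hb
  refine ⟨a, limitProj_ext fun ℓ => ?_⟩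
  have := congrFun heb ℓ
  simp only [Finset.sum_apply, Pi.smul_apply] at this
  rw [this, map_sum]
  exact Finset.sum_congr rfl fun i _ => by rw [map_smul, hG, ha]

/-- The limit of the `M ℓ` as a logarithmic model. -/
def limitModel (h : IsAdicSystem (Reduction.transition C E) (tElt C) M)
    (hD : IsCompatibleSystem D) (hst : ∀ ℓ, ∀ e ∈ M ℓ, D ℓ e ∈ M ℓ)
    (hM : ∀ ℓ (f : (C⟦X⟧)⟦X⟧), ∀ e ∈ M ℓ, HahnSeries.ofPowerSeries ℤ _ f • e ∈ M ℓ)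
    (hfg : ∃ (n : ℕ) (g : Fin n → Reduction C E 0), (∀ i, g i ∈ M 0) ∧
      ∀ e ∈ M 0, ∃ a : Fin n → C⟦X⟧, e = ∑ i, HahnSeries.ofPowerSeries ℤ C (a i) • g i) :
    LogModel (limitConn hD hst hM) where
  carrier :=
    { carrier := {e | ∀ ℓ, limitProj hM ℓ e ∈ M ℓ}
      add_mem' := fun {a b} ha hb ℓ => by rw [map_add]; exact (M ℓ).add_mem (ha ℓ) (hb ℓ)
      zero_mem' := fun ℓ => by rw [map_zero]; exact (M ℓ).zero_mem
      neg_mem' := fun {a} ha ℓ => by rw [map_neg]; exact (M ℓ).neg_mem (ha ℓ) }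
  smul_mem f e he ℓ := by rw [map_smul]; exact hM ℓ f _ (he ℓ)
  fg := exists_generators h hM hfg
  stable e he ℓ := hst ℓ _ (he ℓ)
  spans e := by
    obtain ⟨n, hn⟩ := exists_pow_smul_limitProj_mem e
    exact ⟨n, fun ℓ => by rw [map_smul]; exact hn ℓ⟩

theorem LogModel.finite {A : Type u} [CommRing A] {E : Type v} [AddCommGroup E] [Module A⸨X⸩ E]
    {D : Connection (theta A) E} (L : LogModel D) : Module.Finite A⸨X⸩ E := by
  obtain ⟨n, g, -, hg⟩ := L.fg
  refine ⟨Submodule.fg_def.2 ⟨Set.range g, Set.finite_range g, ?_⟩⟩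
  rw [eq_top_iff]
  rintro e -
  obtain ⟨m, hm⟩ := L.spans e
  obtain ⟨a, ha⟩ := hg _ hm
  have h1 : xElt A ^ m • e ∈ Submodule.span A⸨X⸩ (Set.range g) := by
    rw [ha]
    exact Submodule.sum_mem _ fun i _ => Submodule.smul_mem _ _ (Submodule.subset_span ⟨i, rfl⟩)
  have h2 := Submodule.smul_mem _ (HahnSeries.single (-(m : ℤ)) 1 : A⸨X⸩) h1
  rwa [smul_smul, single_neg_mul_xElt_pow, one_smul] at h2

/-- A compatible system of connections with Euler bases has a limit. -/
theorem IsCompatibleSystem.exists_limit [IsAlgClosed C] {τ : Set C}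
    (hτ : ∀ a ∈ τ, ∀ n : ℤ, a - n ∈ τ → n = 0) (hD : IsCompatibleSystem D)
    (B : ∀ ℓ, EulerBasis τ (D ℓ)) :
    ∃ (E' : Type (max u v)) (_ : AddCommGroup E') (_ : Module (C⟦X⟧)⸨X⸩ E')
      (nabla' : Connection (theta (C⟦X⟧)) E')
      (θ : ∀ ℓ : ℕ, Reduction C E' ℓ ≃ₗ[(C⟦X⟧)⸨X⸩] Reduction C E ℓ),
      Module.Finite (C⟦X⟧)⸨X⸩ E' ∧ IsRegularSingular nabla' ∧ IsReductionIso D nabla' θ ∧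
        IsLimit τ D nabla' θ := by
  have h := isAdicSystem_lattice hτ hD B
  have hM : ∀ ℓ (f : (C⟦X⟧)⟦X⟧), ∀ e ∈ (B ℓ).lattice.carrier,
      HahnSeries.ofPowerSeries ℤ _ f • e ∈ (B ℓ).lattice.carrier :=
    fun ℓ f e he => ofPowerSeries_smul_mem_lattice hτ hD B ℓ f he
  have hspan : ∀ ℓ (e : Reduction C E ℓ), ∃ n : ℕ, xElt (C⟦X⟧) ^ n • e ∈
      (B ℓ).lattice.carrier := by
    intro ℓ e
    obtain ⟨n, hn⟩ := (B ℓ).lattice.spans e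
    rw [Reduction.smul_def, inclC_xElt_pow] at hn
    exact ⟨n, hn⟩
  have hst : ∀ ℓ, ∀ e ∈ (B ℓ).lattice.carrier, D ℓ e ∈ (B ℓ).lattice.carrier :=
    fun ℓ => (B ℓ).lattice.stable
  let L := limitModel h hD hst hM (B 0).lattice.fg
  refine ⟨limitModule hM, inferInstance, inferInstance, limitConn hD hst hM,
    limitEquiv h hspan, L.finite, ⟨L⟩, ⟨fun ℓ e => ?_, fun ℓ e => ?_⟩,
    fun ℓ => (B ℓ).lattice, L, fun ℓ => (B ℓ).isDeligneManin_lattice, fun ℓ e => ⟨fun he => ?_, ?_⟩,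
    fun e he hte => ?_⟩
  · obtain ⟨e, rfl⟩ := Reduction.mk_surjective ℓ e
    rw [Connection.reduce_mk, limitEquiv_mk, limitEquiv_mk, limitProj_limitConn]
  · obtain ⟨e, rfl⟩ := Reduction.mk_surjective _ e
    rw [Reduction.transition_mk, limitEquiv_mk, limitEquiv_mk, transition_limitProj]
  · obtain ⟨y, hy, hye⟩ := h.exists_lift he
    obtain ⟨w, hw⟩ := exists_limitProj_eq (hM := hM) hy
    refine ⟨w, fun k => ?_, ?_⟩
    · rw [hw]; exact hy.1 k
    · rw [limitEquiv_mk, hw, hye]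
  · rintro ⟨w, hw, rfl⟩
    rw [limitEquiv_mk]
    exact hw ℓ
  · obtain ⟨w, hw⟩ := exists_limitProj_eq (hM := hM)
      (show e ∈ limitGroup (Reduction.transition C E) _ from ⟨he, hte⟩)
    refine ⟨w, ⟨fun k => ?_, fun ℓ => ?_⟩, fun w' hw' => limitProj_ext fun ℓ => ?_⟩
    · rw [hw]; exact he k
    · rw [limitEquiv_mk, hw]
    · rw [hw, ← limitEquiv_mk h hspan]
      exact hw'.2 ℓ

end LimitConnection

end RegSing
end

theorem proposition4p14 (C : Type u) [Field C] [IsAlgClosed C] [CharZero C]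
    (τ : Set C) (hτ : ∀ c : C, ∃! a : C, a ∈ τ ∧ ∃ n : ℤ, c - a = n)
    (hτ0 : ∀ n : ℤ, (n : C) ∈ τ ↔ n = 0)
    (E : Type v) [AddCommGroup E] [Module (C⟦X⟧)⸨X⸩ E] [Module.Finite (C⟦X⟧)⸨X⸩ E]
    (nabla : RegSing.Connection (RegSing.theta (C⟦X⟧)) E) :
    ∃ D : ∀ ℓ : ℕ, RegSing.Connection (RegSing.theta C) (RegSing.Reduction C E ℓ),
      (∀ ℓ : ℕ, RegSing.IsRegularSingularPart (nabla.reduce ℓ) (D ℓ) ∧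
        ∀ D', RegSing.IsRegularSingularPart (nabla.reduce ℓ) D' → D' = D ℓ) ∧
      RegSing.IsCompatibleSystem D ∧
      ∃ (E' : Type (max u v)) (_ : AddCommGroup E') (_ : Module (C⟦X⟧)⸨X⸩ E')
        (nabla' : RegSing.Connection (RegSing.theta (C⟦X⟧)) E')
        (θ : ∀ ℓ : ℕ, RegSing.Reduction C E' ℓ ≃ₗ[(C⟦X⟧)⸨X⸩] RegSing.Reduction C E ℓ),
        Module.Finite (C⟦X⟧)⸨X⸩ E' ∧
        RegSing.IsRegularSingular nabla' ∧
        RegSing.IsReductionIso D nabla' θ ∧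
        RegSing.IsLimit τ D nabla' θ := by
  have hτ₁ : ∀ c : C, ∃ a ∈ τ, ∃ n : ℤ, c - a = n := fun c => by
    obtain ⟨a, ⟨ha, hn⟩, -⟩ := hτ c
    exact ⟨a, ha, hn⟩
  -- Both `a` and `a - n` represent the class of `a` modulo the integers, so they coincide.
  have hτ₂ : ∀ a ∈ τ, ∀ n : ℤ, a - n ∈ τ → n = 0 := fun a ha n hn => by
    have h := (hτ a).unique ⟨ha, 0, by simp⟩ ⟨hn, n, by simp⟩
    exact_mod_cast (by linear_combination h : (n : C) = 0)
  have hfin := fun ℓ => RegSing.Reduction.finite (C := C) (E := E) ℓ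
  choose s S hS using fun ℓ => RegSing.exists_isIrregularPart (nabla.reduce ℓ)
  have hD := RegSing.IsCompatibleSystem.of_isIrregularPart nabla s S hS
  have hB := fun ℓ => ((hS ℓ).exists_eulerBasis hτ₁ hτ₂).some
  exact ⟨fun ℓ => (nabla.reduce ℓ).subLinear (S ℓ),
    fun ℓ => ⟨(hS ℓ).isRegularSingularPart ⟨(hB ℓ).lattice⟩, fun D' h => h.eq_subLinear (hS ℓ)⟩,
    hD, hD.exists_limit hτ₂ hB⟩
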